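/- **Theorem (weighted $L_2$-theory with $\theta=d$ on a half space).** Let $d,d_1\ge 1$ be integers and $\delta>0$. Write $\mathbb{R}^d_+=\{x=(x_1,x')\in\mathbb{R}^d: x_1>0\}$. For $i,j=1,\dots,d$ let $A^{ij}(t)=[a^{ij}_{kr}(t)]_{k,r=1}^{d_1}$ be complex $d_1\times d_1$ matrices, with entries that are measurable functions of $t\in\mathbb{R}$ only, such that for all $t\in\mathbb{R}$ $$|a^{ij}_{kr}(t)|\le\delta^{-1}\quad\text{for all } i,j,k,r,\qquad \Re\Big(\sum_{i,j=1}^d \vartheta^{\mathrm{tr}}\xi_i\xi_jA^{ij}(t)\bar\vartheta\Big)\ge\delta|\xi|^2|\vartheta|^2\quad\text{for all }\xi\in\mathbb{R}^d,\ \vartheta\in\mathbb{C}^{d_1}.$$ Let $T\in(-\infty,\infty]$, $\lambda\ge 0$ and $\Omega_T=(-\infty,T)\times\mathbb{R}^d_+$. Functions on $\Omega_T$ are vector or tensor valued and complex, $|\cdot|$ is the square root of the sum of the squared moduli of all components, $\|\cdot\|_{2,d}$ is the norm of $\mathbb{L}_{2,d}=L_2(\Omega_T;dx\,dt)$ (the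 weight $x_1^{\theta-d}$ is $1$ for $\theta=d$), and $M^k$ denotes multiplication by $x_1^k$. Let $\mathfrak{H}^2_{2,d}$ be the set of $\mathbb{C}^{d_1}$-valued functions $u$ on $\Omega_T$ whose weak derivatives $u_t$, $Du$, $D^2u$ on $\Omega_T$ exist and for which $M^{-1}u,\ Du,\ MD^2u,\ Mu_t\in\mathbb{L}_{2,d}$, with $$\|u\|_{\mathfrak{H}^2_{2,d}}=\|M^{-1}u\|_{2,d}+\|Du\|_{2,d}+\|MD^2u\|_{2,d}+\|Mu_t\|_{2,d}.$$ Consider the system $$-u_t+\sum_{i,j=1}^dA^{ij}(t)D_{ij}u-\lambda u=f\quad\text{a.e. in }\Omega_T.\tag{1}$$ There is a constant $N$ depending only on $d,d_1,\delta$ (not on $A^{ij}$, $T$, $\lambda$, $u$, $f$) such that for every $u\in\mathfrak{H}^2_{2,d}$ satisfying (1) with $Mf\in\mathbb{L}_{2,d}$, $$\lambda\|Mu\|_{2,d}+\sqrt\lambda\,\|MDu\|_{2,d}+\|u\|_{\mathfrak{H}^2_{2,d}}\le N\|Mf\|_{2,d},$$ where the terms with the factors $\lambda$ and $\sqrt\lambda$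 are read as $0$ if $\lambda=0$. Moreover, for every $f$ with $Mf\in\mathbb{L}_{2,d}$ there exists a unique (up to equality a.e. in $\Omega_T$) $u\in\mathfrak{H}^2_{2,d}$ satisfying (1). -/

import Mathlib

open MeasureTheory
open scoped ENNReal NNReal ContDiff

noncomputable section

/-- Space-time points `(t, x)` with `t ∈ ℝ` and `x ∈ ℝ^d`. -/
abbrev SpaceTime (d : ℕ) : Type := ℝ × EuclideanSpace ℝ (Fin d)

/-- The values of the unknown: column vectors in `ℂ^{d₁}` with the Euclidean norm. -/
abbrev Val (d₁ : ℕ) : Type := EuclideanSpace ℂ (Fin d₁)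

/-- The time direction in space-time. -/
def timeDir (d : ℕ) : SpaceTime d := (1, 0)

/-- The `i`-th coordinate direction of space, in space-time. -/
def spaceDir {d : ℕ} (i : Fin d) : SpaceTime d := (0, EuclideanSpace.single i 1)

/-- The domain `(-∞, T) × ℝ^d_+`, where `T ∈ (-∞, ∞]` and `ℝ^d_+` is the set of `x` whose first
coordinate (the coordinate of index `0`) is positive. -/
def halfCylinder (d : ℕ) [NeZero d] (T : WithTop ℝ) : Set (SpaceTime d) :=
  {z | (z.1 : WithTop ℝ) < T ∧ 0 < z.2 0}

/-- Lebesgue measure `dx dt` on `(-∞, T) × ℝ^d_+`. Since the weight `x_1 ^ (θ - d)` is `1` for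
`θ = d`, the space `𝕃_{2,d}` is the space `L_2` of this measure. -/
def cylMeasure (d : ℕ) [NeZero d] (T : WithTop ℝ) : Measure (SpaceTime d) :=
  (volume : Measure (SpaceTime d)).restrict (halfCylinder d T)

/-- `g` is the weak (distributional) derivative of `u` on the set `Ω` in the direction `v`; both
functions are locally integrable on `Ω`, and their values outside `Ω` play no role. -/
def HasWeakDeriv {d d₁ : ℕ} (Ω : Set (SpaceTime d)) (v : SpaceTime d)
    (u g : SpaceTime d → Val d₁) : Prop :=
  LocallyIntegrableOn u Ω ∧ LocallyIntegrableOn g Ω ∧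
    ∀ φ : SpaceTime d → ℝ, ContDiff ℝ ∞ φ → HasCompactSupport φ → tsupport φ ⊆ Ω →
      ∫ z in Ω, (fderiv ℝ φ z v) • u z = -∫ z in Ω, φ z • g z

/-- `u` has a weak derivative on `Ω` in the direction `v`. -/
def HasSomeWeakDeriv {d d₁ : ℕ} (Ω : Set (SpaceTime d)) (v : SpaceTime d)
    (u : SpaceTime d → Val d₁) : Prop :=
  ∃ g : SpaceTime d → Val d₁, HasWeakDeriv Ω v u g

open Classical in
/-- The weak derivative of `u` on `Ω` in the direction `v` (for open `Ω` it is determined up to a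
null set of `Ω`); it is `0` by convention if there is none. -/
def weakDeriv {d d₁ : ℕ} (Ω : Set (SpaceTime d)) (v : SpaceTime d)
    (u : SpaceTime d → Val d₁) : SpaceTime d → Val d₁ :=
  if h : HasSomeWeakDeriv Ω v u then Classical.choose h else 0

section Operators

variable {d d₁ : ℕ} [NeZero d]

/-- `u_t` on `(-∞, T) × ℝ^d_+`. -/
def Dt (T : WithTop ℝ) (u : SpaceTime d → Val d₁) : SpaceTime d → Val d₁ :=
  weakDeriv (halfCylinder d T) (timeDir d) u

/-- `D_i u` on `(-∞, T) × ℝ^d_+`. -/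
def Dx (T : WithTop ℝ) (i : Fin d) (u : SpaceTime d → Val d₁) : SpaceTime d → Val d₁ :=
  weakDeriv (halfCylinder d T) (spaceDir i) u

/-- The full gradient `Du`, with the norm `|Du| = (∑_{k,i} |D_i u^k|²)^{1/2}`. -/
def grad (T : WithTop ℝ) (u : SpaceTime d → Val d₁) :
    SpaceTime d → PiLp 2 (fun _ : Fin d => Val d₁) :=
  fun z => WithLp.toLp 2 (fun i => Dx T i u z)

/-- The full Hessian `D²u`, with the norm `|D²u| = (∑_{k,i,j} |D_{ij} u^k|²)^{1/2}`. -/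
def hess (T : WithTop ℝ) (u : SpaceTime d → Val d₁) :
    SpaceTime d → PiLp 2 (fun _ : Fin d × Fin d => Val d₁) :=
  fun z => WithLp.toLp 2 (fun ij => Dx T ij.1 (Dx T ij.2 u) z)

/-- The operator `M ^ k`, multiplication by `x_1 ^ k`, for `k ∈ ℤ`. -/
def mulM {F : Type*} [SMul ℝ F] (k : ℤ) (g : SpaceTime d → F) : SpaceTime d → F :=
  fun z => (z.2 0) ^ k • g z

/-- Membership in the space `𝔥²_{2,d}((-∞, T) × ℝ^d_+)`: the weak derivatives `u_t`, `D_i u` and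
`D_{ij} u` exist, and `M⁻¹u`, `Du`, `M D²u`, `M u_t` lie in `𝕃_{2,d}`. -/
structure MemH2 (T : WithTop ℝ) (u : SpaceTime d → Val d₁) : Prop where
  hasDt : HasSomeWeakDeriv (halfCylinder d T) (timeDir d) u
  hasDx : ∀ i : Fin d, HasSomeWeakDeriv (halfCylinder d T) (spaceDir i) u
  hasDxx : ∀ i j : Fin d, HasSomeWeakDeriv (halfCylinder d T) (spaceDir i) (Dx T j u)
  memLp_u : MemLp (mulM (-1) u) 2 (cylMeasure d T)
  memLp_grad : MemLp (grad T u) 2 (cylMeasure d T)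
  memLp_hess : MemLp (mulM 1 (hess T u)) 2 (cylMeasure d T)
  memLp_Dt : MemLp (mulM 1 (Dt T u)) 2 (cylMeasure d T)

/-- The norm `‖M⁻¹u‖ + ‖Du‖ + ‖M D²u‖ + ‖M u_t‖` of `𝔥²_{2,d}((-∞, T) × ℝ^d_+)`. -/
def h2Norm (T : WithTop ℝ) (u : SpaceTime d → Val d₁) : ℝ≥0∞ :=
  eLpNorm (mulM (-1) u) 2 (cylMeasure d T) + eLpNorm (grad T u) 2 (cylMeasure d T) +
    eLpNorm (mulM 1 (hess T u)) 2 (cylMeasure d T) + eLpNorm (mulM 1 (Dt T u)) 2 (cylMeasure d T)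

/-- `u` solves `-u_t + ∑_{i,j} A^{ij}(t) D_{ij} u - lam u = f` almost everywhere in
`(-∞, T) × ℝ^d_+`. -/
def SolvesSystem (A : Fin d → Fin d → ℝ → Matrix (Fin d₁) (Fin d₁) ℂ) (T : WithTop ℝ) (lam : ℝ)
    (u f : SpaceTime d → Val d₁) : Prop :=
  ∀ᵐ z ∂(cylMeasure d T),
    -(Dt T u z) +
      ∑ i, ∑ j, WithLp.toLp 2 ((A i j z.1).mulVec (WithLp.ofLp (Dx T i (Dx T j u) z))) -
      lam • u z = f z

end Operators

/-- The standing assumptions on coefficients depending only on `t`: they are (Lebesgue) measurable,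
bounded by `δ⁻¹`, and satisfy the Legendre-Hadamard ellipticity condition with constant `δ`. -/
structure AdmissibleCoeff {d d₁ : ℕ} (δ : ℝ)
    (A : Fin d → Fin d → ℝ → Matrix (Fin d₁) (Fin d₁) ℂ) : Prop where
  measurable : ∀ i j k r, AEMeasurable (fun t => A i j t k r) volume
  bounded : ∀ i j k r t, ‖A i j t k r‖ ≤ δ⁻¹
  elliptic : ∀ (t : ℝ) (ξ : EuclideanSpace ℝ (Fin d)) (θ : EuclideanSpace ℂ (Fin d₁)),
    δ * ‖ξ‖ ^ 2 * ‖θ‖ ^ 2 ≤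
      (∑ i, ∑ j, ∑ k, ∑ r,
        θ k * (ξ i : ℂ) * (ξ j : ℂ) * A i j t k r * (starRingEnd ℂ) (θ r)).re

end

/-! The theorem rests on one energy argument, used for test functions and again for very weak
solutions.

*The energy inequality.* The coefficients depend on time only, so at each time Plancherel's theorem
turns the Legendre-Hadamard condition into the Gårding inequality (`garding`). The equation is
multiplied by the solution and integrated. For `θ = d` the right-hand side splits as `⟨M⁻¹ u, M f⟩`,
and `M⁻¹ u` is bounded by `D u` with Hardy's inequality (`hardy`). This gives the bound of order
one. The function `x_1 u` solves an equation without weight whose right-hand side consists of `M f`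
and first derivatives of `u`, and the operator commutes with spatial derivatives; the energy
inequality for `x_1 u` and for its first derivatives gives the remaining bounds. For smooth
functions with compact support in `ℝ × ℝ^d_+` this is `exists_integral_bound`. Such functions need
not vanish at time `T`: the boundary term there has the good sign.

*Uniqueness.* A very weak solution `v` has all derivatives on test functions `χ(t) η(x)`; only `M⁻¹
v ∈ L²` is assumed. Mollification in space makes it smooth in space and absolutely continuous in
time (`integral_deriv_mul_normSq`), so the energy argument applies to it after multiplication by
cutoffs (`energy_mollified`). The gradients of the cutoffs are of size `1 / x_1`, so that the error
terms are controlled by the part of the norm of `M⁻¹ v` near the boundary and near infinity, which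
tends to zero. Hence very weak solutions vanish (`ae_eq_zero_of_weakIntegrand`). Strong solutions
are very weak ones, even though the coefficients are merely measurable in time
(`weakIntegrand_of_solution`), and this yields `solution_unique`.

*Existence.* The adjoint problem with time reversed is of the same type. A function orthogonal to
all `M (parabolicOp L lam φ)`, for test functions `φ`, gives a very weak solution of it, so these
functions are dense in `L²` (`rangeOp_topologicalClosure`). Approximating `M f` by them, the a
priori estimate makes all weighted derivatives converge, and the limit is a solution that satisfies
the estimate (`exists_solution`). By uniqueness it is the only one, and so every solution satisfies
the estimate. -/

noncomputable section

open Filter Topology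

/-! ### The Gårding inequality -/

section Garding

open scoped SchwartzMap FourierTransform LineDeriv

/-- The derivative of `w` in the direction `v`, as a function of the point. -/
def dv {X F : Type*} [NormedAddCommGroup X] [NormedSpace ℝ X] [NormedAddCommGroup F]
    [NormedSpace ℝ F] (v : X) (w : X → F) : X → F :=
  fun x => fderiv ℝ w x v

/-- The partial derivative `∂_i w` of a function on `ℝ^d`. -/
abbrev pd {d : ℕ} {F : Type*} [NormedAddCommGroup F] [NormedSpace ℝ F] (i : Fin d)
    (w : EuclideanSpace ℝ (Fin d) → F) : EuclideanSpace ℝ (Fin d) → F :=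
  dv (EuclideanSpace.single i 1) w

variable {d d₁ : ℕ}

lemma real_inner_eq_re (x y : Val d₁) : inner ℝ x y = (inner ℂ x y : ℂ).re := by
  simp [PiLp.inner_apply, Complex.re_sum]

/-- The Legendre-Hadamard condition with constant `δ` for a constant coefficient system
`∑ L i j ∂_i ∂_j`: the form is coercive on rank one arguments. Only the real part of the hermitian
form matters, so it is written with the real inner product of `ℂ^{d₁}`. -/
def LegendreHadamard (δ : ℝ) (L : Fin d → Fin d → Val d₁ →L[ℂ] Val d₁) : Prop :=
  ∀ (ξ : EuclideanSpace ℝ (Fin d)) (θ : Val d₁),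
    δ * ‖ξ‖ ^ 2 * ‖θ‖ ^ 2 ≤ ∑ i, ∑ j, ξ i * ξ j * inner ℝ θ (L i j θ)

/-- In `AdmissibleCoeff` the vector `θ` enters without and its conjugate with the factor `A`, so the
condition for `LegendreHadamard` at `θ` is the one for `AdmissibleCoeff` at the conjugate of `θ`. -/
lemma legendreHadamard_of_admissible {δ : ℝ} {A : Fin d → Fin d → ℝ → Matrix (Fin d₁) (Fin d₁) ℂ}
    (hA : AdmissibleCoeff δ A) (t : ℝ) :
    LegendreHadamard δ fun i j => Matrix.toEuclideanCLM (n := Fin d₁) (𝕜 := ℂ) (A i j t) := by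
  intro ξ θ
  have := hA.elliptic t ξ (WithLp.toLp 2 fun k => (starRingEnd ℂ) (θ k))
  have hn : ‖(WithLp.toLp 2 fun k => (starRingEnd ℂ) (θ k) : Val d₁)‖ = ‖θ‖ := by
    simp [EuclideanSpace.norm_eq]
  rw [hn] at this
  refine this.trans (le_of_eq ?_)
  simp only [Complex.re_sum, PiLp.inner_apply, Matrix.ofLp_toEuclideanCLM,
    Matrix.mulVec, dotProduct, Finset.mul_sum]
  refine Finset.sum_congr rfl fun i _ => Finset.sum_congr rfl fun j _ =>
    Finset.sum_congr rfl fun k _ => ?_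
  have h : inner ℝ (θ k) (∑ r, A i j t k r * θ r) =
      ((∑ r, A i j t k r * θ r) * (starRingEnd ℂ) (θ k)).re := by
    simp [Complex.inner, mul_comm]
  rw [h, ← Complex.re_ofReal_mul, Finset.sum_mul, Finset.mul_sum, Complex.re_sum]
  refine Finset.sum_congr rfl fun r _ => ?_
  congr 1
  push_cast
  simp
  ring

/-- The Gårding inequality for constant coefficients. By Plancherel's theorem both sides are
integrals over the frequency `ξ`, where `∂_i w` becomes `2πi ξ_i ŵ`; there the vectors `ξ_i ŵ` form
a rank one argument and the Legendre-Hadamard condition applies pointwise. -/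
theorem garding {δ : ℝ} {L : Fin d → Fin d → Val d₁ →L[ℂ] Val d₁} (hL : LegendreHadamard δ L)
    (w : EuclideanSpace ℝ (Fin d) → Val d₁) (hw : ContDiff ℝ ∞ w) (hc : HasCompactSupport w) :
    δ * ∫ x, ∑ i, ‖pd i w x‖ ^ 2 ≤ ∫ x, ∑ i, ∑ j, inner ℝ (pd i w x) (L i j (pd j w x)) := by
  set f : 𝓢(EuclideanSpace ℝ (Fin d), Val d₁) := hc.toSchwartzMap hw with hf
  let e : Fin d → EuclideanSpace ℝ (Fin d) := fun i => EuclideanSpace.single i 1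
  have hpd : ∀ i x, pd i w x = (∂_{e i} f) x := fun i x => by
    rw [SchwartzMap.lineDerivOp_apply_eq_fderiv]; rfl
  have hF : ∀ i ξ, (𝓕 (∂_{e i} f)) ξ = (2 * Real.pi * Complex.I * (ξ i : ℂ)) • (𝓕 f ξ) := by
    intro i ξ
    rw [SchwartzMap.fourier_lineDerivOp_eq]
    rw [smul_apply, SchwartzMap.smulLeftCLM_apply_apply]
    · rw [RCLike.real_smul_eq_coe_smul (K := ℂ) (inner ℝ ξ (e i)), smul_smul]
      simp [e, EuclideanSpace.inner_single_right]
    · fun_prop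
  -- the sesquilinear form `⟪x, L y⟫`
  let M : (Val d₁ →L[ℂ] Val d₁) → Val d₁ →L⋆[ℂ] Val d₁ →L[ℂ] ℂ := fun T =>
    (innerSL ℂ).comp (ContinuousLinearMap.adjoint T)
  have hM : ∀ T x y, M T x y = inner ℂ x (T y) := fun T x y => by
    simp [M, ContinuousLinearMap.adjoint_inner_left]
  have hint : ∀ (T : Val d₁ →L[ℂ] Val d₁) (g h : 𝓢(EuclideanSpace ℝ (Fin d), Val d₁)),
      Integrable (fun x => (inner ℂ (g x) (T (h x)) : ℂ)) := by
    intro T g h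
    have h1 := (g.memLp 2 volume)
    have h2 := ((h.postcompCLM T).memLp 2 volume)
    have := MemLp.integrable_mul h1.norm h2.norm
    refine this.mono' ?_ (Eventually.of_forall fun x => ?_)
    · exact (Continuous.inner g.continuous (T.continuous.comp h.continuous)).aestronglyMeasurable
    · exact norm_inner_le_norm _ _
  -- Plancherel
  have key : ∀ (T : Val d₁ →L[ℂ] Val d₁) (g h : 𝓢(EuclideanSpace ℝ (Fin d), Val d₁)),
      ∫ x, inner ℝ (g x) (T (h x)) = ∫ ξ, inner ℝ (𝓕 g ξ) (T (𝓕 h ξ)) := by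
    intro T g h
    have h1 := SchwartzMap.integral_sesq_fourier_fourier g h (M T)
    simp only [hM] at h1
    have h2 := congrArg Complex.re h1
    have h3 : ∀ g h : 𝓢(EuclideanSpace ℝ (Fin d), Val d₁), (∫ x, (inner ℂ (g x) (T (h x)) : ℂ)).re =
        ∫ x, inner ℝ (g x) (T (h x)) := by
      intro g h
      simp only [real_inner_eq_re]
      exact (integral_re (hint T g h)).symm
    rw [h3, h3] at h2
    exact h2.symm
  have hintR : ∀ (T : Val d₁ →L[ℂ] Val d₁) (g h : 𝓢(EuclideanSpace ℝ (Fin d), Val d₁)),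
      Integrable (fun x => inner ℝ (g x) (T (h x))) := by
    intro T g h
    simp only [real_inner_eq_re]
    exact (hint T g h).re
  have e1 : ∀ (g : 𝓢(EuclideanSpace ℝ (Fin d), Val d₁)) x,
      ‖g x‖ ^ 2 = inner ℝ (g x) ((ContinuousLinearMap.id ℂ (Val d₁)) (g x)) := by
    intro g x; simp
  -- the squared norm is the case of the identity operator
  simp only [hpd, e1]
  have hsum : ∀ (g : Fin d → 𝓢(EuclideanSpace ℝ (Fin d), Val d₁)),
      ∫ x, ∑ i, ∑ j, inner ℝ (g i x) (L i j (g j x)) =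
        ∫ ξ, ∑ i, ∑ j, inner ℝ (𝓕 (g i) ξ) (L i j (𝓕 (g j) ξ)) := by
    intro g
    rw [integral_finsetSum _ fun i _ => integrable_finsetSum _ fun j _ => hintR _ _ _,
      integral_finsetSum _ fun i _ => integrable_finsetSum _ fun j _ => hintR _ _ _]
    refine Finset.sum_congr rfl fun i _ => ?_
    rw [integral_finsetSum _ fun j _ => hintR _ _ _, integral_finsetSum _ fun j _ => hintR _ _ _]
    exact Finset.sum_congr rfl fun j _ => key _ _ _
  have hsum' : ∀ (g : Fin d → 𝓢(EuclideanSpace ℝ (Fin d), Val d₁)),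
      ∫ x, ∑ i, inner ℝ (g i x) ((ContinuousLinearMap.id ℂ (Val d₁)) (g i x)) =
        ∫ ξ, ∑ i, inner ℝ (𝓕 (g i) ξ) ((ContinuousLinearMap.id ℂ (Val d₁)) (𝓕 (g i) ξ)) := by
    intro g
    rw [integral_finsetSum _ fun i _ => hintR _ _ _, integral_finsetSum _ fun i _ => hintR _ _ _]
    exact Finset.sum_congr rfl fun j _ => key _ _ _
  rw [hsum, hsum', ← integral_const_mul]
  refine integral_mono ?_ ?_ fun ξ => ?_
  · exact (integrable_finsetSum _ fun i _ => hintR _ _ _).const_mul _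
  · exact integrable_finsetSum _ fun i _ => integrable_finsetSum _ fun j _ => hintR _ _ _
  · have := hL ξ (𝓕 f ξ)
    have hs : ∀ (T : Val d₁ →L[ℂ] Val d₁) i j, inner ℝ ((𝓕 (∂_{e i} f)) ξ) (T ((𝓕 (∂_{e j} f)) ξ)) =
        (2 * Real.pi) ^ 2 * (ξ i * ξ j * inner ℝ (𝓕 f ξ) (T (𝓕 f ξ))) := by
      intro T i j
      rw [hF, hF, map_smul, real_inner_eq_re, real_inner_eq_re, inner_smul_left, inner_smul_right]
      rw [← Complex.re_ofReal_mul, ← Complex.re_ofReal_mul]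
      congr 1
      have h2 : (starRingEnd ℂ) 2 = 2 := map_ofNat _ 2
      simp [h2]
      ring_nf
      simp
    simp only [hs]
    simp only [← Finset.mul_sum]
    rw [mul_left_comm]
    refine mul_le_mul_of_nonneg_left ?_ (by positivity)
    refine le_trans (le_of_eq ?_) this
    rw [← Finset.sum_mul, EuclideanSpace.norm_eq ξ, Real.sq_sqrt (by positivity)]
    simp [sq, mul_assoc]

end Garding

/-- Smooth functions with compact support, with values in any normed space. -/
structure IsTest {X F : Type*} [NormedAddCommGroup X] [NormedSpace ℝ X] [NormedAddCommGroup F]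
    [NormedSpace ℝ F] (w : X → F) : Prop where
  smooth : ContDiff ℝ ∞ w
  compact : HasCompactSupport w

/-! ### Test functions -/

section Test

variable {X F G W : Type*} [NormedAddCommGroup X] [NormedSpace ℝ X] [NormedAddCommGroup F]
  [NormedSpace ℝ F] [NormedAddCommGroup G] [NormedSpace ℝ G] [NormedAddCommGroup W]
  [NormedSpace ℝ W]

lemma dv_smooth {w : X → F} (hw : ContDiff ℝ ∞ w) (v : X) : ContDiff ℝ ∞ (dv v w) :=
  (hw.fderiv_right (m := ∞) (by simp)).clm_apply contDiff_const

lemma tsupport_dv_subset (w : X → F) (v : X) : tsupport (dv v w) ⊆ tsupport w :=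
  (closure_mono fun x hx => by
    contrapose! hx
    simp only [Function.mem_support, not_not] at hx ⊢
    simp [dv, hx]).trans (tsupport_fderiv_subset ℝ (f := w))

lemma IsTest.dv {w : X → F} (hw : IsTest w) (v : X) : IsTest (dv v w) :=
  ⟨dv_smooth hw.smooth v, hw.compact.mono' (subset_closure.trans (tsupport_dv_subset w v))⟩

lemma IsTest.continuous {w : X → F} (hw : IsTest w) : Continuous w := hw.smooth.continuous

lemma IsTest.differentiable {w : X → F} (hw : IsTest w) : Differentiable ℝ w :=
  hw.smooth.differentiable (by simp)

lemma IsTest.add {w u : X → F} (hw : IsTest w) (hu : IsTest u) : IsTest (fun x => w x + u x) :=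
  ⟨hw.smooth.add hu.smooth, hw.compact.add hu.compact⟩

lemma IsTest.neg {w : X → F} (hw : IsTest w) : IsTest (fun x => - w x) :=
  ⟨hw.smooth.neg, hw.compact.neg⟩

lemma IsTest.sub {w u : X → F} (hw : IsTest w) (hu : IsTest u) : IsTest (fun x => w x - u x) := by
  simpa [sub_eq_add_neg] using hw.add hu.neg

lemma IsTest.sum {ι : Type*} (s : Finset ι) {w : ι → X → F} (hw : ∀ i, IsTest (w i)) :
    IsTest (fun x => ∑ i ∈ s, w i x) := by
  classical
  induction s using Finset.induction_on with
  | empty => exact ⟨by simpa using contDiff_const, by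
      simpa using! (HasCompactSupport.zero : HasCompactSupport (0 : X → F))⟩
  | insert a s ha ih => simpa [Finset.sum_insert ha] using (hw a).add ih

lemma IsTest.smul_left {a : X → ℝ} {w : X → F} (ha : ContDiff ℝ ∞ a) (hw : IsTest w) :
    IsTest (fun x => a x • w x) :=
  ⟨ha.smul hw.smooth, hw.compact.smul_left (f := a)⟩

lemma IsTest.smul_right {a : X → ℝ} {w : X → F} (ha : IsTest a) (hw : ContDiff ℝ ∞ w) :
    IsTest (fun x => a x • w x) :=
  ⟨ha.smooth.smul hw, ha.compact.smul_right (f' := w)⟩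

lemma IsTest.clm (T : F →L[ℝ] G) {w : X → F} (hw : IsTest w) : IsTest (fun x => T (w x)) :=
  ⟨T.contDiff.comp hw.smooth, hw.compact.comp_left (map_zero T)⟩

lemma dv_clm (T : F →L[ℝ] G) {w : X → F} (hw : Differentiable ℝ w) (v : X) :
    dv v (fun x => T (w x)) = fun x => T (dv v w x) := by
  ext x
  have := (T.hasFDerivAt (x := w x)).comp x (hw x).hasFDerivAt
  simp only [dv]
  rw [show (fun x => T (w x)) = T ∘ w from rfl, this.fderiv]
  rfl

lemma dv_add {w u : X → F} (hw : Differentiable ℝ w) (hu : Differentiable ℝ u) (v : X) :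
    dv v (fun x => w x + u x) = fun x => dv v w x + dv v u x := by
  ext x; simp [dv, fderiv_fun_add (hw x) (hu x)]

lemma dv_sub {w u : X → F} (hw : Differentiable ℝ w) (hu : Differentiable ℝ u) (v : X) :
    dv v (fun x => w x - u x) = fun x => dv v w x - dv v u x := by
  ext x; simp [dv, fderiv_fun_sub (hw x) (hu x)]

lemma dv_neg (w : X → F) (v : X) :
    dv v (fun x => - w x) = fun x => - dv v w x := by
  ext x; simp [dv]

lemma dv_sum {ι : Type*} (s : Finset ι) {w : ι → X → F} (hw : ∀ i, Differentiable ℝ (w i)) (v : X) :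
    dv v (fun x => ∑ i ∈ s, w i x) = fun x => ∑ i ∈ s, dv v (w i) x := by
  ext x; simp [dv, fderiv_fun_sum (fun i _ => hw i x)]

lemma dv_smul {a : X → ℝ} {w : X → F} (ha : Differentiable ℝ a) (hw : Differentiable ℝ w) (v : X) :
    dv v (fun x => a x • w x) = fun x => a x • dv v w x + dv v a x • w x := by
  ext x; simp [dv, fderiv_fun_smul (ha x) (hw x)]

lemma dv_const_smul (a : ℝ) {w : X → F} (hw : Differentiable ℝ w) (v : X) :
    dv v (fun x => a • w x) = fun x => a • dv v w x := by
  ext x; simp [dv, fderiv_fun_const_smul (hw x)]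

lemma dv_comm {w : X → F} (hw : ContDiff ℝ ∞ w) (v v' : X) : dv v (dv v' w) = dv v' (dv v w) := by
  ext x
  have h : IsSymmSndFDerivAt ℝ w x :=
    (hw.contDiffAt).isSymmSndFDerivAt (by simp; exact WithTop.coe_le_coe.2 le_top)
  have hd : DifferentiableAt ℝ (fderiv ℝ w) x :=
    ((hw.fderiv_right (m := ∞) (by simp)).differentiable (by simp)) x
  have e : ∀ u u' : X, dv u (dv u' w) x = fderiv ℝ (fderiv ℝ w) x u u' := fun u u' => by
    have : fderiv ℝ (fun y => fderiv ℝ w y u') x = _ := fderiv_clm_apply hd (differentiableAt_const u')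
    rw [show dv u (dv u' w) x = fderiv ℝ (fun y => fderiv ℝ w y u') x u from rfl, this]
    simp
  rw [e, e]
  exact h v v'

variable [MeasurableSpace X] [BorelSpace X] {μ : Measure X}

lemma IsTest.integrable [IsFiniteMeasureOnCompacts μ] {w : X → F} (hw : IsTest w) :
    Integrable w μ := hw.continuous.integrable_of_hasCompactSupport hw.compact

/-- Integration by parts without boundary terms. -/
lemma integral_inner_dv [FiniteDimensional ℝ X] [μ.IsAddHaarMeasure] {H : Type*}
    [NormedAddCommGroup H] [InnerProductSpace ℝ H] {f g : X → H} (hf : ContDiff ℝ ∞ f)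
    (hg : IsTest g) (v : X) :
    ∫ x, inner ℝ (f x) (dv v g x) ∂μ = - ∫ x, inner ℝ (dv v f x) (g x) ∂μ := by
  have hI : ∀ {a b : X → H}, Continuous a → Continuous b → HasCompactSupport b →
      Integrable (fun x => inner ℝ (a x) (b x)) μ := fun ha hb hc =>
    (ha.inner hb).integrable_of_hasCompactSupport (hc.mono fun x hx => by
      contrapose! hx
      simp only [Function.mem_support, not_not] at hx ⊢
      simp [hx])
  exact integral_bilinear_fderiv_right_eq_neg_left_of_integrable (B := innerSL ℝ) (μ := μ)
    (hI (dv_smooth hf v).continuous hg.continuous hg.compact)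
    (hI hf.continuous (hg.dv v).continuous (hg.dv v).compact)
    (hI hf.continuous hg.continuous hg.compact)
    (fun x _ => hf.differentiable (by simp) x) (fun x _ => hg.differentiable x)

lemma IsTest.inner_integrable [IsFiniteMeasureOnCompacts μ] {H : Type*}
    [NormedAddCommGroup H] [InnerProductSpace ℝ H] {f g : X → H} (hf : Continuous f)
    (hg : IsTest g) : Integrable (fun x => inner ℝ (f x) (g x)) μ :=
  (hf.inner hg.continuous).integrable_of_hasCompactSupport (hg.compact.mono fun x hx => by
    contrapose! hx
    simp only [Function.mem_support, not_not] at hx ⊢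
    simp [hx])

lemma IsTest.normSq_integrable [IsFiniteMeasureOnCompacts μ] {f : X → F} (hf : IsTest f) :
    Integrable (fun x => ‖f x‖ ^ 2) μ :=
  (hf.continuous.norm.pow 2).integrable_of_hasCompactSupport (hf.compact.mono fun x hx => by
    contrapose! hx
    simp only [Function.mem_support, not_not] at hx ⊢
    simp [hx])

end Test

/-! ### Hardy's inequality -/

section Space

variable {d d₁ : ℕ}

lemma coord_smooth (i : Fin d) : ContDiff ℝ ∞ fun x : EuclideanSpace ℝ (Fin d) => x i :=
  (EuclideanSpace.proj (𝕜 := ℝ) i).contDiff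

lemma pd_coord (i j : Fin d) (x : EuclideanSpace ℝ (Fin d)) :
    pd i (fun x : EuclideanSpace ℝ (Fin d) => x j) x = if j = i then 1 else 0 := by
  have := (EuclideanSpace.proj (𝕜 := ℝ) j : EuclideanSpace ℝ (Fin d) →L[ℝ] ℝ).hasFDerivAt (x := x)
  simp only [pd, dv]
  rw [show (fun x : EuclideanSpace ℝ (Fin d) => x j) =
    (EuclideanSpace.proj (𝕜 := ℝ) j : EuclideanSpace ℝ (Fin d) →L[ℝ] ℝ) from rfl, this.fderiv]
  simp

variable [NeZero d]

/-- Hardy's inequality for `x_1 Y`. The identity `∂_1 (x_1 Y) = x_1 ∂_1 Y + Y` is tested with `Y`,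
and `x_1 ⟨Y, ∂_1 Y⟩` is integrated by parts. -/
lemma hardy_mul {Y : EuclideanSpace ℝ (Fin d) → Val d₁} (hY : IsTest Y) :
    ∫ x, ‖Y x‖ ^ 2 ≤ 4 * ∫ x, ‖pd 0 (fun x => x 0 • Y x) x‖ ^ 2 := by
  have hZ : IsTest (fun x => x 0 • Y x) := hY.smul_left (coord_smooth 0)
  have e : ∀ x, pd 0 (fun x => x 0 • Y x) x = x 0 • pd 0 Y x + Y x := fun x => by
    have := congrFun (dv_smul ((coord_smooth (0 : Fin d)).differentiable (by simp))
      hY.differentiable (EuclideanSpace.single 0 1)) x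
    simp only [pd] at this ⊢
    rw [this]
    have h2 := pd_coord (0 : Fin d) 0 x
    simp only [pd] at h2
    simp [h2]
  have h1 := integral_inner_dv (μ := volume) hY.smooth hZ (EuclideanSpace.single 0 1)
  have h2 : ∀ x, inner ℝ (pd 0 Y x) (x 0 • Y x) =
      inner ℝ (Y x) (pd 0 (fun x => x 0 • Y x) x) - ‖Y x‖ ^ 2 := fun x => by
    rw [e, inner_add_right, real_inner_self_eq_norm_sq, inner_smul_right, inner_smul_right,
      real_inner_comm]
    ring
  simp only [pd] at h2
  simp only [h2] at h1
  have hI := IsTest.inner_integrable (μ := volume) hY.continuous (hZ.dv (EuclideanSpace.single 0 1))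
  have hI2 := hY.normSq_integrable (μ := volume)
  have hI3 := (hZ.dv (EuclideanSpace.single 0 1)).normSq_integrable (μ := volume)
  rw [integral_sub hI hI2] at h1
  have h3 : ∫ x, inner ℝ (Y x) (pd 0 (fun x => x 0 • Y x) x) ≤
      ∫ x, ((1 / 4) * ‖Y x‖ ^ 2 + ‖pd 0 (fun x => x 0 • Y x) x‖ ^ 2) := by
    refine integral_mono hI ((hI2.const_mul _).add hI3) fun x => ?_
    have := real_inner_le_norm (Y x) (pd 0 (fun x => x 0 • Y x) x)
    refine this.trans ?_
    nlinarith [sq_nonneg ((1 / 2) * ‖Y x‖ - ‖pd 0 (fun x => x 0 • Y x) x‖)]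
  rw [integral_add (hI2.const_mul _) hI3, integral_const_mul] at h3
  simp only [pd] at h3 ⊢
  linarith

/-- Smoothness may be checked on the support. -/
lemma contDiff_of_forall_tsupport {X F : Type*} [NormedAddCommGroup X] [NormedSpace ℝ X]
    [NormedAddCommGroup F] [NormedSpace ℝ F] {f : X → F}
    (h : ∀ x ∈ tsupport f, ContDiffAt ℝ ∞ f x) : ContDiff ℝ ∞ f := by
  rw [contDiff_iff_contDiffAt]
  intro x
  by_cases hx : x ∈ tsupport f
  · exact h x hx
  · exact contDiffAt_const.congr_of_eventuallyEq (notMem_tsupport_iff_eventuallyEq.1 hx)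

lemma IsTest.inv_coord_smul {F : Type*} [NormedAddCommGroup F] [NormedSpace ℝ F]
    {Y : EuclideanSpace ℝ (Fin d) → F} (hY : IsTest Y)
    (hs : tsupport Y ⊆ {x | 0 < x 0}) : IsTest (fun x => (x 0)⁻¹ • Y x) := by
  refine ⟨contDiff_of_forall_tsupport fun x hx => ?_, ?_⟩
  swap
  · exact hY.compact.mono (Function.support_smul_subset_right
      (fun x : EuclideanSpace ℝ (Fin d) => (x 0)⁻¹) Y)
  have hx' : x ∈ {x : EuclideanSpace ℝ (Fin d) | 0 < x 0} :=
    hs (tsupport_smul_subset_right (fun x : EuclideanSpace ℝ (Fin d) => (x 0)⁻¹) Y hx)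
  have hx' : 0 < x 0 := hx'
  have h1 : ContDiffAt ℝ ∞ (fun x : EuclideanSpace ℝ (Fin d) => x 0) x := (coord_smooth 0).contDiffAt
  exact (h1.inv hx'.ne').smul hY.smooth.contDiffAt

/-- Hardy's inequality in the half space. -/
lemma hardy {Y : EuclideanSpace ℝ (Fin d) → Val d₁} (hY : IsTest Y)
    (hs : tsupport Y ⊆ {x | 0 < x 0}) :
    ∫ x, ‖(x 0)⁻¹ • Y x‖ ^ 2 ≤ 4 * ∫ x, ‖pd 0 Y x‖ ^ 2 := by
  have := hardy_mul (hY.inv_coord_smul hs)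
  have e : (fun x => x 0 • (x 0)⁻¹ • Y x) = Y := by
    ext1 x
    by_cases h : x ∈ tsupport Y
    · have : 0 < x 0 := hs h
      rw [smul_inv_smul₀ this.ne']
    · rw [image_eq_zero_of_notMem_tsupport h]; simp
  rwa [e] at this

end Space

/-! ### The Gårding inequality with a cutoff -/

section GardingCutoff

variable {d d₁ : ℕ}

lemma abs_inner_clm_le {K : ℝ} {T : Val d₁ →L[ℂ] Val d₁} (hT : ‖T‖ ≤ K) (x y : Val d₁) :
    |inner ℝ x (T y)| ≤ K * (‖x‖ * ‖y‖) := by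
  refine (abs_real_inner_le_norm _ _).trans ?_
  calc ‖x‖ * ‖T y‖ ≤ ‖x‖ * (K * ‖y‖) := by gcongr; exact T.le_of_opNorm_le hT y
    _ = K * (‖x‖ * ‖y‖) := by ring

lemma two_mul_le_young {δ : ℝ} (hδ : 0 < δ) (n a b : ℝ) (hn : 0 < n) :
    2 * a * b ≤ δ / (2 * n) * a ^ 2 + 2 * n / δ * b ^ 2 := by
  have h : 0 ≤ (2 * n) / δ * (b - δ / (2 * n) * a) ^ 2 := by positivity
  have : (2 * n) / δ * (b - δ / (2 * n) * a) ^ 2 =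
    δ / (2 * n) * a ^ 2 + 2 * n / δ * b ^ 2 - 2 * a * b := by field_simp; ring
  linarith

/-- The pointwise inequality behind `garding_cutoff`. There `p` is the gradient of `ζ W` and `z` the
gradient of `ζ`; the terms in which the cutoff is differentiated are absorbed with Young's
inequality, at the price of half of the coercivity. -/
lemma cutoff_pointwise [NeZero d] {δ K : ℝ} (hδ : 0 < δ)
    {L : Fin d → Fin d → Val d₁ →L[ℂ] Val d₁}
    (hK : ∀ i j, ‖L i j‖ ≤ K) (p : Fin d → Val d₁) (z : Fin d → ℝ) (W : Val d₁) :
    ∑ i, ∑ j, inner ℝ (p i) (L i j (p j)) - δ / 2 * ∑ i, ‖p i‖ ^ 2 -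
      (2 * K ^ 2 * d / δ + K) * ((∑ i, |z i|) ^ 2 * ‖W‖ ^ 2) ≤
    ∑ i, ∑ j, inner ℝ (z i • W + p i) (L i j (p j - z j • W)) := by
  have hd : (0 : ℝ) < d := Nat.cast_pos.2 (NeZero.pos d)
  have h1 : ∀ i j, inner ℝ (p i) (L i j (p j)) - (K * ‖W‖) * (‖p i‖ * |z j|) -
      (K * ‖W‖) * (|z i| * ‖p j‖) - (K * ‖W‖ ^ 2) * (|z i| * |z j|) ≤
      inner ℝ (z i • W + p i) (L i j (p j - z j • W)) := by
    intro i j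
    have e : inner ℝ (z i • W + p i) (L i j (p j - z j • W)) = inner ℝ (p i) (L i j (p j)) -
        inner ℝ (p i) (L i j (z j • W)) + inner ℝ (z i • W) (L i j (p j)) -
        inner ℝ (z i • W) (L i j (z j • W)) := by
      rw [map_sub, inner_add_left, inner_sub_right, inner_sub_right]; ring
    have a1 := (abs_le.1 (abs_inner_clm_le (hK i j) (p i) (z j • W))).2
    have a2 := (abs_le.1 (abs_inner_clm_le (hK i j) (z i • W) (p j))).1
    have a3 := (abs_le.1 (abs_inner_clm_le (hK i j) (z i • W) (z j • W))).2
    simp only [norm_smul, Real.norm_eq_abs] at a1 a2 a3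
    rw [e]
    linarith
  have h2 := Finset.sum_le_sum fun i (_ : i ∈ Finset.univ) =>
    Finset.sum_le_sum fun j (_ : j ∈ Finset.univ) => h1 i j
  refine le_trans ?_ h2
  simp only [Finset.sum_sub_distrib, ← Finset.mul_sum, ← Finset.sum_mul]
  set a := ∑ i, ‖p i‖
  set b := ∑ i, |z i|
  have h3 : a ^ 2 ≤ d * ∑ i, ‖p i‖ ^ 2 := by
    simpa using sq_sum_le_card_mul_sum_sq (s := Finset.univ) (f := fun i => ‖p i‖)
  have h4 := two_mul_le_young hδ d a (K * ‖W‖ * b) hd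
  have h5 : δ / (2 * d) * a ^ 2 ≤ δ / 2 * ∑ i, ‖p i‖ ^ 2 := by
    calc δ / (2 * d) * a ^ 2 ≤ δ / (2 * d) * (d * ∑ i, ‖p i‖ ^ 2) := by gcongr
      _ = _ := by field_simp
  have h6 : 2 * d / δ * (K * ‖W‖ * b) ^ 2 = 2 * K ^ 2 * d / δ * (b ^ 2 * ‖W‖ ^ 2) := by ring
  nlinarith

/-- The Gårding inequality for a smooth function multiplied by a cutoff in the half space, with
Hardy's inequality built in: `M⁻¹ ζ W` is controlled by the elliptic operator tested with `ζ² W`, up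
to an error supported where the gradient of the cutoff does not vanish. -/
lemma garding_cutoff [NeZero d] {δ K : ℝ} (hδ : 0 < δ)
    {L : Fin d → Fin d → Val d₁ →L[ℂ] Val d₁} (hL : LegendreHadamard δ L)
    (hK : ∀ i j, ‖L i j‖ ≤ K) {W : EuclideanSpace ℝ (Fin d) → Val d₁} (hW : ContDiff ℝ ∞ W)
    {ζ : EuclideanSpace ℝ (Fin d) → ℝ} (hζ : IsTest ζ) (hs : tsupport ζ ⊆ {x | 0 < x 0}) :
    δ / 8 * (∫ x, ‖(x 0)⁻¹ • ζ x • W x‖ ^ 2) +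
      ∫ x, ζ x ^ 2 * ∑ i, ∑ j, inner ℝ (W x) (L i j (pd i (pd j W) x)) ≤
    (2 * K ^ 2 * d / δ + K) * ∫ x, (∑ i, |pd i ζ x|) ^ 2 * ‖W x‖ ^ 2 := by
  set U : EuclideanSpace ℝ (Fin d) → Val d₁ := fun x => ζ x • W x with hU
  have hUt : IsTest U := hζ.smul_right hW
  have hUs : tsupport U ⊆ {x | 0 < x 0} := (closure_mono fun x hx => by
    contrapose! hx
    simp only [Function.mem_support, not_not] at hx ⊢
    simp [hU, hx]).trans hs
  have hζU : IsTest (fun x => ζ x • U x) := hUt.smul_left hζ.smooth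
  have hdW : ∀ j, ContDiff ℝ ∞ (pd j W) := fun j => dv_smooth hW _
  have hLW : ∀ i j, ContDiff ℝ ∞ fun x => L i j (pd j W x) := fun i j =>
    ((L i j).restrictScalars ℝ).contDiff.comp (hdW j)
  have ibp : ∀ i j, ∫ x, inner ℝ (pd i (fun x => L i j (pd j W x)) x) (ζ x • U x) =
      - ∫ x, inner ℝ (L i j (pd j W x)) (pd i (fun x => ζ x • U x) x) := fun i j => by
    rw [integral_inner_dv (μ := volume) (hLW i j) hζU, neg_neg]
  have hI1 : ∀ i j, Integrable fun x =>
      inner ℝ (pd i (fun x => L i j (pd j W x)) x) (ζ x • U x) := fun i j =>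
    IsTest.inner_integrable (dv_smooth (hLW i j) _).continuous hζU
  have hI2 : ∀ i j, Integrable fun x =>
      inner ℝ (L i j (pd j W x)) (pd i (fun x => ζ x • U x) x) := fun i j =>
    IsTest.inner_integrable (hLW i j).continuous (hζU.dv _)
  have e1 : ∫ x, ζ x ^ 2 * ∑ i, ∑ j, inner ℝ (W x) (L i j (pd i (pd j W) x)) =
      - ∫ x, ∑ i, ∑ j, inner ℝ (L i j (pd j W x)) (pd i (fun x => ζ x • U x) x) := by
    rw [integral_finsetSum _ fun i _ => integrable_finsetSum _ fun j _ => hI2 i j,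
      ← Finset.sum_neg_distrib]
    simp_rw [fun i => integral_finsetSum (μ := volume) Finset.univ fun j _ => hI2 i j,
      ← Finset.sum_neg_distrib, ← ibp,
      ← fun i => integral_finsetSum (μ := volume) Finset.univ fun j _ => hI1 i j]
    rw [← integral_finsetSum _ fun i _ => integrable_finsetSum _ fun j _ => hI1 i j]
    congr 1
    ext1 x
    simp only [Finset.mul_sum]
    refine Finset.sum_congr rfl fun i _ => Finset.sum_congr rfl fun j _ => ?_
    have := congrFun (dv_clm ((L i j).restrictScalars ℝ) ((hdW j).differentiable (by simp))
      (EuclideanSpace.single i 1)) x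
    simp only [ContinuousLinearMap.coe_restrictScalars'] at this
    rw [show pd i (fun x => L i j (pd j W x)) x = L i j (pd i (pd j W) x) from this]
    rw [hU, inner_smul_right, inner_smul_right, real_inner_comm, ← mul_assoc, sq]
  have hz : ∀ i x, pd i U x = ζ x • pd i W x + pd i ζ x • W x := fun i x =>
    congrFun (dv_smul hζ.differentiable (hW.differentiable (by simp)) _) x
  have hz2 : ∀ i x, pd i (fun x => ζ x • U x) x = ζ x • pd i U x + pd i ζ x • U x := fun i x =>
    congrFun (dv_smul hζ.differentiable hUt.differentiable _) x
  have e2 : ∀ x, ∑ i, ∑ j, inner ℝ (L i j (pd j W x)) (pd i (fun x => ζ x • U x) x) =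
      ∑ i, ∑ j, inner ℝ (pd i ζ x • W x + pd i U x) (L i j (pd j U x - pd j ζ x • W x)) := by
    intro x
    refine Finset.sum_congr rfl fun i _ => Finset.sum_congr rfl fun j _ => ?_
    have e3 : pd j U x - pd j ζ x • W x = ζ x • pd j W x := by rw [hz]; abel
    have e4 : pd i (fun x => ζ x • U x) x = ζ x • (pd i ζ x • W x + pd i U x) := by
      rw [hz2, smul_add, add_comm, hU, smul_comm]
    rw [e3, e4, ← Complex.coe_smul (ζ x) (pd j W x), map_smul, Complex.coe_smul,
      inner_smul_right, inner_smul_right, real_inner_comm]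
  have hg := garding hL U hUt.smooth hUt.compact
  have hp1 : Integrable fun x => ∑ i, ‖pd i U x‖ ^ 2 :=
    integrable_finsetSum _ fun i _ => (hUt.dv _).normSq_integrable
  have hp2 : Integrable fun x => ∑ i, ∑ j, inner ℝ (pd i U x) (L i j (pd j U x)) :=
    integrable_finsetSum _ fun i _ => integrable_finsetSum _ fun j _ =>
      IsTest.inner_integrable (hUt.dv _).continuous
        ((hUt.dv (EuclideanSpace.single j 1)).clm ((L i j).restrictScalars ℝ))
  have hp3 : Integrable fun x => (∑ i, |pd i ζ x|) ^ 2 * ‖W x‖ ^ 2 := by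
    refine Continuous.integrable_of_hasCompactSupport ?_ ?_
    · have : ∀ i, Continuous (pd i ζ) := fun i => (hζ.dv _).continuous
      have hWc := hW.continuous
      fun_prop
    · refine hζ.compact.mono' fun x hx => ?_
      by_contra h
      refine hx ?_
      have : ∀ i, pd i ζ x = 0 := fun i =>
        image_eq_zero_of_notMem_tsupport fun h' => h (tsupport_dv_subset _ _ h')
      simp [this]
  have hp4 : Integrable fun x =>
      ∑ i, ∑ j, inner ℝ (L i j (pd j W x)) (pd i (fun x => ζ x • U x) x) :=
    integrable_finsetSum _ fun i _ => integrable_finsetSum _ fun j _ => hI2 i j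
  have hp12 : Integrable fun x => ∑ i, ∑ j, inner ℝ (pd i U x) (L i j (pd j U x)) -
      δ / 2 * ∑ i, ‖pd i U x‖ ^ 2 := hp2.sub (hp1.const_mul (δ / 2))
  have hm := integral_mono ((hp2.sub (hp1.const_mul (δ / 2))).sub
    (hp3.const_mul (2 * K ^ 2 * d / δ + K))) hp4 fun x => by
      rw [e2 x]
      exact cutoff_pointwise hδ hK (fun i => pd i U x) (fun i => pd i ζ x) (W x)
  have hhardy := hardy hUt hUs
  have hle : ∫ x, ‖pd 0 U x‖ ^ 2 ≤ ∫ x, ∑ i, ‖pd i U x‖ ^ 2 :=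
    integral_mono (hUt.dv _).normSq_integrable hp1 fun x =>
      Finset.single_le_sum (f := fun i => ‖pd i U x‖ ^ 2) (fun i _ => by positivity)
        (Finset.mem_univ 0)
  simp only [Pi.sub_apply] at hm
  rw [integral_sub hp12 (hp3.const_mul _), integral_sub hp2 (hp1.const_mul (δ / 2)),
    integral_const_mul, integral_const_mul] at hm
  rw [e1]
  have : δ / 8 * (∫ x, ‖(x 0)⁻¹ • ζ x • W x‖ ^ 2) ≤ δ / 2 * ∫ x, ∑ i, ‖pd i U x‖ ^ 2 := by
    nlinarith
  linarith

/-- `garding_cutoff` as an inequality for a single integral. -/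
lemma garding_cutoff_integral [NeZero d] {δ K : ℝ} (hδ : 0 < δ)
    {L : Fin d → Fin d → Val d₁ →L[ℂ] Val d₁} (hL : LegendreHadamard δ L)
    (hK : ∀ i j, ‖L i j‖ ≤ K) {W : EuclideanSpace ℝ (Fin d) → Val d₁} (hW : ContDiff ℝ ∞ W)
    {ζ : EuclideanSpace ℝ (Fin d) → ℝ} (hζ : IsTest ζ) (hs : tsupport ζ ⊆ {x | 0 < x 0}) :
    ∫ x, (δ / 8 * (((x 0)⁻¹ * ζ x) ^ 2 * ‖W x‖ ^ 2) +
      ∑ i, ∑ j, ζ x ^ 2 * inner ℝ (L i j (pd i (pd j W) x)) (W x) -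
      (2 * K ^ 2 * d / δ + K) * ((∑ i, |pd i ζ x|) ^ 2 * ‖W x‖ ^ 2)) ≤ 0 := by
  have hWc := hW.continuous
  have hsub : ∀ {g : EuclideanSpace ℝ (Fin d) → ℝ}, (∀ x, x ∉ tsupport ζ → g x = 0) →
      HasCompactSupport g := fun h => hζ.compact.mono' fun x hx => by
    by_contra h'
    exact hx (h x h')
  have hζ0 : ∀ x, x ∉ tsupport ζ → ζ x = 0 := fun x hx => image_eq_zero_of_notMem_tsupport hx
  have i1 : Integrable fun x => ((x 0)⁻¹ * ζ x) ^ 2 * ‖W x‖ ^ 2 := by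
    refine Continuous.integrable_of_hasCompactSupport ?_ (hsub fun x hx => by simp [hζ0 x hx])
    have := (hζ.inv_coord_smul hs).continuous
    simp only [smul_eq_mul] at this
    fun_prop
  have i2 : Integrable fun x => ∑ i, ∑ j, ζ x ^ 2 * inner ℝ (L i j (pd i (pd j W) x)) (W x) := by
    refine Continuous.integrable_of_hasCompactSupport ?_ (hsub fun x hx => by simp [hζ0 x hx])
    have h1 : ∀ i j, Continuous (pd i (pd j W)) := fun i j =>
      (dv_smooth (dv_smooth hW _) _).continuous
    have h2 := hζ.continuous
    fun_prop
  have i3 : Integrable fun x => (∑ i, |pd i ζ x|) ^ 2 * ‖W x‖ ^ 2 := by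
    refine Continuous.integrable_of_hasCompactSupport ?_ (hsub fun x hx => ?_)
    · have : ∀ i, Continuous (pd i ζ) := fun i => (hζ.dv _).continuous
      fun_prop
    · have : ∀ i, pd i ζ x = 0 := fun i =>
        image_eq_zero_of_notMem_tsupport fun h' => hx (tsupport_dv_subset _ _ h')
      simp [this]
  have i12 : Integrable fun x => δ / 8 * (((x 0)⁻¹ * ζ x) ^ 2 * ‖W x‖ ^ 2) +
      ∑ i, ∑ j, ζ x ^ 2 * inner ℝ (L i j (pd i (pd j W) x)) (W x) := (i1.const_mul _).add i2
  rw [integral_sub i12 (i3.const_mul _), integral_add (i1.const_mul _) i2, integral_const_mul,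
    integral_const_mul]
  have := garding_cutoff hδ hL hK hW hζ hs
  have e1 : ∀ x, ‖(x 0)⁻¹ • ζ x • W x‖ ^ 2 = ((x 0)⁻¹ * ζ x) ^ 2 * ‖W x‖ ^ 2 := fun x => by
    rw [smul_smul, norm_smul, mul_pow, Real.norm_eq_abs, sq_abs]
  have e2 : ∀ x, ζ x ^ 2 * ∑ i, ∑ j, inner ℝ (W x) (L i j (pd i (pd j W) x)) =
      ∑ i, ∑ j, ζ x ^ 2 * inner ℝ (L i j (pd i (pd j W) x)) (W x) := fun x => by
    simp only [Finset.mul_sum, real_inner_comm (W x)]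
  simp only [e1, e2] at this
  linarith

end GardingCutoff

/-! ### Weak derivatives on the line -/

section OneDim

open Set

lemma exists_Icc_of_isCompact {a b : ℝ} (hab : a < b) {K : Set ℝ} (hK : IsCompact K)
    (h : K ⊆ Ioo a b) : ∃ a' b', a < a' ∧ b' < b ∧ K ⊆ Icc a' b' := by
  have hK' : IsCompact (insert ((a + b) / 2) K) := hK.insert _
  have h' : insert ((a + b) / 2) K ⊆ Ioo a b :=
    insert_subset ⟨by linarith, by linarith⟩ h
  obtain ⟨m, hm, hm'⟩ := hK'.exists_isLeast (insert_nonempty _ _)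
  obtain ⟨M, hM, hM'⟩ := hK'.exists_isGreatest (insert_nonempty _ _)
  exact ⟨m, M, (h' hm).1, (h' hM).2, fun x hx => ⟨hm' (mem_insert_of_mem _ hx),
    hM' (mem_insert_of_mem _ hx)⟩⟩

lemma exists_Ioo_of_isCompact {U : Set ℝ} (hU : IsOpen U) (hc : U.OrdConnected) {K : Set ℝ}
    (hK : IsCompact K) (hne : K.Nonempty) (h : K ⊆ U) :
    ∃ a b, a < b ∧ K ⊆ Ioo a b ∧ Icc a b ⊆ U := by
  obtain ⟨m, hm, hm'⟩ := hK.exists_isLeast hne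
  obtain ⟨M, hM, hM'⟩ := hK.exists_isGreatest hne
  obtain ⟨ε, hε, h1⟩ := Metric.isOpen_iff.1 hU m (h hm)
  obtain ⟨ε', hε', h2⟩ := Metric.isOpen_iff.1 hU M (h hM)
  have hmM : m ≤ M := hm' hM
  refine ⟨m - ε / 2, M + ε' / 2, by linarith, fun x hx => ⟨?_, ?_⟩, hc.out (h1 ?_) (h2 ?_)⟩
  · linarith [hm' hx]
  · linarith [hM' hx]
  · rw [Metric.mem_ball, Real.dist_eq, abs_lt]; constructor <;> linarith
  · rw [Metric.mem_ball, Real.dist_eq, abs_lt]; constructor <;> linarith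

lemma IsTest.absolutelyContinuous {χ : ℝ → ℝ} (hχ : IsTest χ) (a b : ℝ) :
    AbsolutelyContinuousOnInterval χ a b :=
  ContDiffOn.absolutelyContinuousOnInterval (hχ.smooth.of_le (by simp)).contDiffOn

/-- A test function of integral zero is the derivative of a test function. -/
lemma IsTest.exists_primitive {θ : ℝ → ℝ} (hθ : IsTest θ) {a b : ℝ} (hab : a < b)
    (hs : tsupport θ ⊆ Ioo a b) (h0 : ∫ t, θ t = 0) :
    ∃ Θ : ℝ → ℝ, IsTest Θ ∧ tsupport Θ ⊆ Ioo a b ∧ deriv Θ = θ := by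
  obtain ⟨a', b', ha, hb, hK⟩ := exists_Icc_of_isCompact hab hθ.compact hs
  set Θ : ℝ → ℝ := fun t => ∫ s in a..t, θ s with hΘ
  have hd : ∀ t, HasDerivAt Θ (θ t) t := fun t =>
    hθ.continuous.integral_hasStrictDerivAt a t |>.hasDerivAt
  have hd' : deriv Θ = θ := funext fun t => (hd t).deriv
  have hz : ∀ t, t ∉ Icc a' b' → θ t = 0 := fun t ht =>
    image_eq_zero_of_notMem_tsupport fun h => ht (hK h)
  have hint : ∀ x y, IntervalIntegrable θ volume x y := fun x y =>
    hθ.continuous.intervalIntegrable x y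
  have hsupp : Function.support Θ ⊆ Icc a' b' := by
    intro t ht
    by_contra h
    apply ht
    rw [mem_Icc, not_and_or, not_le, not_le] at h
    rcases h with h | h
    · refine intervalIntegral.integral_zero_ae (ae_of_all _ fun s hs => hz s fun hs' => ?_)
      rcases le_total a t with h1 | h1
      · rw [uIoc_of_le h1] at hs; linarith [hs.2, hs'.1]
      · rw [uIoc_of_ge h1] at hs; linarith [hs.2, hs'.1]
    · have e : ∫ s in a..t, θ s = ∫ s, θ s := by
        rw [intervalIntegral.integral_eq_integral_of_support_subset]
        intro s hs
        by_cases hs' : s ∈ Icc a' b'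
        · exact ⟨by linarith [hs'.1], by linarith [hs'.2]⟩
        · exact absurd (hz s hs') hs
      simp only [hΘ]
      rw [e, h0]
  have hts : tsupport Θ ⊆ Icc a' b' := closure_minimal hsupp isClosed_Icc
  refine ⟨Θ, ⟨?_, ?_⟩, hts.trans fun t ht => ⟨by linarith [ht.1], by linarith [ht.2]⟩, hd'⟩
  · rw [contDiff_infty_iff_deriv]
    exact ⟨fun t => (hd t).differentiableAt, hd' ▸ hθ.smooth⟩
  · exact HasCompactSupport.of_support_subset_isCompact isCompact_Icc hsupp

lemma exists_isTest_integral_one {a b : ℝ} (hab : a < b) :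
    ∃ χ : ℝ → ℝ, IsTest χ ∧ tsupport χ ⊆ Ioo a b ∧ ∫ t, χ t = 1 := by
  let f : ContDiffBump ((a + b) / 2) := ⟨(b - a) / 8, (b - a) / 4, by linarith, by linarith⟩
  refine ⟨f.normed volume, ⟨f.contDiff_normed, f.hasCompactSupport_normed⟩, ?_,
    f.integral_normed⟩
  rw [f.tsupport_normed_eq]
  intro x hx
  have : |x - (a + b) / 2| ≤ (b - a) / 4 := by simpa [Real.dist_eq] using hx
  rw [abs_le] at this
  constructor <;> linarith [this.1, this.2]

/-- Integration by parts for the primitive of a locally integrable function. -/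
lemma integral_deriv_mul_primitive {G : ℝ → ℝ} (hG : LocallyIntegrable G) {a b : ℝ}
    {Θ : ℝ → ℝ} (hΘ : IsTest Θ) (hs : tsupport Θ ⊆ Ioo a b) :
    ∫ t, deriv Θ t * (∫ s in a..t, G s) = - ∫ t, Θ t * G t := by
  have hGi : IntervalIntegrable G volume a b :=
    intervalIntegrable_iff.2 ((hG.integrableOn_isCompact isCompact_uIcc).mono_set uIoc_subset_uIcc)
  have hF : AbsolutelyContinuousOnInterval (fun t => ∫ s in a..t, G s) a b :=
    hGi.absolutelyContinuousOnInterval_intervalIntegral (by simp)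
  have h := hF.integral_mul_deriv_eq_deriv_mul (hΘ.absolutelyContinuous a b)
  have hz : ∀ t, t ∉ Ioo a b → Θ t = 0 := fun t ht =>
    image_eq_zero_of_notMem_tsupport fun h => ht (hs h)
  have hz' : ∀ t, t ∉ Ioo a b → deriv Θ t = 0 := fun t ht =>
    image_eq_zero_of_notMem_tsupport (f := deriv Θ)
      fun h => ht (hs (tsupport_deriv_subset (𝕜 := ℝ) h))
  rw [hz a (by simp), hz b (by simp)] at h
  have e1 : ∫ t, deriv Θ t * (∫ s in a..t, G s) =
      ∫ t in a..b, (∫ s in a..t, G s) * deriv Θ t := by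
    rw [intervalIntegral.integral_eq_integral_of_support_subset]
    · simp_rw [mul_comm]
    · intro t ht
      by_contra h'
      exact ht (by simp [hz' t fun h => h' (Ioo_subset_Ioc_self h)])
  have e2 : ∫ t, Θ t * G t = ∫ t in a..b, deriv (fun t => ∫ s in a..t, G s) t * Θ t := by
    rw [← intervalIntegral.integral_eq_integral_of_support_subset (a := a) (b := b)]
    · refine intervalIntegral.integral_congr_ae ?_
      filter_upwards [_root_.LocallyIntegrable.ae_hasDerivAt_integral hG] with t ht _
      rw [(ht a).deriv, mul_comm]
    · intro t ht
      by_contra h'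
      exact ht (by simp [hz t fun h => h' (Ioo_subset_Ioc_self h)])
  rw [e1, e2, h]
  ring

lemma IsTest.mul_integrable {χ V : ℝ → ℝ} (hχ : IsTest χ) (hV : LocallyIntegrable V) :
    Integrable fun t => χ t * V t := by
  simpa using hV.integrable_smul_left_of_hasCompactSupport hχ.continuous hχ.compact

lemma IsTest.deriv {χ : ℝ → ℝ} (hχ : IsTest χ) : IsTest (deriv χ) := by
  have : _root_.deriv χ = _root_.dv (1 : ℝ) χ := by
    ext t; simp [_root_.dv]
  rw [this]
  exact hχ.dv 1

/-- A function with a locally integrable weak derivative is a primitive of it, up to a null set. -/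
lemma ae_eq_const_add_primitive {V G : ℝ → ℝ} (hV : LocallyIntegrable V) (hG : LocallyIntegrable G)
    {a b : ℝ} (hab : a < b)
    (h : ∀ χ : ℝ → ℝ, IsTest χ → tsupport χ ⊆ Ioo a b →
      ∫ t, deriv χ t * V t = - ∫ t, χ t * G t) :
    ∃ c, ∀ᵐ t, t ∈ Ioo a b → V t = c + ∫ s in a..t, G s := by
  obtain ⟨χ₀, hχ₀, hs₀, h₀⟩ := exists_isTest_integral_one hab
  set F : ℝ → ℝ := fun t => ∫ s in a..t, G s with hF
  have hFc : Continuous F :=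
    intervalIntegral.continuous_primitive (fun x y => intervalIntegrable_iff.2
      ((hG.integrableOn_isCompact isCompact_uIcc).mono_set uIoc_subset_uIcc)) a
  have hVF : LocallyIntegrable (fun t => V t - F t) := hV.sub hFc.locallyIntegrable
  set c := ∫ t, χ₀ t * (V t - F t) with hc
  have hVFc : LocallyIntegrable (fun t => V t - F t - c) := hVF.sub (locallyIntegrable_const c)
  refine ⟨c, ?_⟩
  have := isOpen_Ioo.ae_eq_zero_of_integral_contDiff_smul_eq_zero (U := Ioo a b)
    (f := fun t => V t - F t - c) (μ := volume) (hVFc.locallyIntegrableOn _)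
    fun ψ hψ hψc hψs => ?_
  · filter_upwards [this] with t ht ht'
    linarith [ht ht']
  · have hψ' : IsTest ψ := ⟨hψ, hψc⟩
    set m := ∫ t, ψ t with hm
    have hθ : IsTest (fun t => ψ t - m * χ₀ t) :=
      hψ'.sub (hχ₀.smul_left (a := fun _ => m) contDiff_const)
    have hθs : tsupport (fun t => ψ t - m * χ₀ t) ⊆ Ioo a b := by
      refine (closure_minimal (fun t ht => ?_)
        ((isClosed_tsupport ψ).union (isClosed_tsupport χ₀))).trans (union_subset hψs hs₀)
      by_contra h'
      rw [mem_union, not_or] at h'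
      exact ht (by simp [image_eq_zero_of_notMem_tsupport h'.1,
        image_eq_zero_of_notMem_tsupport h'.2])
    have hθ0 : ∫ t, (ψ t - m * χ₀ t) = 0 := by
      rw [integral_sub hψ'.integrable (hχ₀.integrable.const_mul m), integral_const_mul, h₀]
      simp [hm]
    obtain ⟨Θ, hΘ, hΘs, hΘd⟩ := hθ.exists_primitive hab hθs hθ0
    have h1 := h Θ hΘ hΘs
    have h2 := integral_deriv_mul_primitive hG hΘ hΘs
    rw [hΘd] at h1 h2
    have h3 : ∫ t, (ψ t - m * χ₀ t) * (V t - F t) = 0 := by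
      simp_rw [mul_sub]
      rw [integral_sub (hθ.mul_integrable hV) (hθ.mul_integrable hFc.locallyIntegrable), h1, h2,
        sub_self]
    have e : ∀ t, ψ t • (V t - F t - c) =
        (ψ t - m * χ₀ t) * (V t - F t) + m * (χ₀ t * (V t - F t)) - c * ψ t := fun t => by
      simp only [smul_eq_mul]; ring
    have i1 : Integrable fun t => (ψ t - m * χ₀ t) * (V t - F t) + m * (χ₀ t * (V t - F t)) :=
      (hθ.mul_integrable hVF).add ((hχ₀.mul_integrable hVF).const_mul m)
    simp_rw [e]
    rw [integral_sub i1 (hψ'.integrable.const_mul c), integral_add (hθ.mul_integrable hVF)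
      ((hχ₀.mul_integrable hVF).const_mul m), integral_const_mul, integral_const_mul, h3,
      ← hc, ← hm]
    ring

/-- The weak form of `(V²)' = 2 V G` for a function `V` with weak derivative `G`. -/
lemma integral_deriv_mul_sq {V G : ℝ → ℝ} (hV : LocallyIntegrable V) (hG : LocallyIntegrable G)
    {U : Set ℝ} (hU : IsOpen U) (hUc : U.OrdConnected)
    (h : ∀ χ : ℝ → ℝ, IsTest χ → tsupport χ ⊆ U → ∫ t, deriv χ t * V t = - ∫ t, χ t * G t)
    {χ : ℝ → ℝ} (hχ : IsTest χ) (hs : tsupport χ ⊆ U) :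
    ∫ t, (deriv χ t * V t ^ 2 + 2 * χ t * (G t * V t)) = 0 := by
  rcases (tsupport χ).eq_empty_or_nonempty with h0 | hne
  · have : χ = 0 := by rwa [tsupport_eq_empty_iff] at h0
    subst this
    simp
  obtain ⟨a, b, hab, hK, hI⟩ := exists_Ioo_of_isCompact hU hUc hχ.compact hne hs
  obtain ⟨c, hc⟩ := ae_eq_const_add_primitive hV hG hab fun χ hχ hχs =>
    h χ hχ (hχs.trans (Ioo_subset_Icc_self.trans hI))
  set H : ℝ → ℝ := fun t => c + ∫ s in a..t, G s with hH
  have hGi : IntervalIntegrable G volume a b :=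
    intervalIntegrable_iff.2 ((hG.integrableOn_isCompact isCompact_uIcc).mono_set uIoc_subset_uIcc)
  have hHac : AbsolutelyContinuousOnInterval H a b :=
    (contDiffOn_const (c := c) (n := 1)).absolutelyContinuousOnInterval.add
      (hGi.absolutelyContinuousOnInterval_intervalIntegral (by simp))
  have hz : ∀ t, t ∉ Ioo a b → χ t = 0 := fun t ht =>
    image_eq_zero_of_notMem_tsupport fun h => ht (hK h)
  have hz' : ∀ t, t ∉ Ioo a b → deriv χ t = 0 := fun t ht =>
    image_eq_zero_of_notMem_tsupport (f := deriv χ)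
      fun h => ht (hK (tsupport_deriv_subset (𝕜 := ℝ) h))
  have key := ((hχ.absolutelyContinuous a b).fun_mul hHac).integral_deriv_mul_eq_sub hHac
  rw [hz a (by simp), hz b (by simp)] at key
  rw [← intervalIntegral.integral_eq_integral_of_support_subset (a := a) (b := b)]
  · rw [show (0 : ℝ) = 0 * H b * H b - 0 * H a * H a by ring, ← key]
    refine intervalIntegral.integral_congr_ae ?_
    filter_upwards [_root_.LocallyIntegrable.ae_hasDerivAt_integral hG, hc, measure_eq_zero_iff_ae_notMem.1
      (measure_singleton (μ := volume) b)] with t ht hct htb htI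
    rw [uIoc_of_le hab.le] at htI
    have htI' : t ∈ Ioo a b := ⟨htI.1, lt_of_le_of_ne htI.2 htb⟩
    have hHd : HasDerivAt H (G t) t := (ht a).const_add c
    have hχd : HasDerivAt χ (deriv χ t) t := (hχ.differentiable t).hasDerivAt
    rw [hHd.deriv, (hχd.fun_mul hHd).deriv, hct htI']
    simp only [hH]
    ring
  · intro t ht
    by_contra h'
    have h'' : t ∉ Ioo a b := fun h => h' (Ioo_subset_Ioc_self h)
    exact ht (by simp [hz t h'', hz' t h''])

end OneDim

/-! ### Mollification in space -/

section Mollify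

open Set
open scoped Convolution

variable {d d₁ : ℕ}

/-- The weak form of `(‖V‖²)' = 2 ⟨G, V⟩` for a function `V` with weak derivative `G`. -/
lemma integral_deriv_mul_normSq {V G : ℝ → Val d₁} (hV : MemLp V 2) (hG : MemLp G 2)
    {U : Set ℝ} (hU : IsOpen U) (hUc : U.OrdConnected)
    (h : ∀ χ : ℝ → ℝ, IsTest χ → tsupport χ ⊆ U → ∫ t, (deriv χ t • V t + χ t • G t) = 0)
    {χ : ℝ → ℝ} (hχ : IsTest χ) (hs : tsupport χ ⊆ U) :
    ∫ t, (deriv χ t * ‖V t‖ ^ 2 + 2 * χ t * inner ℝ (G t) (V t)) = 0 := by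
  let b := stdOrthonormalBasis ℝ (Val d₁)
  have hVl : LocallyIntegrable V := hV.locallyIntegrable (by norm_num)
  have hGl : LocallyIntegrable G := hG.locallyIntegrable (by norm_num)
  have hVi : ∀ i, MemLp (fun t => inner ℝ (b i) (V t)) 2 := fun i => hV.const_inner (b i)
  have hGi : ∀ i, MemLp (fun t => inner ℝ (b i) (G t)) 2 := fun i => hG.const_inner (b i)
  have key : ∀ i, ∫ t, (deriv χ t * (inner ℝ (b i) (V t)) ^ 2 +
      2 * χ t * (inner ℝ (b i) (G t) * inner ℝ (b i) (V t))) = 0 := by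
    intro i
    refine integral_deriv_mul_sq ((hVi i).locallyIntegrable (by norm_num))
      ((hGi i).locallyIntegrable (by norm_num)) hU hUc (fun ψ hψ hψs => ?_) hχ hs
    have h1 : Integrable fun t => deriv ψ t • V t :=
      hVl.integrable_smul_left_of_hasCompactSupport hψ.deriv.continuous hψ.deriv.compact
    have h2 : Integrable fun t => ψ t • G t :=
      hGl.integrable_smul_left_of_hasCompactSupport hψ.continuous hψ.compact
    have h3 := congrArg (fun w => inner ℝ (b i) w) (h ψ hψ hψs)
    simp only [inner_zero_right] at h3
    have h12 : Integrable fun t => deriv ψ t • V t + ψ t • G t := h1.add h2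
    rw [← integral_inner (𝕜 := ℝ) h12] at h3
    simp only [inner_add_right, inner_smul_right] at h3
    have h4 : Integrable fun t => deriv ψ t * inner ℝ (b i) (V t) := by
      simpa [inner_smul_right] using h1.const_inner (𝕜 := ℝ) (b i)
    have h5 : Integrable fun t => ψ t * inner ℝ (b i) (G t) := by
      simpa [inner_smul_right] using h2.const_inner (𝕜 := ℝ) (b i)
    rw [integral_add h4 h5] at h3
    linarith
  have hint : ∀ i, Integrable fun t => deriv χ t * (inner ℝ (b i) (V t)) ^ 2 +
      2 * χ t * (inner ℝ (b i) (G t) * inner ℝ (b i) (V t)) := by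
    intro i
    have h1 : Integrable fun t => (inner ℝ (b i) (V t)) ^ 2 := (hVi i).integrable_sq
    have h2 : Integrable fun t => inner ℝ (b i) (G t) * inner ℝ (b i) (V t) :=
      (hGi i).integrable_mul (hVi i)
    refine (hχ.deriv.mul_integrable h1.locallyIntegrable).add ?_
    simp_rw [mul_assoc]
    exact (hχ.mul_integrable h2.locallyIntegrable).const_mul 2
  have e : ∀ t, deriv χ t * ‖V t‖ ^ 2 + 2 * χ t * inner ℝ (G t) (V t) =
      ∑ i, (deriv χ t * (inner ℝ (b i) (V t)) ^ 2 +
      2 * χ t * (inner ℝ (b i) (G t) * inner ℝ (b i) (V t))) := by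
    intro t
    rw [Finset.sum_add_distrib, ← Finset.mul_sum, ← Finset.mul_sum, ← real_inner_self_eq_norm_sq,
      ← b.sum_inner_mul_inner (V t) (V t), ← b.sum_inner_mul_inner (G t) (V t)]
    simp only [real_inner_comm (b _), sq]
  simp_rw [e]
  rw [integral_finsetSum _ fun i _ => hint i]
  exact Finset.sum_eq_zero fun i _ => key i

/-- Convolution with `k` in the space variables only. -/
def mol (k : EuclideanSpace ℝ (Fin d) → ℝ) (v : SpaceTime d → Val d₁) : SpaceTime d → Val d₁ :=
  fun z => ∫ y, k (z.2 - y) • v (z.1, y)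

lemma stronglyMeasurable_mol {k : EuclideanSpace ℝ (Fin d) → ℝ} (hk : Continuous k)
    {v : SpaceTime d → Val d₁} (hv : StronglyMeasurable v) : StronglyMeasurable (mol k v) := by
  refine StronglyMeasurable.integral_prod_right'
    (f := fun p : SpaceTime d × EuclideanSpace ℝ (Fin d) => k (p.1.2 - p.2) • v (p.1.1, p.2)) ?_
  have h1 : StronglyMeasurable fun p : SpaceTime d × EuclideanSpace ℝ (Fin d) => k (p.1.2 - p.2) :=
    (hk.comp (by fun_prop)).stronglyMeasurable
  exact h1.smul (hv.comp_measurable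
    (g := fun p : SpaceTime d × EuclideanSpace ℝ (Fin d) => (p.1.1, p.2)) (by fun_prop))

/-- The Cauchy-Schwarz inequality. -/
lemma sq_integral_mul_le {α : Type*} [MeasurableSpace α] {μ : Measure α} {f g : α → ℝ}
    (hf : MemLp f 2 μ) (hg : MemLp g 2 μ) (hf0 : ∀ x, 0 ≤ f x) (hg0 : ∀ x, 0 ≤ g x) :
    (∫ x, f x * g x ∂μ) ^ 2 ≤ (∫ x, f x ^ 2 ∂μ) * ∫ x, g x ^ 2 ∂μ := by
  have h := integral_mul_le_Lp_mul_Lq_of_nonneg (μ := μ) (p := 2) (q := 2)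
    Real.HolderConjugate.two_two (ae_of_all _ hf0) (ae_of_all _ hg0) (by simpa using hf)
    (by simpa using hg)
  simp only [Real.rpow_two, ← Real.sqrt_eq_rpow] at h
  have h0 : 0 ≤ ∫ x, f x * g x ∂μ := integral_nonneg fun x => mul_nonneg (hf0 x) (hg0 x)
  calc _ ≤ (√(∫ x, f x ^ 2 ∂μ) * √(∫ x, g x ^ 2 ∂μ)) ^ 2 := by gcongr
    _ = _ := by
      rw [mul_pow, Real.sq_sqrt (integral_nonneg fun x => sq_nonneg _),
        Real.sq_sqrt (integral_nonneg fun x => sq_nonneg _)]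

variable {v : SpaceTime d → Val d₁}

lemma ae_memLp_slice (hv : MemLp v 2) : ∀ᵐ t : ℝ, MemLp (fun y => v (t, y)) 2 := by
  have h1 : Integrable (fun z => ‖v z‖ ^ 2) ((volume : Measure ℝ).prod volume) :=
    hv.integrable_norm_pow (by norm_num)
  have h2 : AEStronglyMeasurable v ((volume : Measure ℝ).prod volume) := hv.1
  filter_upwards [h1.prod_right_ae, h2.prodMk_left] with t ht ht'
  exact (memLp_two_iff_integrable_sq_norm ht').2 ht

lemma integrable_slice_normSq (hv : MemLp v 2) : Integrable fun t : ℝ => ∫ y, ‖v (t, y)‖ ^ 2 := by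
  have h1 : Integrable (fun z => ‖v z‖ ^ 2) ((volume : Measure ℝ).prod volume) :=
    hv.integrable_norm_pow (by norm_num)
  exact h1.integral_prod_left

lemma norm_mol_sq_le {k : EuclideanSpace ℝ (Fin d) → ℝ} (hk : IsTest k) {t : ℝ}
    (ht : MemLp (fun y => v (t, y)) 2) (x : EuclideanSpace ℝ (Fin d)) :
    ‖mol k v (t, x)‖ ^ 2 ≤ (∫ y, k y ^ 2) * ∫ y, ‖v (t, y)‖ ^ 2 := by
  have hk2 : MemLp (fun y => ‖k (x - y)‖) 2 := by
    have hc : Continuous fun y => k (x - y) := hk.continuous.comp (by fun_prop)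
    refine MemLp.norm ?_
    exact hc.memLp_of_hasCompactSupport
      (hk.compact.comp_homeomorph (Homeomorph.subLeft x))
  have h1 : ‖mol k v (t, x)‖ ≤ ∫ y, ‖k (x - y)‖ * ‖v (t, y)‖ := by
    refine (norm_integral_le_integral_norm _).trans (le_of_eq ?_)
    simp only [norm_smul]
  have h2 := sq_integral_mul_le hk2 ht.norm (fun _ => norm_nonneg _) (fun _ => norm_nonneg _)
  have h3 : ∫ y, ‖k (x - y)‖ ^ 2 = ∫ y, k y ^ 2 := by
    simp only [Real.norm_eq_abs, sq_abs]
    exact integral_sub_left_eq_self (fun y => k y ^ 2) volume x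
  rw [h3] at h2
  refine le_trans ?_ h2
  gcongr

/-- `mol k v` at a fixed point of space is square integrable in time. -/
lemma memLp_mol {k : EuclideanSpace ℝ (Fin d) → ℝ} (hk : IsTest k) (hvm : StronglyMeasurable v)
    (hv : MemLp v 2) (x : EuclideanSpace ℝ (Fin d)) : MemLp (fun t => mol k v (t, x)) 2 := by
  have hm : StronglyMeasurable fun t => mol k v (t, x) :=
    (stronglyMeasurable_mol hk.continuous hvm).comp_measurable (by fun_prop)
  rw [memLp_two_iff_integrable_sq_norm hm.aestronglyMeasurable]
  refine ((integrable_slice_normSq hv).const_mul (∫ y, k y ^ 2)).mono'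
    (hm.norm.pow 2).aestronglyMeasurable ?_
  filter_upwards [ae_memLp_slice hv] with t ht
  rw [Real.norm_of_nonneg (by positivity)]
  exact norm_mol_sq_le hk ht x

lemma mol_slice_eq (k : EuclideanSpace ℝ (Fin d) → ℝ) (t : ℝ) :
    (fun x => mol k v (t, x)) =
      ((fun y => v (t, y)) ⋆[(ContinuousLinearMap.lsmul ℝ ℝ).flip, volume] k) := rfl

lemma mol_slice_smooth {k : EuclideanSpace ℝ (Fin d) → ℝ} (hk : IsTest k) {t : ℝ}
    (ht : LocallyIntegrable (fun y => v (t, y))) : ContDiff ℝ ∞ fun x => mol k v (t, x) := by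
  rw [mol_slice_eq]
  exact hk.compact.contDiff_convolution_right _ ht hk.smooth

lemma dv_mol_slice {k : EuclideanSpace ℝ (Fin d) → ℝ} (hk : IsTest k) {t : ℝ}
    (ht : LocallyIntegrable (fun y => v (t, y))) (w : EuclideanSpace ℝ (Fin d)) :
    dv w (fun x => mol k v (t, x)) = fun x => mol (dv w k) v (t, x) := by
  ext1 x
  have h := hk.compact.hasFDerivAt_convolution_right (ContinuousLinearMap.lsmul ℝ ℝ).flip ht
    (hk.smooth.of_le (by simp)) x
  rw [dv, mol_slice_eq, h.fderiv, convolution_precompR_apply _ ht (hk.compact.fderiv ℝ)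
    (hk.smooth.continuous_fderiv (by simp))]
  rfl

end Mollify

/-! ### The weak formulation and its energy inequality -/

section Energy

open Set

variable {d d₁ : ℕ}

/-- Coefficients depending only on time for which the arguments work: strongly measurable, bounded
by `K` and elliptic with constant `δ`. They are operators on `ℂ^{d₁}`, so that adjoints are at hand.
-/
structure IsParabolic (δ K : ℝ) (L : ℝ → Fin d → Fin d → Val d₁ →L[ℂ] Val d₁) : Prop where
  meas : ∀ i j, AEStronglyMeasurable (fun t => L t i j) volume
  bound : ∀ t i j, ‖L t i j‖ ≤ K
  ell : ∀ t, LegendreHadamard δ (L t)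

/-- The integrand of the very weak form of `-v_t + ∑ L i j ∂_i ∂_j v - lam v = 0`, tested with the
product `χ(t) η(x)`: all derivatives are on the test function, so nothing but local integrability is
asked of `v`. -/
def weakIntegrand (L : ℝ → Fin d → Fin d → Val d₁ →L[ℂ] Val d₁) (lam : ℝ) (χ : ℝ → ℝ)
    (η : EuclideanSpace ℝ (Fin d) → ℝ) (v : SpaceTime d → Val d₁) (z : SpaceTime d) : Val d₁ :=
  (deriv χ z.1 * η z.2) • v z +
    ∑ i, ∑ j, (χ z.1 * pd i (pd j η) z.2) • L z.1 i j (v z) - (lam * (χ z.1 * η z.2)) • v z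

lemma IsTest.prod_mul {χ : ℝ → ℝ} {η : EuclideanSpace ℝ (Fin d) → ℝ} (hχ : IsTest χ)
    (hη : IsTest η) : IsTest fun z : SpaceTime d => χ z.1 * η z.2 := by
  refine ⟨(hχ.smooth.comp contDiff_fst).mul (hη.smooth.comp contDiff_snd), ?_⟩
  refine HasCompactSupport.of_support_subset_isCompact
    (hχ.compact.isCompact.prod hη.compact.isCompact) fun z hz => ?_
  have : χ z.1 ≠ 0 ∧ η z.2 ≠ 0 := by
    simpa only [Function.mem_support, ne_eq, mul_eq_zero, not_or] using hz
  exact ⟨subset_tsupport _ this.1, subset_tsupport _ this.2⟩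

lemma IsTest.comp_sub_left {k : EuclideanSpace ℝ (Fin d) → ℝ} (hk : IsTest k)
    (x : EuclideanSpace ℝ (Fin d)) : IsTest fun y => k (x - y) :=
  ⟨hk.smooth.comp (contDiff_const.sub contDiff_id),
    hk.compact.comp_homeomorph (Homeomorph.subLeft x)⟩

lemma dv_comp_sub_left {k : EuclideanSpace ℝ (Fin d) → ℝ} (hk : ContDiff ℝ ∞ k)
    (x w : EuclideanSpace ℝ (Fin d)) :
    dv w (fun y => k (x - y)) = fun y => - dv w k (x - y) := by
  ext1 y
  have h1 : HasFDerivAt k (fderiv ℝ k (x - y)) (x - y) :=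
    (hk.differentiable (by simp) _).hasFDerivAt
  have h2 := h1.comp y ((hasFDerivAt_id y).const_sub x)
  rw [dv, show (fun y => k (x - y)) = k ∘ (fun y => x - y) from rfl]
  erw [h2.fderiv]
  simp [dv]

lemma pd_pd_comp_sub_left {k : EuclideanSpace ℝ (Fin d) → ℝ} (hk : IsTest k)
    (x : EuclideanSpace ℝ (Fin d)) (i j : Fin d) :
    pd i (pd j fun y => k (x - y)) = fun y => pd i (pd j k) (x - y) := by
  rw [pd, pd, dv_comp_sub_left hk.smooth, dv_neg, dv_comp_sub_left (hk.dv _).smooth]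
  simp

lemma MemLp.clm_apply_time {δ K : ℝ} {L : ℝ → Fin d → Fin d → Val d₁ →L[ℂ] Val d₁}
    (hL : IsParabolic δ K L) {v : SpaceTime d → Val d₁} {μ : Measure (SpaceTime d)}
    (hμ : μ ≪ volume) (hv : MemLp v 2 μ) (i j : Fin d) :
    MemLp (fun z => L z.1 i j (v z)) 2 μ := by
  have hm : AEStronglyMeasurable (fun z : SpaceTime d => L z.1 i j) μ := by
    have : AEStronglyMeasurable (fun z : SpaceTime d => L z.1 i j)
      ((volume : Measure ℝ).prod volume) := (hL.meas i j).comp_fst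
    exact this.mono_ac hμ
  refine hv.of_le_mul (c := K) ?_ (ae_of_all _ fun z => (L z.1 i j).le_of_opNorm_le (hL.bound _ i j) _)
  exact (ContinuousLinearMap.apply ℂ (Val d₁) |>.flip).aestronglyMeasurable_comp₂ hm hv.1

variable {v : SpaceTime d → Val d₁}

lemma weakIntegrand_integrable {L : ℝ → Fin d → Fin d → Val d₁ →L[ℂ] Val d₁}
    (hv : LocallyIntegrable v)
    (hLv : ∀ i j, LocallyIntegrable fun z => L z.1 i j (v z)) (lam : ℝ) {χ : ℝ → ℝ}
    {η : EuclideanSpace ℝ (Fin d) → ℝ} (hχ : IsTest χ) (hη : IsTest η) :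
    Integrable (weakIntegrand L lam χ η v) := by
  have key : ∀ {u : SpaceTime d → Val d₁} {χ : ℝ → ℝ} {η : EuclideanSpace ℝ (Fin d) → ℝ},
      LocallyIntegrable u → IsTest χ → IsTest η →
      Integrable fun z : SpaceTime d => (χ z.1 * η z.2) • u z := fun hu hχ hη =>
    hu.integrable_smul_left_of_hasCompactSupport (hχ.prod_mul hη).continuous
      (hχ.prod_mul hη).compact
  refine ((key hv hχ.deriv hη).add (integrable_finsetSum _ fun i _ =>
    integrable_finsetSum _ fun j _ => key (hLv i j) hχ ((hη.dv _).dv _))).sub ?_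
  simp_rw [← smul_smul lam]
  exact (key hv hχ hη).smul lam

/-- The elliptic part of the operator, applied to `mol k v`; the derivatives are put on `k`. -/
def molRhs (L : ℝ → Fin d → Fin d → Val d₁ →L[ℂ] Val d₁) (lam : ℝ)
    (k : EuclideanSpace ℝ (Fin d) → ℝ) (v : SpaceTime d → Val d₁) (z : SpaceTime d) : Val d₁ :=
  ∑ i, ∑ j, L z.1 i j (mol (pd i (pd j k)) v z) - lam • mol k v z

/-- At a fixed point of space the mollification of a very weak solution solves an ordinary
differential equation in time, weakly: `y ↦ k (x - y)` is the test function in space. -/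
lemma integral_mol_weak {δ K : ℝ} {L : ℝ → Fin d → Fin d → Val d₁ →L[ℂ] Val d₁}
    (hL : IsParabolic δ K L) (hv : MemLp v 2) (lam : ℝ) {χ : ℝ → ℝ}
    {k : EuclideanSpace ℝ (Fin d) → ℝ} (hχ : IsTest χ) (hk : IsTest k)
    (x : EuclideanSpace ℝ (Fin d))
    (h : ∫ z, weakIntegrand L lam χ (fun y => k (x - y)) v z = 0) :
    ∫ t, (deriv χ t • mol k v (t, x) + χ t • molRhs L lam k v (t, x)) = 0 := by
  have hint := weakIntegrand_integrable (hv.locallyIntegrable (by norm_num))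
    (fun i j => (MemLp.clm_apply_time hL Measure.AbsolutelyContinuous.rfl hv i j).locallyIntegrable
      (by norm_num)) lam hχ (hk.comp_sub_left x)
  rw [Measure.volume_eq_prod] at hint h
  rw [integral_prod _ hint] at h
  rw [← h]
  refine integral_congr_ae ?_
  filter_upwards [ae_memLp_slice hv] with t ht
  have htl : LocallyIntegrable fun y => v (t, y) := ht.locallyIntegrable (by norm_num)
  have hi : ∀ {k : EuclideanSpace ℝ (Fin d) → ℝ}, IsTest k →
      Integrable fun y => k (x - y) • v (t, y) := fun hk =>
    htl.integrable_smul_left_of_hasCompactSupport (hk.comp_sub_left x).continuous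
      (hk.comp_sub_left x).compact
  have hk2 : ∀ i j, IsTest (pd i (pd j k)) := fun i j => (hk.dv _).dv _
  have e : ∀ y, weakIntegrand L lam χ (fun y => k (x - y)) v (t, y) =
      deriv χ t • k (x - y) • v (t, y) + χ t • ∑ i, ∑ j, L t i j (pd i (pd j k) (x - y) • v (t, y)) -
      (χ t * lam) • k (x - y) • v (t, y) := by
    intro y
    simp only [weakIntegrand, pd_pd_comp_sub_left hk, smul_smul, Finset.smul_sum]
    congr 1
    · congr 1
      refine Finset.sum_congr rfl fun i _ => Finset.sum_congr rfl fun j _ => ?_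
      rw [← Complex.coe_smul (pd i (pd j k) (x - y)), map_smul, Complex.coe_smul, smul_smul]
    · congr 1; ring
  simp_rw [e]
  have i2 : ∀ i j, Integrable fun y => L t i j (pd i (pd j k) (x - y) • v (t, y)) := fun i j =>
    (L t i j).integrable_comp (hi (hk2 i j))
  have i3 : Integrable fun y => ∑ i, ∑ j, L t i j (pd i (pd j k) (x - y) • v (t, y)) :=
    integrable_finsetSum _ fun i _ => integrable_finsetSum _ fun j _ => i2 i j
  have i4 : Integrable fun y => deriv χ t • k (x - y) • v (t, y) +
      χ t • ∑ i, ∑ j, L t i j (pd i (pd j k) (x - y) • v (t, y)) :=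
    ((hi hk).smul (deriv χ t)).add (i3.smul (χ t))
  have i5 : ∀ c : ℝ, Integrable fun y => c • k (x - y) • v (t, y) := fun c => (hi hk).smul c
  have i6 : Integrable fun y => χ t • ∑ i, ∑ j, L t i j (pd i (pd j k) (x - y) • v (t, y)) :=
    i3.smul (χ t)
  rw [integral_sub i4 (i5 _), integral_add (i5 _) i6, integral_smul, integral_smul, integral_smul,
    integral_finsetSum _ fun i _ => integrable_finsetSum _ fun j _ => i2 i j]
  simp_rw [fun i => integral_finsetSum (μ := volume) Finset.univ fun j _ => i2 i j]
  have e2 : ∀ i j, ∫ y, L t i j (pd i (pd j k) (x - y) • v (t, y)) =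
      L t i j (mol (pd i (pd j k)) v (t, x)) := fun i j =>
    (L t i j).integral_comp_comm (hi (hk2 i j))
  simp_rw [e2]
  simp only [molRhs, smul_sub, smul_smul]
  change _ = deriv χ t • mol k v (t, x) + _ - (χ t * lam) • mol k v (t, x)
  abel

lemma memLp_molRhs {δ K : ℝ} {L : ℝ → Fin d → Fin d → Val d₁ →L[ℂ] Val d₁}
    (hL : IsParabolic δ K L) (hvm : StronglyMeasurable v) (hv : MemLp v 2) (lam : ℝ)
    {k : EuclideanSpace ℝ (Fin d) → ℝ} (hk : IsTest k) (x : EuclideanSpace ℝ (Fin d)) :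
    MemLp (fun t => molRhs L lam k v (t, x)) 2 := by
  refine MemLp.sub (memLp_finsetSum _ fun i _ => memLp_finsetSum _ fun j _ => ?_)
    ((memLp_mol hk hvm hv x).const_smul lam)
  have h := memLp_mol ((hk.dv (EuclideanSpace.single j 1)).dv (EuclideanSpace.single i 1)) hvm hv x
  refine h.of_le_mul (c := K) ?_ (ae_of_all _ fun t => (L t i j).le_of_opNorm_le (hL.bound _ i j) _)
  exact (ContinuousLinearMap.apply ℂ (Val d₁) |>.flip).aestronglyMeasurable_comp₂ (hL.meas i j) h.1

lemma integrable_mol_mul_mol {B : ℝ → Val d₁ →L[ℂ] Val d₁} {K : ℝ}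
    (hB : AEStronglyMeasurable B volume) (hK : ∀ t, ‖B t‖ ≤ K)
    (hvm : StronglyMeasurable v) (hv : MemLp v 2) {k₁ k₂ : EuclideanSpace ℝ (Fin d) → ℝ}
    (h₁ : IsTest k₁) (h₂ : IsTest k₂) {c : ℝ → ℝ} (hc : IsTest c)
    {a : EuclideanSpace ℝ (Fin d) → ℝ} (ha : Continuous a) (hac : HasCompactSupport a) :
    Integrable fun z : SpaceTime d =>
      (c z.1 * a z.2) * inner ℝ (B z.1 (mol k₁ v z)) (mol k₂ v z) := by
  obtain ⟨C, hC⟩ := hc.compact.exists_bound_of_continuous hc.continuous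
  have hK0 : 0 ≤ K := (norm_nonneg _).trans (hK 0)
  have hC0 : 0 ≤ C := (norm_nonneg _).trans (hC 0)
  have hi := (((integrable_slice_normSq hv).const_mul
    (C * (K * ((∫ y, k₁ y ^ 2) + ∫ y, k₂ y ^ 2)))).mul_prod
    ((ha.integrable_of_hasCompactSupport (μ := volume) hac).norm))
  have hBm : AEStronglyMeasurable (fun z : SpaceTime d => B z.1)
      ((volume : Measure ℝ).prod volume) := hB.comp_fst
  refine hi.mono' ?_ ?_
  · refine AEStronglyMeasurable.mul ?_ ?_
    · exact ((hc.continuous.comp continuous_fst).mul (ha.comp continuous_snd)).aestronglyMeasurable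
    · refine AEStronglyMeasurable.inner (𝕜 := ℝ) ?_
        (stronglyMeasurable_mol h₂.continuous hvm).aestronglyMeasurable
      exact (ContinuousLinearMap.apply ℂ (Val d₁) |>.flip).aestronglyMeasurable_comp₂ hBm
        (stronglyMeasurable_mol h₁.continuous hvm).aestronglyMeasurable
  · have hs := ae_memLp_slice hv
    have : ∀ᵐ z ∂((volume : Measure ℝ).prod (volume : Measure (EuclideanSpace ℝ (Fin d)))),
        MemLp (fun y => v (z.1, y)) 2 := Measure.quasiMeasurePreserving_fst.ae hs
    filter_upwards [this] with z hz
    have b1 := norm_mol_sq_le h₁ hz z.2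
    have b2 := norm_mol_sq_le h₂ hz z.2
    rw [norm_mul, norm_mul, mul_assoc, mul_assoc C, mul_assoc C]
    refine mul_le_mul (hC _) ?_ (by positivity) hC0
    rw [mul_comm ‖a z.2‖]
    refine mul_le_mul_of_nonneg_right ?_ (norm_nonneg _)
    refine (norm_inner_le_norm _ _).trans ?_
    have b3 := (B z.1).le_of_opNorm_le (hK z.1) (mol k₁ v z)
    calc ‖B z.1 (mol k₁ v z)‖ * ‖mol k₂ v z‖ ≤ K * ‖mol k₁ v z‖ * ‖mol k₂ v z‖ := by gcongr
      _ = K * (‖mol k₁ v z‖ * ‖mol k₂ v z‖) := by ring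
      _ ≤ K * (‖mol k₁ v z‖ ^ 2 + ‖mol k₂ v z‖ ^ 2) := by
          gcongr
          nlinarith [sq_nonneg (‖mol k₁ v z‖ - ‖mol k₂ v z‖), norm_nonneg (mol k₁ v z),
            norm_nonneg (mol k₂ v z)]
      _ ≤ K * ((∫ y, k₁ y ^ 2) * (∫ y, ‖v (z.1, y)‖ ^ 2) +
            (∫ y, k₂ y ^ 2) * (∫ y, ‖v (z.1, y)‖ ^ 2)) := by gcongr
      _ = _ := by ring

/-- The energy inequality for the mollification of a very weak solution. The equation for `mol k v`
is multiplied by `χ ζ² (mol k v)`; at every point of space `integral_deriv_mul_normSq` deals with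
the time derivative, and at almost every time `garding_cutoff_integral` with the elliptic part. -/
lemma energy_mollified [NeZero d] {δ K : ℝ} (hδ : 0 < δ)
    {L : ℝ → Fin d → Fin d → Val d₁ →L[ℂ] Val d₁} (hL : IsParabolic δ K L)
    (hvm : StronglyMeasurable v) (hv : MemLp v 2) {lam : ℝ} (hlam : 0 ≤ lam)
    {k : EuclideanSpace ℝ (Fin d) → ℝ} (hk : IsTest k)
    {ζ : EuclideanSpace ℝ (Fin d) → ℝ} (hζ : IsTest ζ) (hs : tsupport ζ ⊆ {x | 0 < x 0})
    {U : Set ℝ} (hU : IsOpen U) (hUc : U.OrdConnected)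
    (hweak : ∀ x ∈ tsupport ζ, ∀ χ : ℝ → ℝ, IsTest χ → tsupport χ ⊆ U →
      ∫ z, weakIntegrand L lam χ (fun y => k (x - y)) v z = 0)
    {χ : ℝ → ℝ} (hχ : IsTest χ) (hχU : tsupport χ ⊆ U) (hχ0 : ∀ t, 0 ≤ χ t) :
    δ / 4 * ∫ z : SpaceTime d, (χ z.1 * ((z.2 0)⁻¹ * ζ z.2) ^ 2) * ‖mol k v z‖ ^ 2 ≤
      (∫ z : SpaceTime d, (deriv χ z.1 * ζ z.2 ^ 2) * ‖mol k v z‖ ^ 2) +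
      2 * (2 * K ^ 2 * d / δ + K) *
        ∫ z : SpaceTime d, (χ z.1 * (∑ i, |pd i ζ z.2|) ^ 2) * ‖mol k v z‖ ^ 2 := by
  set C := 2 * K ^ 2 * d / δ + K with hC
  have hζc := hζ.continuous
  have hsub : ∀ {g : EuclideanSpace ℝ (Fin d) → ℝ}, (∀ x, x ∉ tsupport ζ → g x = 0) →
      HasCompactSupport g := fun h => hζ.compact.mono' fun x hx => by
    by_contra h'
    exact hx (h x h')
  have hζ0 : ∀ x, x ∉ tsupport ζ → ζ x = 0 := fun x hx => image_eq_zero_of_notMem_tsupport hx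
  -- the three weights
  have a1 : Continuous fun x : EuclideanSpace ℝ (Fin d) => ((x 0)⁻¹ * ζ x) ^ 2 :=
    (hζ.inv_coord_smul hs).continuous.pow 2
  have a1' : HasCompactSupport fun x : EuclideanSpace ℝ (Fin d) => ((x 0)⁻¹ * ζ x) ^ 2 :=
    hsub fun x hx => by simp [hζ0 x hx]
  have a2 : Continuous fun x => ζ x ^ 2 := hζc.pow 2
  have a2' : HasCompactSupport fun x => ζ x ^ 2 := hsub fun x hx => by simp [hζ0 x hx]
  have a3 : Continuous fun x => (∑ i, |pd i ζ x|) ^ 2 := by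
    have : ∀ i, Continuous (pd i ζ) := fun i => (hζ.dv _).continuous
    fun_prop
  have a3' : HasCompactSupport fun x => (∑ i, |pd i ζ x|) ^ 2 := hsub fun x hx => by
    have : ∀ i, pd i ζ x = 0 := fun i =>
      image_eq_zero_of_notMem_tsupport fun h' => hx (tsupport_dv_subset _ _ h')
    simp [this]
  have hN : ∀ {c : ℝ → ℝ} {a : EuclideanSpace ℝ (Fin d) → ℝ}, IsTest c → Continuous a →
      HasCompactSupport a →
      Integrable fun z : SpaceTime d => (c z.1 * a z.2) * ‖mol k v z‖ ^ 2 := by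
    intro c a hc ha ha'
    have := integrable_mol_mul_mol (B := fun _ => ContinuousLinearMap.id ℂ (Val d₁)) (K := 1)
      aestronglyMeasurable_const (fun _ => ContinuousLinearMap.norm_id_le) hvm hv hk hk hc ha ha'
    simpa using this
  have hM : ∀ i j, Integrable fun z : SpaceTime d => (χ z.1 * ζ z.2 ^ 2) *
      inner ℝ (L z.1 i j (mol (pd i (pd j k)) v z)) (mol k v z) := fun i j =>
    integrable_mol_mul_mol (hL.meas i j) (fun t => hL.bound t i j) hvm hv ((hk.dv _).dv _) hk hχ
      a2 a2'
  -- the time derivative is balanced by the elliptic part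
  have hF : ∫ z : SpaceTime d, ((deriv χ z.1 * ζ z.2 ^ 2) * ‖mol k v z‖ ^ 2 +
      2 * (∑ i, ∑ j, (χ z.1 * ζ z.2 ^ 2) *
        inner ℝ (L z.1 i j (mol (pd i (pd j k)) v z)) (mol k v z)) -
      2 * lam * ((χ z.1 * ζ z.2 ^ 2) * ‖mol k v z‖ ^ 2)) = 0 := by
    have hint : Integrable (fun z : SpaceTime d => (deriv χ z.1 * ζ z.2 ^ 2) * ‖mol k v z‖ ^ 2 +
      2 * (∑ i, ∑ j, (χ z.1 * ζ z.2 ^ 2) *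
        inner ℝ (L z.1 i j (mol (pd i (pd j k)) v z)) (mol k v z)) -
      2 * lam * ((χ z.1 * ζ z.2 ^ 2) * ‖mol k v z‖ ^ 2))
      ((volume : Measure ℝ).prod (volume : Measure (EuclideanSpace ℝ (Fin d)))) :=
      ((hN hχ.deriv a2 a2').add ((integrable_finsetSum _ fun i _ =>
        integrable_finsetSum _ fun j _ => hM i j).const_mul 2)).sub
        ((hN hχ a2 a2').const_mul (2 * lam))
    rw [Measure.volume_eq_prod, integral_prod_symm _ hint]
    refine integral_eq_zero_of_ae (ae_of_all _ fun x => ?_)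
    by_cases hx : x ∈ tsupport ζ
    · have h1 := integral_deriv_mul_normSq (memLp_mol hk hvm hv x) (memLp_molRhs hL hvm hv lam hk x)
        hU hUc (fun ψ hψ hψU => integral_mol_weak hL hv lam hψ hk x (hweak x hx ψ hψ hψU)) hχ hχU
      have e : ∀ t : ℝ, (deriv χ t * ζ x ^ 2) * ‖mol k v (t, x)‖ ^ 2 +
          2 * (∑ i, ∑ j, (χ t * ζ x ^ 2) *
            inner ℝ (L t i j (mol (pd i (pd j k)) v (t, x))) (mol k v (t, x))) -
          2 * lam * ((χ t * ζ x ^ 2) * ‖mol k v (t, x)‖ ^ 2) =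
          ζ x ^ 2 * (deriv χ t * ‖mol k v (t, x)‖ ^ 2 +
            2 * χ t * inner ℝ (molRhs L lam k v (t, x)) (mol k v (t, x))) := by
        intro t
        simp only [molRhs, inner_sub_left, sum_inner, real_inner_smul_left,
          real_inner_self_eq_norm_sq, ← Finset.mul_sum]
        ring
      simp only [Pi.zero_apply]
      simp_rw [e]
      rw [integral_const_mul, h1, mul_zero]
    · simp [hζ0 x hx]
  -- the elliptic part is controlled at almost every time
  have hΦ : ∫ z : SpaceTime d, (δ / 8 * ((χ z.1 * ((z.2 0)⁻¹ * ζ z.2) ^ 2) * ‖mol k v z‖ ^ 2) +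
      (∑ i, ∑ j, (χ z.1 * ζ z.2 ^ 2) *
        inner ℝ (L z.1 i j (mol (pd i (pd j k)) v z)) (mol k v z)) -
      C * ((χ z.1 * (∑ i, |pd i ζ z.2|) ^ 2) * ‖mol k v z‖ ^ 2)) ≤ 0 := by
    have hint : Integrable (fun z : SpaceTime d =>
      δ / 8 * ((χ z.1 * ((z.2 0)⁻¹ * ζ z.2) ^ 2) * ‖mol k v z‖ ^ 2) +
      (∑ i, ∑ j, (χ z.1 * ζ z.2 ^ 2) *
        inner ℝ (L z.1 i j (mol (pd i (pd j k)) v z)) (mol k v z)) -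
      C * ((χ z.1 * (∑ i, |pd i ζ z.2|) ^ 2) * ‖mol k v z‖ ^ 2))
      ((volume : Measure ℝ).prod (volume : Measure (EuclideanSpace ℝ (Fin d)))) :=
      (((hN hχ a1 a1').const_mul _).add (integrable_finsetSum _ fun i _ =>
        integrable_finsetSum _ fun j _ => hM i j)).sub ((hN hχ a3 a3').const_mul _)
    rw [Measure.volume_eq_prod, integral_prod _ hint]
    refine integral_nonpos_of_ae ?_
    filter_upwards [ae_memLp_slice hv] with t ht
    have htl : LocallyIntegrable fun y => v (t, y) := ht.locallyIntegrable (by norm_num)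
    have h1 := garding_cutoff_integral hδ (hL.ell t) (hL.bound t) (mol_slice_smooth hk htl) hζ hs
    have e : ∀ x, δ / 8 * ((χ t * ((x 0)⁻¹ * ζ x) ^ 2) * ‖mol k v (t, x)‖ ^ 2) +
        (∑ i, ∑ j, (χ t * ζ x ^ 2) *
          inner ℝ (L t i j (mol (pd i (pd j k)) v (t, x))) (mol k v (t, x))) -
        C * ((χ t * (∑ i, |pd i ζ x|) ^ 2) * ‖mol k v (t, x)‖ ^ 2) =
        χ t * (δ / 8 * (((x 0)⁻¹ * ζ x) ^ 2 * ‖mol k v (t, x)‖ ^ 2) +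
      ∑ i, ∑ j, ζ x ^ 2 *
        inner ℝ (L t i j (pd i (pd j fun x => mol k v (t, x)) x)) (mol k v (t, x)) -
      (2 * K ^ 2 * d / δ + K) * ((∑ i, |pd i ζ x|) ^ 2 * ‖mol k v (t, x)‖ ^ 2)) := by
      intro x
      have e1 : ∀ i j, pd i (pd j fun x => mol k v (t, x)) x = mol (pd i (pd j k)) v (t, x) :=
        fun i j => by rw [pd, pd, dv_mol_slice hk htl, dv_mol_slice (hk.dv _) htl]
      simp only [e1, ← Finset.mul_sum, hC]
      ring
    simp_rw [e]
    rw [integral_const_mul]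
    exact mul_nonpos_of_nonneg_of_nonpos (hχ0 t) h1
  have hS : Integrable fun z : SpaceTime d => ∑ i, ∑ j, (χ z.1 * ζ z.2 ^ 2) *
        inner ℝ (L z.1 i j (mol (pd i (pd j k)) v z)) (mol k v z) :=
    integrable_finsetSum _ fun i _ => integrable_finsetSum _ fun j _ => hM i j
  have hF1 : Integrable fun z : SpaceTime d => (deriv χ z.1 * ζ z.2 ^ 2) * ‖mol k v z‖ ^ 2 +
      2 * (∑ i, ∑ j, (χ z.1 * ζ z.2 ^ 2) *
        inner ℝ (L z.1 i j (mol (pd i (pd j k)) v z)) (mol k v z)) :=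
    (hN hχ.deriv a2 a2').add (hS.const_mul 2)
  have hΦ1 : Integrable fun z : SpaceTime d =>
      δ / 8 * ((χ z.1 * ((z.2 0)⁻¹ * ζ z.2) ^ 2) * ‖mol k v z‖ ^ 2) +
      (∑ i, ∑ j, (χ z.1 * ζ z.2 ^ 2) *
        inner ℝ (L z.1 i j (mol (pd i (pd j k)) v z)) (mol k v z)) :=
    ((hN hχ a1 a1').const_mul _).add hS
  rw [integral_sub hF1 ((hN hχ a2 a2').const_mul _), integral_add (hN hχ.deriv a2 a2')
    (hS.const_mul 2), integral_const_mul, integral_const_mul] at hF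
  rw [integral_sub hΦ1 ((hN hχ a3 a3').const_mul _), integral_add ((hN hχ a1 a1').const_mul _)
    hS, integral_const_mul, integral_const_mul] at hΦ
  have hpos : 0 ≤ ∫ z : SpaceTime d, (χ z.1 * ζ z.2 ^ 2) * ‖mol k v z‖ ^ 2 :=
    integral_nonneg fun z => mul_nonneg (mul_nonneg (hχ0 _) (sq_nonneg _)) (sq_nonneg _)
  have := mul_nonneg hlam hpos
  linarith

end Energy

/-! ### Cutoff functions -/

section Cutoff

open Set

open Real (smoothTransition)

lemma hasDerivAt_smoothTransition (y : ℝ) : HasDerivAt smoothTransition (deriv smoothTransition y) y :=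
  ((Real.smoothTransition.contDiff (n := 1)).differentiable (by simp) y).hasDerivAt

lemma deriv_smoothTransition_of_one_lt {y : ℝ} (hy : 1 < y) : deriv smoothTransition y = 0 := by
  have : smoothTransition =ᶠ[𝓝 y] fun _ => 1 := by
    filter_upwards [lt_mem_nhds hy] with x hx
    exact Real.smoothTransition.one_of_one_le hx.le
  rw [this.deriv_eq]; simp

lemma deriv_smoothTransition_of_neg {y : ℝ} (hy : y < 0) : deriv smoothTransition y = 0 := by
  have : smoothTransition =ᶠ[𝓝 y] fun _ => 0 := by
    filter_upwards [gt_mem_nhds hy] with x hx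
    exact Real.smoothTransition.zero_of_nonpos hx.le
  rw [this.deriv_eq]; simp

lemma deriv_smoothTransition_nonneg (y : ℝ) : 0 ≤ deriv smoothTransition y :=
  Real.smoothTransition.monotone.deriv_nonneg

lemma exists_deriv_smoothTransition_le : ∃ S : ℝ, 0 < S ∧ ∀ y, deriv smoothTransition y ≤ S := by
  have hc : Continuous (deriv smoothTransition) :=
    (Real.smoothTransition.contDiff (n := 1)).continuous_deriv (by simp)
  obtain ⟨S, hS⟩ := (isCompact_Icc (a := (0 : ℝ)) (b := 1)).exists_bound_of_continuousOn
    hc.continuousOn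
  refine ⟨max S 1, by positivity, fun y => ?_⟩
  by_cases hy : y ∈ Icc (0 : ℝ) 1
  · exact (le_abs_self _).trans ((hS y hy).trans (le_max_left _ _))
  · rw [mem_Icc, not_and_or, not_le, not_le] at hy
    rcases hy with hy | hy
    · rw [deriv_smoothTransition_of_neg hy]; positivity
    · rw [deriv_smoothTransition_of_one_lt hy]; positivity

/-- Cutoffs in time that converge to one on `(-∞, T)`. Their derivatives are not bounded from below
near `T`, but in the energy inequality only an upper bound is needed. It has to decay faster than
`(n + 1)⁻²`, since the cutoff region in space has diameter of order `n + 1`, hence the power `4`. -/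
lemma exists_time_cutoff (T : WithTop ℝ) : ∃ S : ℝ, 0 ≤ S ∧ ∃ χ : ℕ → ℝ → ℝ,
    (∀ n, IsTest (χ n)) ∧ (∀ n, tsupport (χ n) ⊆ {t : ℝ | (t : WithTop ℝ) < T}) ∧
    (∀ n t, 0 ≤ χ n t) ∧ (∀ n t, χ n t ≤ 1) ∧ (∀ n t, deriv (χ n) t ≤ S / ((n : ℝ) + 1) ^ 4) ∧
    ∀ t : ℝ, (t : WithTop ℝ) < T → ∀ᶠ n in atTop, χ n t = 1 := by
  obtain ⟨S, hS0, hS⟩ := exists_deriv_smoothTransition_le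
  obtain ⟨τ, hτ1, hτ2⟩ : ∃ τ : ℕ → ℝ, (∀ n, (τ n : WithTop ℝ) < T) ∧
      ∀ t : ℝ, (t : WithTop ℝ) < T → ∀ᶠ n : ℕ in atTop, 1 ≤ ((n : ℝ) + 1) * (τ n - t) := by
    induction T using WithTop.recTopCoe with
    | top =>
      refine ⟨fun n => n, fun n => WithTop.coe_lt_top _, fun t _ => ?_⟩
      filter_upwards [eventually_ge_atTop ⌈t + 1⌉₊] with n hn
      have : t + 1 ≤ n := (Nat.le_ceil _).trans (by exact_mod_cast hn)
      have h0 : (0 : ℝ) ≤ n := n.cast_nonneg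
      nlinarith
    | coe T =>
      refine ⟨fun n => T - 1 / ((n : ℝ) + 1), fun n => ?_, fun t ht => ?_⟩
      · rw [WithTop.coe_lt_coe]
        have : 0 < 1 / ((n : ℝ) + 1) := by positivity
        linarith
      · rw [WithTop.coe_lt_coe] at ht
        filter_upwards [eventually_ge_atTop ⌈2 / (T - t)⌉₊] with n hn
        have h1 : 2 / (T - t) ≤ n := (Nat.le_ceil _).trans (by exact_mod_cast hn)
        rw [div_le_iff₀ (by linarith)] at h1
        have h2 : ((n : ℝ) + 1) * (T - 1 / ((n : ℝ) + 1) - t) = ((n : ℝ) + 1) * (T - t) - 1 := by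
          field_simp
          ring
        rw [h2]
        nlinarith
  have hN : ∀ n : ℕ, 0 < ((n : ℝ) + 1) := fun n => by positivity
  set χ : ℕ → ℝ → ℝ := fun n t =>
    smoothTransition (2 + t / ((n : ℝ) + 1) ^ 4) * smoothTransition (((n : ℝ) + 1) * (τ n - t)) with hχ
  have hsupp : ∀ n, Function.support (χ n) ⊆ Icc (-2 * ((n : ℝ) + 1) ^ 4) (τ n) := by
    intro n t ht
    by_contra h
    apply ht
    rw [mem_Icc, not_and_or, not_le, not_le] at h
    have hN4 : 0 < ((n : ℝ) + 1) ^ 4 := by positivity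
    rcases h with h | h
    · have : smoothTransition (2 + t / ((n : ℝ) + 1) ^ 4) = 0 := by
        refine Real.smoothTransition.zero_of_nonpos ?_
        have : t / ((n : ℝ) + 1) ^ 4 < -2 := by rw [div_lt_iff₀ hN4]; linarith
        linarith
      simp [hχ, this]
    · have : smoothTransition (((n : ℝ) + 1) * (τ n - t)) = 0 := by
        refine Real.smoothTransition.zero_of_nonpos ?_
        have := hN n
        nlinarith
      simp [hχ, this]
  refine ⟨S, hS0.le, χ, fun n => ⟨?_, ?_⟩, fun n => ?_, fun n t => ?_, fun n t => ?_, fun n t => ?_,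
    fun t ht => ?_⟩
  · exact (Real.smoothTransition.contDiff.comp (by fun_prop)).mul
      (Real.smoothTransition.contDiff.comp (by fun_prop))
  · exact HasCompactSupport.of_support_subset_isCompact isCompact_Icc (hsupp n)
  · refine (closure_minimal (hsupp n) isClosed_Icc).trans fun t ht => ?_
    exact lt_of_le_of_lt (WithTop.coe_le_coe.2 ht.2) (hτ1 n)
  · exact mul_nonneg (Real.smoothTransition.nonneg _) (Real.smoothTransition.nonneg _)
  · exact mul_le_one₀ (Real.smoothTransition.le_one _) (Real.smoothTransition.nonneg _)
      (Real.smoothTransition.le_one _)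
  · have h1 : HasDerivAt (fun t : ℝ => 2 + t / ((n : ℝ) + 1) ^ 4) (1 / ((n : ℝ) + 1) ^ 4) t :=
      ((hasDerivAt_id t).div_const _).const_add 2
    have h2 : HasDerivAt (fun t : ℝ => ((n : ℝ) + 1) * (τ n - t)) (((n : ℝ) + 1) * -1) t :=
      ((hasDerivAt_id t).const_sub (τ n)).const_mul _
    have h3 := ((hasDerivAt_smoothTransition _).comp t h1).mul
      ((hasDerivAt_smoothTransition _).comp t h2)
    have h4 : deriv (χ n) t = _ := h3.deriv
    rw [h4]
    have a1 := Real.smoothTransition.nonneg (2 + t / ((n : ℝ) + 1) ^ 4)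
    have a2 := Real.smoothTransition.nonneg (((n : ℝ) + 1) * (τ n - t))
    have a3 := Real.smoothTransition.le_one (((n : ℝ) + 1) * (τ n - t))
    have a4 := hS (2 + t / ((n : ℝ) + 1) ^ 4)
    have a5 := deriv_smoothTransition_nonneg (2 + t / ((n : ℝ) + 1) ^ 4)
    have a6 := deriv_smoothTransition_nonneg (((n : ℝ) + 1) * (τ n - t))
    simp only [Function.comp_apply]
    have b1 : deriv smoothTransition (2 + t / ((n : ℝ) + 1) ^ 4) * (1 / ((n : ℝ) + 1) ^ 4) *
        smoothTransition (((n : ℝ) + 1) * (τ n - t)) ≤ S * (1 / ((n : ℝ) + 1) ^ 4) * 1 := by gcongr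
    have b2 : 0 ≤ smoothTransition (2 + t / ((n : ℝ) + 1) ^ 4) *
        (deriv smoothTransition (((n : ℝ) + 1) * (τ n - t)) * ((n : ℝ) + 1)) := by positivity
    have b3 : S / ((n : ℝ) + 1) ^ 4 = S * (1 / ((n : ℝ) + 1) ^ 4) * 1 := by ring
    rw [b3]
    linarith
  · have hlim : ∀ᶠ n : ℕ in atTop, -(1 : ℝ) ≤ t / ((n : ℝ) + 1) ^ 4 := by
      filter_upwards [eventually_ge_atTop ⌈|t|⌉₊] with n hn
      have h1 : |t| ≤ n := (Nat.le_ceil _).trans (by exact_mod_cast hn)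
      have h2 : (n : ℝ) ≤ ((n : ℝ) + 1) ^ 4 := by
        have h0 : (1 : ℝ) ≤ (n : ℝ) + 1 := by linarith [(n.cast_nonneg : (0 : ℝ) ≤ n)]
        have := le_self_pow₀ h0 (n := 4) (by norm_num)
        linarith
      rw [le_div_iff₀ (by positivity)]
      linarith [neg_abs_le t]
    filter_upwards [hlim, hτ2 t ht] with n h1 h2
    simp only [hχ]
    rw [Real.smoothTransition.one_of_one_le (by linarith), Real.smoothTransition.one_of_one_le h2,
      one_mul]

variable {d : ℕ} [NeZero d]

/-- Cutoffs in space that converge to one on the half space, with gradients of size `C / x_1`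
uniformly in the scale `N`. Such gradients are controlled by the weight of Hardy's inequality. -/
lemma exists_space_cutoff : ∃ C : ℝ, ∀ N : ℝ, 1 ≤ N →
    ∃ ζ : EuclideanSpace ℝ (Fin d) → ℝ, IsTest ζ ∧
      tsupport ζ ⊆ {x | 1 / N ≤ x 0 ∧ ‖x‖ ≤ 2 * N} ∧ (∀ x, 0 ≤ ζ x) ∧ (∀ x, ζ x ≤ 1) ∧
      (∀ x, 2 / N < x 0 → ‖x‖ < N → ζ x = 1 ∧ ∀ i, pd i ζ x = 0) ∧
      ∀ x, 0 < x 0 → ∑ i, |pd i ζ x| ≤ C / x 0 := by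
  obtain ⟨S, hS0, hS⟩ := exists_deriv_smoothTransition_le
  refine ⟨d * (10 * S), fun N hN => ?_⟩
  have hN0 : 0 < N := by linarith
  set a : EuclideanSpace ℝ (Fin d) → ℝ := fun x => smoothTransition (N * x 0 - 1) with ha
  set b : EuclideanSpace ℝ (Fin d) → ℝ := fun x => smoothTransition (2 - ‖x‖ ^ 2 / N ^ 2) with hb
  have has : ContDiff ℝ ∞ a := Real.smoothTransition.contDiff.comp
    ((contDiff_const.mul (coord_smooth 0)).sub contDiff_const)
  have hbs : ContDiff ℝ ∞ b := Real.smoothTransition.contDiff.comp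
    (contDiff_const.sub ((contDiff_id.norm_sq ℝ).div_const _))
  set ζ : EuclideanSpace ℝ (Fin d) → ℝ := fun x => a x * b x with hζ
  have hsupp : Function.support ζ ⊆ {x | 1 / N ≤ x 0 ∧ ‖x‖ ≤ 2 * N} := by
    intro x hx
    by_contra h
    apply hx
    rw [mem_ofPred_eq, not_and_or, not_le, not_le] at h
    rcases h with h | h
    · have : a x = 0 := by
        refine Real.smoothTransition.zero_of_nonpos ?_
        rw [lt_div_iff₀ hN0] at h
        linarith
      simp [hζ, this]
    · have : b x = 0 := by
        refine Real.smoothTransition.zero_of_nonpos ?_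
        have : 2 ≤ ‖x‖ ^ 2 / N ^ 2 := by
          rw [le_div_iff₀ (by positivity)]
          nlinarith
        linarith
      simp [hζ, this]
  have hcl : IsClosed {x : EuclideanSpace ℝ (Fin d) | 1 / N ≤ x 0 ∧ ‖x‖ ≤ 2 * N} :=
    (isClosed_le continuous_const (coord_smooth (0 : Fin d)).continuous).inter
      (isClosed_le continuous_norm continuous_const)
  have hts : tsupport ζ ⊆ {x | 1 / N ≤ x 0 ∧ ‖x‖ ≤ 2 * N} := closure_minimal hsupp hcl
  have hcomp : IsCompact {x : EuclideanSpace ℝ (Fin d) | 1 / N ≤ x 0 ∧ ‖x‖ ≤ 2 * N} := by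
    refine (isCompact_closedBall (0 : EuclideanSpace ℝ (Fin d)) (2 * N)).of_isClosed_subset hcl ?_
    intro x hx
    simpa using hx.2
  have hζt : IsTest ζ :=
    ⟨has.mul hbs, HasCompactSupport.of_support_subset_isCompact hcomp hsupp⟩
  refine ⟨ζ, hζt, hts, fun x => ?_, fun x => ?_, fun x h1 h2 => ?_, fun x hx => ?_⟩
  · exact mul_nonneg (Real.smoothTransition.nonneg _) (Real.smoothTransition.nonneg _)
  · exact mul_le_one₀ (Real.smoothTransition.le_one _) (Real.smoothTransition.nonneg _)
      (Real.smoothTransition.le_one _)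
  · have hloc : ∀ y : EuclideanSpace ℝ (Fin d), 2 / N < y 0 → ‖y‖ < N → ζ y = 1 := by
      intro y hy1 hy2
      have e1 : a y = 1 := by
        refine Real.smoothTransition.one_of_one_le ?_
        rw [div_lt_iff₀ hN0] at hy1
        linarith
      have e2 : b y = 1 := by
        refine Real.smoothTransition.one_of_one_le ?_
        have : ‖y‖ ^ 2 / N ^ 2 ≤ 1 := by
          rw [div_le_one (by positivity)]
          gcongr
        linarith
      simp [hζ, e1, e2]
    refine ⟨hloc x h1 h2, fun i => ?_⟩
    have hev : ζ =ᶠ[𝓝 x] fun _ => 1 := by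
      have o1 : IsOpen {y : EuclideanSpace ℝ (Fin d) | 2 / N < y 0} :=
        isOpen_lt continuous_const (coord_smooth (0 : Fin d)).continuous
      have o2 : IsOpen {y : EuclideanSpace ℝ (Fin d) | ‖y‖ < N} :=
        isOpen_lt continuous_norm continuous_const
      filter_upwards [o1.mem_nhds h1, o2.mem_nhds h2] with y hy1 hy2
      exact hloc y hy1 hy2
    rw [pd, dv, hev.fderiv_eq]
    simp
  · have key : ∀ i, |pd i ζ x| ≤ 10 * S / x 0 := by
      intro i
      by_cases hxs : x ∈ tsupport ζ
      swap
      · have : pd i ζ x = 0 :=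
          image_eq_zero_of_notMem_tsupport fun h' => hxs (tsupport_dv_subset _ _ h')
        rw [this]
        simp only [abs_zero]
        positivity
      obtain ⟨hx1, hx2⟩ := hts hxs
      have hζd : pd i ζ x = a x * pd i b x + pd i a x * b x :=
        congrFun (dv_smul (has.differentiable (by simp)) (hbs.differentiable (by simp))
          (EuclideanSpace.single i 1)) x
      have hxn : x 0 ≤ ‖x‖ := (le_abs_self _).trans (by
        simpa using PiLp.norm_apply_le x (0 : Fin d))
      have hda : pd i a x = deriv smoothTransition (N * x 0 - 1) * (N * pd i (fun y => y 0) x) := by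
        have h1 : HasFDerivAt (fun y : EuclideanSpace ℝ (Fin d) => N * y 0 - 1)
            (N • fderiv ℝ (fun y : EuclideanSpace ℝ (Fin d) => y 0) x) x :=
          ((((coord_smooth (0 : Fin d)).differentiable (by simp)) x).hasFDerivAt.const_mul N).sub_const 1
        have h2 := (hasDerivAt_smoothTransition (N * x 0 - 1)).comp_hasFDerivAt x h1
        have h3 : fderiv ℝ a x = _ := h2.fderiv
        rw [pd, dv, h3]
        simp [pd, dv]
      have hdb : pd i b x = deriv smoothTransition (2 - ‖x‖ ^ 2 / N ^ 2) * (-(2 * x i) / N ^ 2) := by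
        have h1 : HasFDerivAt (fun y : EuclideanSpace ℝ (Fin d) => 2 - ‖y‖ ^ 2 * (N ^ 2)⁻¹)
            (-((N ^ 2)⁻¹ • (2 • innerSL ℝ x))) x :=
          ((hasStrictFDerivAt_norm_sq x).hasFDerivAt.mul_const _).const_sub 2
        have h2 := (hasDerivAt_smoothTransition (2 - ‖x‖ ^ 2 * (N ^ 2)⁻¹)).comp_hasFDerivAt x h1
        have h3 : fderiv ℝ b x = _ := h2.fderiv
        rw [pd, dv, h3]
        simp only [smul_apply, neg_apply,
          innerSL_apply_apply, EuclideanSpace.inner_single_right, smul_eq_mul, nsmul_eq_mul,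
          div_eq_mul_inv]
        simp
        left
        ring
      have ea : |pd i a x| ≤ 2 * S / x 0 := by
        rw [hda, pd_coord, abs_mul, abs_of_nonneg (deriv_smoothTransition_nonneg _)]
        by_cases h2 : 1 < N * x 0 - 1
        · rw [deriv_smoothTransition_of_one_lt h2, zero_mul]; positivity
        · have h3 : N ≤ 2 / x 0 := by rw [le_div_iff₀ hx]; linarith
          have h4 : |N * (if (0 : Fin d) = i then (1 : ℝ) else 0)| ≤ N := by
            split_ifs
            · rw [mul_one, abs_of_pos hN0]
            · simp [hN0.le]
          calc _ ≤ S * (2 / x 0) :=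
                mul_le_mul (hS _) (h4.trans h3) (abs_nonneg _) hS0.le
            _ = _ := by ring
      have eb : |pd i b x| ≤ 8 * S / x 0 := by
        rw [hdb, abs_mul, abs_of_nonneg (deriv_smoothTransition_nonneg _)]
        have h4 : |-(2 * x i) / N ^ 2| ≤ 8 / x 0 := by
          rw [abs_div, abs_neg, abs_mul, abs_two, abs_of_pos (by positivity : 0 < N ^ 2),
            div_le_div_iff₀ (by positivity) hx]
          have h5 : |x i| ≤ 2 * N := by
            have := PiLp.norm_apply_le x i
            simp only [Real.norm_eq_abs] at this
            linarith
          have h6 : x 0 ≤ 2 * N := by linarith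
          calc 2 * |x i| * x 0 ≤ 2 * (2 * N) * (2 * N) := by gcongr
            _ = 8 * N ^ 2 := by ring
        calc _ ≤ S * (8 / x 0) := mul_le_mul (hS _) h4 (abs_nonneg _) hS0.le
          _ = _ := by ring
      have ha1 : |a x| ≤ 1 := by
        rw [abs_of_nonneg (Real.smoothTransition.nonneg _)]
        exact Real.smoothTransition.le_one _
      have hb1 : |b x| ≤ 1 := by
        rw [abs_of_nonneg (Real.smoothTransition.nonneg _)]
        exact Real.smoothTransition.le_one _
      rw [hζd]
      calc |a x * pd i b x + pd i a x * b x| ≤ |a x| * |pd i b x| + |pd i a x| * |b x| := by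
            refine (abs_add_le _ _).trans ?_
            rw [abs_mul, abs_mul]
        _ ≤ 1 * (8 * S / x 0) + (2 * S / x 0) * 1 := by gcongr
        _ = _ := by ring
    calc ∑ i, |pd i ζ x| ≤ ∑ _i : Fin d, 10 * S / x 0 := Finset.sum_le_sum fun i _ => key i
      _ = d * (10 * S) / x 0 := by simp; ring

end Cutoff

/-! ### Approximate identities -/

section ApproxIdentity

variable {d d₁ : ℕ}

/-- An approximate identity for which averages converge almost everywhere, by the Lebesgue
differentiation theorem. -/
lemma exists_mollifier : ∃ ρ : ℕ → EuclideanSpace ℝ (Fin d) → ℝ, (∀ n, IsTest (ρ n)) ∧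
    (∀ n y, 0 ≤ ρ n y) ∧ (∀ n, ∫ y, ρ n y = 1) ∧
    (∀ n y, ρ n y ≠ 0 → ‖y‖ < 1 / (2 * ((n : ℝ) + 1))) ∧
    ∀ g : EuclideanSpace ℝ (Fin d) → Val d₁, LocallyIntegrable g →
      ∀ᵐ x, Tendsto (fun n => ∫ y, ρ n (x - y) • g y) atTop (𝓝 (g x)) := by
  let φ : ℕ → ContDiffBump (0 : EuclideanSpace ℝ (Fin d)) := fun n =>
    { rIn := 1 / (4 * ((n : ℝ) + 1))
      rOut := 1 / (2 * ((n : ℝ) + 1))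
      rIn_pos := by positivity
      rIn_lt_rOut := by
        have : (0 : ℝ) < n + 1 := by positivity
        apply one_div_lt_one_div_of_lt <;> linarith }
  refine ⟨fun n => (φ n).normed volume, fun n => ⟨(φ n).contDiff_normed,
    (φ n).hasCompactSupport_normed⟩, fun n => (φ n).nonneg_normed, fun n => (φ n).integral_normed,
    fun n y hy => ?_, fun g hg => ?_⟩
  · have h : y ∈ Function.support ((φ n).normed volume) := hy
    rw [(φ n).support_normed_eq] at h
    exact mem_ball_zero_iff.1 h
  · have h1 : Tendsto (fun n => (φ n).rOut) atTop (𝓝 0) := by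
      have := (tendsto_one_div_add_atTop_nhds_zero_nat (𝕜 := ℝ)).const_mul (1 / 2)
      rw [mul_zero] at this
      refine this.congr fun n => ?_
      change 1 / 2 * (1 / ((n : ℝ) + 1)) = 1 / (2 * ((n : ℝ) + 1))
      field_simp
    have h2 : ∀ᶠ n in atTop, (φ n).rOut ≤ 2 * (φ n).rIn := Eventually.of_forall fun n => by
      change 1 / (2 * ((n : ℝ) + 1)) ≤ 2 * (1 / (4 * ((n : ℝ) + 1)))
      apply le_of_eq
      field_simp
      norm_num
    filter_upwards [ContDiffBump.ae_convolution_tendsto_right_of_locallyIntegrable h1 h2 hg]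
      with x hx
    simpa only [convolution_lsmul_swap] using hx

/-- Jensen's inequality for averages with respect to a mollifier. -/
lemma enorm_mol_sq_le {ρ : EuclideanSpace ℝ (Fin d) → ℝ} (hρ : IsTest ρ) (h0 : ∀ y, 0 ≤ ρ y)
    (h1 : ∫ y, ρ y = 1) {v : SpaceTime d → Val d₁} (hv : StronglyMeasurable v) (z : SpaceTime d) :
    ‖mol ρ v z‖ₑ ^ 2 ≤ ∫⁻ y, ENNReal.ofReal (ρ (z.2 - y)) * ‖v (z.1, y)‖ₑ ^ 2 := by
  have hc : Continuous fun y => ρ (z.2 - y) := hρ.continuous.comp (by fun_prop)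
  have hvs : StronglyMeasurable fun y => v (z.1, y) := hv.comp_measurable (by fun_prop)
  set r : EuclideanSpace ℝ (Fin d) → ℝ≥0∞ := fun y => ENNReal.ofReal (√(ρ (z.2 - y))) with hr
  have hrm : Measurable r := (Real.continuous_sqrt.comp hc).measurable.ennreal_ofReal
  have hr2 : ∀ y, r y ^ 2 = ENNReal.ofReal (ρ (z.2 - y)) := fun y => by
    rw [hr, ← ENNReal.ofReal_pow (Real.sqrt_nonneg _), Real.sq_sqrt (h0 _)]
  have hone : ∫⁻ y, r y ^ 2 = 1 := by
    simp_rw [hr2]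
    rw [← ofReal_integral_eq_lintegral_ofReal
      (hc.integrable_of_hasCompactSupport (hρ.comp_sub_left z.2).compact)
      (ae_of_all _ fun y => h0 _), integral_sub_left_eq_self (fun y => ρ y), h1, ENNReal.ofReal_one]
  have e1 : ‖mol ρ v z‖ₑ ≤ ∫⁻ y, r y * (r y * ‖v (z.1, y)‖ₑ) := by
    refine (enorm_integral_le_lintegral_enorm _).trans (le_of_eq (lintegral_congr fun y => ?_))
    rw [enorm_smul, ← mul_assoc, ← sq, hr2, Real.enorm_of_nonneg (h0 _)]
  have e2 := ENNReal.lintegral_mul_le_Lp_mul_Lq volume Real.HolderConjugate.two_two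
    hrm.aemeasurable (hrm.mul hvs.enorm).aemeasurable
  simp only [Pi.mul_apply, ENNReal.rpow_two, hone, ENNReal.one_rpow, one_mul] at e2
  calc ‖mol ρ v z‖ₑ ^ 2 ≤ ((∫⁻ y, (r y * ‖v (z.1, y)‖ₑ) ^ 2) ^ (1 / 2 : ℝ)) ^ 2 := by
        gcongr
        exact e1.trans e2
    _ = ∫⁻ y, (r y * ‖v (z.1, y)‖ₑ) ^ 2 := by
        rw [← ENNReal.rpow_two, ← ENNReal.rpow_mul]
        norm_num
    _ = _ := by simp_rw [mul_pow, hr2]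

/-- Mollification is bounded in weighted `L²` spaces if the weights are comparable on the scale of
the mollifier. -/
lemma lintegral_mul_enorm_mol_sq_le {ρ : EuclideanSpace ℝ (Fin d) → ℝ} (hρ : IsTest ρ)
    (h0 : ∀ y, 0 ≤ ρ y) (h1 : ∫ y, ρ y = 1) {v : SpaceTime d → Val d₁} (hv : StronglyMeasurable v)
    {w w' : EuclideanSpace ℝ (Fin d) → ℝ≥0∞} (hw : Measurable w) (hw' : Measurable w')
    (hww : ∀ x y, ρ (x - y) ≠ 0 → w x ≤ w' y) :
    ∫⁻ z : SpaceTime d, w z.2 * ‖mol ρ v z‖ₑ ^ 2 ≤ ∫⁻ z : SpaceTime d, w' z.2 * ‖v z‖ₑ ^ 2 := by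
  have hm := stronglyMeasurable_mol hρ.continuous hv
  have m1 : Measurable fun z : SpaceTime d => w z.2 * ‖mol ρ v z‖ₑ ^ 2 :=
    (hw.comp measurable_snd).mul (hm.enorm.pow_const 2)
  have m2 : Measurable fun z : SpaceTime d => w' z.2 * ‖v z‖ₑ ^ 2 :=
    (hw'.comp measurable_snd).mul (hv.enorm.pow_const 2)
  rw [Measure.volume_eq_prod, lintegral_prod _ m1.aemeasurable, lintegral_prod _ m2.aemeasurable]
  refine lintegral_mono fun t => ?_
  have hvt : Measurable fun y => ‖v (t, y)‖ₑ ^ 2 :=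
    (hv.comp_measurable (g := fun y => (t, y)) (by fun_prop)).enorm.pow_const 2
  have hρm : Measurable fun p : EuclideanSpace ℝ (Fin d) × EuclideanSpace ℝ (Fin d) =>
      ENNReal.ofReal (ρ (p.1 - p.2)) := (hρ.continuous.comp (by fun_prop)).measurable.ennreal_ofReal
  calc ∫⁻ x, w x * ‖mol ρ v (t, x)‖ₑ ^ 2
      ≤ ∫⁻ x, ∫⁻ y, ENNReal.ofReal (ρ (x - y)) * (w' y * ‖v (t, y)‖ₑ ^ 2) := by
        refine lintegral_mono fun x => ?_
        have hρx : Measurable fun y => ENNReal.ofReal (ρ (x - y)) :=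
          hρm.comp measurable_prodMk_left
        calc w x * ‖mol ρ v (t, x)‖ₑ ^ 2
            ≤ w x * ∫⁻ y, ENNReal.ofReal (ρ (x - y)) * ‖v (t, y)‖ₑ ^ 2 := by
              gcongr
              exact enorm_mol_sq_le hρ h0 h1 hv (t, x)
          _ = ∫⁻ y, w x * (ENNReal.ofReal (ρ (x - y)) * ‖v (t, y)‖ₑ ^ 2) :=
              (lintegral_const_mul _ (hρx.mul hvt)).symm
          _ ≤ _ := by
              refine lintegral_mono fun y => ?_
              by_cases hxy : ρ (x - y) = 0
              · simp [hxy]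
              · rw [mul_left_comm]
                gcongr
                exact hww x y hxy
    _ = ∫⁻ y, ∫⁻ x, ENNReal.ofReal (ρ (x - y)) * (w' y * ‖v (t, y)‖ₑ ^ 2) := by
        refine lintegral_lintegral_swap (Measurable.aemeasurable ?_)
        exact hρm.mul ((hw'.mul hvt).comp measurable_snd)
    _ = ∫⁻ y, w' y * ‖v (t, y)‖ₑ ^ 2 := by
        refine lintegral_congr fun y => ?_
        have hρy : Measurable fun x => ENNReal.ofReal (ρ (x - y)) :=
          hρm.comp measurable_prodMk_right
        rw [lintegral_mul_const _ hρy, lintegral_sub_right_eq_self (fun x => ENNReal.ofReal (ρ x)),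
          ← ofReal_integral_eq_lintegral_ofReal hρ.integrable (ae_of_all _ h0), h1,
          ENNReal.ofReal_one, one_mul]

/-- No integrability is needed, since the integral of a function that is not integrable is `0`. -/
lemma integral_le_of_lintegral_le {α : Type*} [MeasurableSpace α] {μ : Measure α} {f : α → ℝ}
    {g : α → ℝ≥0∞} {b : ℝ} (hfg : ∀ x, ENNReal.ofReal (f x) ≤ g x) (hb : 0 ≤ b)
    (hg : ∫⁻ x, g x ∂μ ≤ ENNReal.ofReal b) : ∫ x, f x ∂μ ≤ b := by
  by_cases hf : Integrable f μ
  · rw [integral_eq_lintegral_pos_part_sub_lintegral_neg_part hf]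
    have : (∫⁻ x, ENNReal.ofReal (f x) ∂μ).toReal ≤ b :=
      ENNReal.toReal_le_of_le_ofReal hb ((lintegral_mono hfg).trans hg)
    have h2 : 0 ≤ (∫⁻ x, ENNReal.ofReal (-f x) ∂μ).toReal := ENNReal.toReal_nonneg
    linarith
  · rwa [integral_undef hf]

end ApproxIdentity

/-! ### Uniqueness of very weak solutions -/

section VeryWeakUniqueness

variable {d d₁ : ℕ}

lemma weakIntegrand_congr {L : ℝ → Fin d → Fin d → Val d₁ →L[ℂ] Val d₁} {lam : ℝ} {χ : ℝ → ℝ}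
    {η : EuclideanSpace ℝ (Fin d) → ℝ} {v w : SpaceTime d → Val d₁} {z : SpaceTime d}
    (h : z.2 ∈ tsupport η → v z = w z) :
    weakIntegrand L lam χ η v z = weakIntegrand L lam χ η w z := by
  by_cases hz : z.2 ∈ tsupport η
  · simp only [weakIntegrand, h hz]
  · have h0 : η z.2 = 0 := image_eq_zero_of_notMem_tsupport hz
    have h1 : ∀ i j, pd i (pd j η) z.2 = 0 := fun i j =>
      image_eq_zero_of_notMem_tsupport fun h' =>
        hz (tsupport_dv_subset _ _ (tsupport_dv_subset _ _ h'))
    simp [weakIntegrand, h0, h1]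

lemma tsupport_comp_sub_subset {ρ : EuclideanSpace ℝ (Fin d) → ℝ} {r : ℝ}
    (hρ : ∀ y, ρ y ≠ 0 → ‖y‖ < r) (x : EuclideanSpace ℝ (Fin d)) :
    tsupport (fun y => ρ (x - y)) ⊆ {y | ‖x - y‖ ≤ r} :=
  closure_minimal (fun y hy => (hρ _ hy).le) (isClosed_le (by fun_prop) continuous_const)

variable [NeZero d]

lemma abs_coord_sub_le (x y : EuclideanSpace ℝ (Fin d)) : |x 0 - y 0| ≤ ‖x - y‖ := by
  simpa using PiLp.norm_apply_le (x - y) 0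

/-- The energy inequality with the cutoffs and the mollifier of scale `N`. The weighted mass of the
mollification is bounded by a multiple of `S / N ^ 2` times the mass of `M⁻¹ v`, plus a multiple of
the mass of `M⁻¹ v` near the boundary and near infinity; both tend to zero. Truncating `v` to a ball
makes it square integrable, and does not change the weak formulation for the test functions in
question. -/
lemma energy_truncated {δ K : ℝ} (hδ : 0 < δ)
    {L : ℝ → Fin d → Fin d → Val d₁ →L[ℂ] Val d₁} (hL : IsParabolic δ K L) (hK : 0 ≤ K)
    {lam : ℝ} (hlam : 0 ≤ lam) {T : WithTop ℝ} {v : SpaceTime d → Val d₁}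
    (hvm : StronglyMeasurable v) (hq : MemLp (fun z => (z.2 0)⁻¹ • v z) 2)
    (h0 : ∀ z, ¬ 0 < z.2 0 → v z = 0)
    (hweak : ∀ (χ : ℝ → ℝ) (η : EuclideanSpace ℝ (Fin d) → ℝ), IsTest χ → IsTest η →
      tsupport χ ⊆ {t : ℝ | (t : WithTop ℝ) < T} → tsupport η ⊆ {x | 0 < x 0} →
      ∫ z, weakIntegrand L lam χ η v z = 0)
    {N : ℝ} (hN : 1 ≤ N) {S C : ℝ} (hS : 0 ≤ S) {χ : ℝ → ℝ} (hχ : IsTest χ)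
    (hχT : tsupport χ ⊆ {t : ℝ | (t : WithTop ℝ) < T}) (hχ0 : ∀ t, 0 ≤ χ t) (hχ1 : ∀ t, χ t ≤ 1)
    (hχ' : ∀ t, deriv χ t ≤ S / N ^ 4) {ζ : EuclideanSpace ℝ (Fin d) → ℝ} (hζ : IsTest ζ)
    (hζs : tsupport ζ ⊆ {x | 1 / N ≤ x 0 ∧ ‖x‖ ≤ 2 * N}) (hζ0 : ∀ x, 0 ≤ ζ x)
    (hζ1 : ∀ x, ζ x ≤ 1)
    (hζc : ∀ x, 2 / N < x 0 → ‖x‖ < N → ζ x = 1 ∧ ∀ i, pd i ζ x = 0)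
    (hζ' : ∀ x, 0 < x 0 → ∑ i, |pd i ζ x| ≤ C / x 0)
    {ρ : EuclideanSpace ℝ (Fin d) → ℝ} (hρ : IsTest ρ) (hρ0 : ∀ y, 0 ≤ ρ y) (hρ1 : ∫ y, ρ y = 1)
    (hρs : ∀ y, ρ y ≠ 0 → ‖y‖ < 1 / (2 * N)) :
    ∫⁻ z : SpaceTime d, ENNReal.ofReal (χ z.1 * ((z.2 0)⁻¹ * ζ z.2) ^ 2) *
        ‖mol ρ ({z | ‖z.2‖ ≤ 3 * N}.indicator v) z‖ₑ ^ 2 ≤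
      ENNReal.ofReal (4 / δ * (9 * S * (∫⁻ z : SpaceTime d, ‖(z.2 0)⁻¹ • v z‖ₑ ^ 2).toReal / N ^ 2 +
        2 * (2 * K ^ 2 * d / δ + K) * (9 / 4 * C ^ 2 *
          (∫⁻ z in {z : SpaceTime d | ¬ (3 / N < z.2 0 ∧ ‖z.2‖ < N - 1)},
            ‖(z.2 0)⁻¹ • v z‖ₑ ^ 2).toReal))) := by
  have hN0 : 0 < N := by linarith
  set q : SpaceTime d → Val d₁ := fun z => (z.2 0)⁻¹ • v z with hqd
  set vn := {z : SpaceTime d | ‖z.2‖ ≤ 3 * N}.indicator v with hvn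
  set P := ∫⁻ z, ‖q z‖ₑ ^ 2 with hP
  set B := {z : SpaceTime d | ¬ (3 / N < z.2 0 ∧ ‖z.2‖ < N - 1)} with hB
  set Q := ∫⁻ z in B, ‖q z‖ₑ ^ 2 with hQ
  have hPfin : P ≠ ⊤ := by
    have := hq.2
    rw [eLpNorm_lt_top_iff_lintegral_rpow_enorm_lt_top (by norm_num) (by norm_num)] at this
    simpa using this.ne
  have hQP : Q ≤ P := setLIntegral_le_lintegral _ _
  have hQfin : Q ≠ ⊤ := (hQP.trans_lt hPfin.lt_top).ne
  have hvq : ∀ z : SpaceTime d, v z = z.2 0 • q z := fun z => by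
    by_cases hz : 0 < z.2 0
    · rw [hqd, smul_inv_smul₀ hz.ne']
    · simp [hqd, h0 z hz]
  have hballs : MeasurableSet {z : SpaceTime d | ‖z.2‖ ≤ 3 * N} :=
    (isClosed_le (by fun_prop) continuous_const).measurableSet
  have hvnm : StronglyMeasurable vn := hvm.indicator hballs
  have hvnq : ∀ z, ‖vn z‖ ≤ 3 * N * ‖q z‖ := fun z => by
    by_cases hz : ‖z.2‖ ≤ 3 * N
    · rw [hvn, Set.indicator_of_mem (by exact hz), hvq, norm_smul]
      gcongr
      exact (PiLp.norm_apply_le z.2 0).trans hz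
    · rw [hvn, Set.indicator_of_notMem (by exact hz), norm_zero]
      positivity
  have hvnL : MemLp vn 2 := hq.of_le_mul hvnm.aestronglyMeasurable (ae_of_all _ hvnq)
  have hclose : ∀ x y : EuclideanSpace ℝ (Fin d), 1 / N ≤ x 0 → ‖x - y‖ ≤ 1 / (2 * N) →
      x 0 / 2 ≤ y 0 ∧ y 0 ≤ 3 / 2 * x 0 := by
    intro x y hx hxy
    have h1 := abs_le.1 ((abs_coord_sub_le x y).trans hxy)
    have h2 : 1 / (2 * N) = 1 / N / 2 := by field_simp
    constructor <;> linarith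
  have hsmall : 1 / (2 * N) ≤ 1 := by
    rw [div_le_one (by positivity)]; linarith
  have hen := energy_mollified hδ hL hvnm hvnL hlam hρ hζ (fun x hx =>
      lt_of_lt_of_le (by positivity) (hζs hx).1)
    (U := {t : ℝ | (t : WithTop ℝ) < T}) (isOpen_Iio.preimage WithTop.continuous_coe)
    ⟨fun a _ b hb t ht => lt_of_le_of_lt (WithTop.coe_le_coe.2 ht.2) hb⟩
    (fun x hx ψ hψ hψT => by
      have hsub := tsupport_comp_sub_subset hρs x
      rw [← hweak ψ (fun y => ρ (x - y)) hψ (hρ.comp_sub_left x) hψT fun y hy => by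
        have := (hclose x y (hζs hx).1 (hsub hy)).1
        have h3 : 0 < 1 / N := by positivity
        have := (hζs hx).1
        change 0 < y 0
        linarith]
      refine integral_congr_ae (ae_of_all _ fun z => weakIntegrand_congr fun hz => ?_)
      refine Set.indicator_of_mem ?_ _
      have h1 : ‖z.2‖ ≤ ‖x‖ + ‖x - z.2‖ := by
        simpa using norm_sub_le x (x - z.2)
      have h2 : ‖x - z.2‖ ≤ 1 / (2 * N) := hsub hz
      have h3 := (hζs hx).2
      change ‖z.2‖ ≤ 3 * N
      linarith) hχ hχT hχ0
  have hζ2 : ∀ x, ζ x ^ 2 ≤ 1 := fun x => by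
    have := hζ0 x
    have := hζ1 x
    nlinarith
  have hE : ∀ z, ENNReal.ofReal (‖mol ρ vn z‖ ^ 2) = ‖mol ρ vn z‖ₑ ^ 2 := fun z => by
    rw [ENNReal.ofReal_pow (norm_nonneg _), ofReal_norm]
  -- the term with the time derivative of the cutoff
  have ht : ∫ z : SpaceTime d, (deriv χ z.1 * ζ z.2 ^ 2) * ‖mol ρ vn z‖ ^ 2 ≤
      9 * S * P.toReal / N ^ 2 := by
    refine integral_le_of_lintegral_le
      (g := fun z => ENNReal.ofReal (S / N ^ 4) * ‖mol ρ vn z‖ₑ ^ 2) (fun z => ?_) (by positivity) ?_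
    · rw [← hE, ← ENNReal.ofReal_mul (by positivity)]
      refine ENNReal.ofReal_le_ofReal (mul_le_mul_of_nonneg_right ?_ (sq_nonneg _))
      have h1 : 0 ≤ S / N ^ 4 := by positivity
      calc deriv χ z.1 * ζ z.2 ^ 2 ≤ S / N ^ 4 * ζ z.2 ^ 2 :=
            mul_le_mul_of_nonneg_right (hχ' _) (sq_nonneg _)
        _ ≤ S / N ^ 4 * 1 := by gcongr; exact hζ2 _
        _ = _ := mul_one _
    · refine (lintegral_mul_enorm_mol_sq_le hρ hρ0 hρ1 hvnm
        (w := fun _ => ENNReal.ofReal (S / N ^ 4)) (w' := fun _ => ENNReal.ofReal (S / N ^ 4))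
        measurable_const measurable_const fun _ _ _ => le_rfl).trans ?_
      calc ∫⁻ z, ENNReal.ofReal (S / N ^ 4) * ‖vn z‖ₑ ^ 2
          ≤ ∫⁻ z, ENNReal.ofReal (9 * S / N ^ 2) * ‖q z‖ₑ ^ 2 := by
            refine lintegral_mono fun z => ?_
            rw [← ofReal_norm, ← ofReal_norm, ← ENNReal.ofReal_pow (norm_nonneg _),
              ← ENNReal.ofReal_pow (norm_nonneg _), ← ENNReal.ofReal_mul (by positivity),
              ← ENNReal.ofReal_mul (by positivity)]
            refine ENNReal.ofReal_le_ofReal ?_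
            calc S / N ^ 4 * ‖vn z‖ ^ 2 ≤ S / N ^ 4 * (3 * N * ‖q z‖) ^ 2 := by
                  gcongr; exact hvnq z
              _ = _ := by field_simp; ring
        _ = ENNReal.ofReal (9 * S / N ^ 2) * P := lintegral_const_mul' _ _ ENNReal.ofReal_ne_top
        _ = ENNReal.ofReal (9 * S / N ^ 2) * ENNReal.ofReal P.toReal := by
            rw [ENNReal.ofReal_toReal hPfin]
        _ = ENNReal.ofReal (9 * S * P.toReal / N ^ 2) := by
            rw [← ENNReal.ofReal_mul (by positivity)]
            congr 1; ring
        _ ≤ _ := le_rfl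
  -- the term with the space derivatives of the cutoff
  have hx : ∫ z : SpaceTime d, (χ z.1 * (∑ i, |pd i ζ z.2|) ^ 2) * ‖mol ρ vn z‖ ^ 2 ≤
      9 / 4 * C ^ 2 * Q.toReal := by
    set D : Set (EuclideanSpace ℝ (Fin d)) := {x | 1 / N ≤ x 0 ∧ ¬ (2 / N < x 0 ∧ ‖x‖ < N)} with hD
    set D' : Set (EuclideanSpace ℝ (Fin d)) := {y | ¬ (3 / N < y 0 ∧ ‖y‖ < N - 1)} with hD'
    have hc0 : Continuous fun x : EuclideanSpace ℝ (Fin d) => x 0 := (coord_smooth 0).continuous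
    have hDm : MeasurableSet D := (isClosed_le continuous_const hc0).measurableSet.inter
      ((isOpen_lt continuous_const hc0).inter
        (isOpen_lt continuous_norm continuous_const)).measurableSet.compl
    have hDm' : MeasurableSet D' := ((isOpen_lt continuous_const hc0).inter
        (isOpen_lt continuous_norm continuous_const)).measurableSet.compl
    have hwm : ∀ c : ℝ, Measurable fun x : EuclideanSpace ℝ (Fin d) =>
        ENNReal.ofReal (c / (x 0) ^ 2) := fun c =>
      (measurable_const.div (hc0.measurable.pow_const 2)).ennreal_ofReal
    refine integral_le_of_lintegral_le (g := fun z =>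
      D.indicator (fun x => ENNReal.ofReal (C ^ 2 / (x 0) ^ 2)) z.2 * ‖mol ρ vn z‖ₑ ^ 2)
      (fun z => ?_) (by positivity) ?_
    · rw [← hE, ENNReal.ofReal_mul (mul_nonneg (hχ0 _) (sq_nonneg _))]
      gcongr
      by_cases hz : z.2 ∈ D
      · rw [Set.indicator_of_mem hz]
        have hz0 : 0 < z.2 0 := lt_of_lt_of_le (by positivity) hz.1
        refine ENNReal.ofReal_le_ofReal ?_
        rw [← div_pow]
        have h1 : (∑ i, |pd i ζ z.2|) ^ 2 ≤ (C / z.2 0) ^ 2 :=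
          pow_le_pow_left₀ (Finset.sum_nonneg fun i _ => abs_nonneg _) (hζ' _ hz0) 2
        calc _ ≤ 1 * (∑ i, |pd i ζ z.2|) ^ 2 := by gcongr; exact hχ1 _
          _ ≤ _ := by rwa [one_mul]
      · have : ∀ i, pd i ζ z.2 = 0 := by
          by_cases hz1 : 1 / N ≤ z.2 0
          · have hz2 : 2 / N < z.2 0 ∧ ‖z.2‖ < N := by
              by_contra h
              exact hz ⟨hz1, h⟩
            exact (hζc _ hz2.1 hz2.2).2
          · exact fun i => image_eq_zero_of_notMem_tsupport fun h' =>
              hz1 (hζs (tsupport_dv_subset _ _ h')).1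
        simp [this]
    · refine (lintegral_mul_enorm_mol_sq_le hρ hρ0 hρ1 hvnm
        (w := D.indicator fun x => ENNReal.ofReal (C ^ 2 / (x 0) ^ 2))
        (w' := D'.indicator fun y => ENNReal.ofReal (9 / 4 * C ^ 2 / (y 0) ^ 2))
        ((hwm _).indicator hDm) ((hwm _).indicator hDm') fun x y hxy => ?_).trans ?_
      · by_cases hx : x ∈ D
        · have hn := (hρs _ hxy).le
          have h1 := hclose x y hx.1 hn
          have hx0 : 0 < x 0 := lt_of_lt_of_le (by positivity) hx.1
          have hy : y ∈ D' := by
            rintro ⟨h2, h3⟩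
            refine hx.2 ⟨?_, ?_⟩
            · have : 3 / N = 3 / 2 * (2 / N) := by ring
              linarith [h1.2]
            · have h4 : ‖x‖ ≤ ‖x - y‖ + ‖y‖ := by simpa using norm_add_le (x - y) y
              linarith
          rw [Set.indicator_of_mem hx, Set.indicator_of_mem hy]
          refine ENNReal.ofReal_le_ofReal ?_
          have hy0 : 0 < y 0 := by linarith [h1.1]
          rw [div_le_div_iff₀ (by positivity) (by positivity)]
          have h5 : (y 0) ^ 2 ≤ (3 / 2 * x 0) ^ 2 := pow_le_pow_left₀ hy0.le h1.2 2
          nlinarith [mul_le_mul_of_nonneg_left h5 (sq_nonneg C)]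
        · rw [Set.indicator_of_notMem hx]
          exact zero_le
      · calc ∫⁻ z : SpaceTime d, D'.indicator (fun y => ENNReal.ofReal (9 / 4 * C ^ 2 / (y 0) ^ 2)) z.2 *
              ‖vn z‖ₑ ^ 2
            ≤ ∫⁻ z, B.indicator (fun z => ENNReal.ofReal (9 / 4 * C ^ 2) * ‖q z‖ₑ ^ 2) z := by
              refine lintegral_mono fun z => ?_
              by_cases hz : z.2 ∈ D'
              · rw [Set.indicator_of_mem hz, Set.indicator_of_mem (by exact hz)]
                rw [← ofReal_norm, ← ofReal_norm, ← ENNReal.ofReal_pow (norm_nonneg _),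
                  ← ENNReal.ofReal_pow (norm_nonneg _), ← ENNReal.ofReal_mul (by positivity),
                  ← ENNReal.ofReal_mul (by positivity)]
                refine ENNReal.ofReal_le_ofReal ?_
                have h1 : ‖vn z‖ ≤ ‖v z‖ := norm_indicator_le_norm_self _ _
                have h2 : ‖q z‖ = |z.2 0|⁻¹ * ‖v z‖ := by rw [hqd, norm_smul, norm_inv, Real.norm_eq_abs]
                rw [h2, mul_pow, inv_pow, sq_abs]
                calc 9 / 4 * C ^ 2 / (z.2 0) ^ 2 * ‖vn z‖ ^ 2
                    ≤ 9 / 4 * C ^ 2 / (z.2 0) ^ 2 * ‖v z‖ ^ 2 := by gcongr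
                  _ = _ := by ring
              · rw [Set.indicator_of_notMem hz, zero_mul]
                exact zero_le
          _ = ENNReal.ofReal (9 / 4 * C ^ 2) * Q := by
              have hBm : MeasurableSet B := hDm'.preimage measurable_snd
              rw [lintegral_indicator hBm, lintegral_const_mul' _ _ ENNReal.ofReal_ne_top]
          _ = ENNReal.ofReal (9 / 4 * C ^ 2 * Q.toReal) := by
              rw [ENNReal.ofReal_mul (q := Q.toReal) (by positivity), ENNReal.ofReal_toReal hQfin]
          _ ≤ _ := le_rfl
  -- back to the lower Lebesgue integral
  have hζsc : ∀ x, x ∉ tsupport ζ → ζ x = 0 := fun x hx => image_eq_zero_of_notMem_tsupport hx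
  have hzz : IsTest fun x : EuclideanSpace ℝ (Fin d) => (x 0)⁻¹ * ζ x := by
    simpa using hζ.inv_coord_smul (fun x hx => lt_of_lt_of_le (by positivity) (hζs hx).1)
  have hint : Integrable fun z : SpaceTime d =>
      (χ z.1 * ((z.2 0)⁻¹ * ζ z.2) ^ 2) * ‖mol ρ vn z‖ ^ 2 := by
    have := integrable_mol_mul_mol (B := fun _ => ContinuousLinearMap.id ℂ (Val d₁)) (K := 1)
      aestronglyMeasurable_const (fun _ => ContinuousLinearMap.norm_id_le) hvnm hvnL hρ hρ hχ
      (a := fun x => ((x 0)⁻¹ * ζ x) ^ 2) (hzz.continuous.pow 2)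
      (hzz.compact.comp_left (g := fun s : ℝ => s ^ 2) (by norm_num))
    simpa using this
  have hfin : ∫ z : SpaceTime d, (χ z.1 * ((z.2 0)⁻¹ * ζ z.2) ^ 2) * ‖mol ρ vn z‖ ^ 2 ≤
      4 / δ * (9 * S * P.toReal / N ^ 2 +
        2 * (2 * K ^ 2 * d / δ + K) * (9 / 4 * C ^ 2 * Q.toReal)) := by
    have h1 : 0 ≤ 2 * (2 * K ^ 2 * d / δ + K) := by positivity
    have h2 := mul_le_mul_of_nonneg_left hx h1
    rw [div_mul_eq_mul_div, le_div_iff₀ hδ]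
    nlinarith
  refine le_trans (le_of_eq ?_) (ENNReal.ofReal_le_ofReal hfin)
  rw [ofReal_integral_eq_lintegral_ofReal hint
    (ae_of_all _ fun z => mul_nonneg (mul_nonneg (hχ0 _) (sq_nonneg _)) (sq_nonneg _))]
  refine lintegral_congr fun z => ?_
  rw [ENNReal.ofReal_mul (mul_nonneg (hχ0 _) (sq_nonneg _)), hE]

end VeryWeakUniqueness

section VeryWeakUniqueness

variable {d d₁ : ℕ} [NeZero d]

lemma IsParabolic.nonneg {δ K : ℝ} {L : ℝ → Fin d → Fin d → Val d₁ →L[ℂ] Val d₁}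
    (hL : IsParabolic δ K L) : 0 ≤ K :=
  (norm_nonneg _).trans (hL.bound 0 0 0)

/-- Uniqueness of very weak solutions `v` with `M⁻¹ v` square integrable, by `energy_truncated` and
Fatou's lemma. No condition at the lateral boundary is imposed, it is contained in the weight, and
the integrability replaces an initial condition at `t = -∞`. -/
theorem ae_eq_zero_of_weakIntegrand {δ K : ℝ} (hδ : 0 < δ)
    {L : ℝ → Fin d → Fin d → Val d₁ →L[ℂ] Val d₁} (hL : IsParabolic δ K L)
    {lam : ℝ} (hlam : 0 ≤ lam) {T : WithTop ℝ} {v : SpaceTime d → Val d₁}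
    (hvm : StronglyMeasurable v) (hq : MemLp (fun z => (z.2 0)⁻¹ • v z) 2)
    (h0 : ∀ z, ¬ 0 < z.2 0 → v z = 0)
    (hweak : ∀ (χ : ℝ → ℝ) (η : EuclideanSpace ℝ (Fin d) → ℝ), IsTest χ → IsTest η →
      tsupport χ ⊆ {t : ℝ | (t : WithTop ℝ) < T} → tsupport η ⊆ {x | 0 < x 0} →
      ∫ z, weakIntegrand L lam χ η v z = 0) :
    ∀ᵐ z : SpaceTime d, (z.1 : WithTop ℝ) < T → v z = 0 := by
  obtain ⟨S, hS, χ, hχ, hχT, hχ0, hχ1, hχ', hχt⟩ := exists_time_cutoff T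
  obtain ⟨C, hζ⟩ := exists_space_cutoff (d := d)
  have hn1 : ∀ n : ℕ, (1 : ℝ) ≤ (n : ℝ) + 1 := fun n => by
    have : (0 : ℝ) ≤ n := n.cast_nonneg
    linarith
  choose ζ hζt hζs hζ0 hζ1 hζc hζ' using fun n : ℕ => hζ ((n : ℝ) + 1) (hn1 n)
  obtain ⟨ρ, hρ, hρ0, hρ1, hρs, hρc⟩ := exists_mollifier (d := d) (d₁ := d₁)
  set q : SpaceTime d → Val d₁ := fun z => (z.2 0)⁻¹ • v z with hqd
  have hvq : ∀ z : SpaceTime d, v z = z.2 0 • q z := fun z => by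
    by_cases hz : 0 < z.2 0
    · rw [hqd, smul_inv_smul₀ hz.ne']
    · simp [hqd, h0 z hz]
  have hqm : StronglyMeasurable q := by
    have : Measurable fun z : SpaceTime d => (z.2 0)⁻¹ :=
      ((coord_smooth (d := d) 0).continuous.measurable.comp measurable_snd).inv
    exact this.stronglyMeasurable.smul hvm
  set B : ℕ → Set (SpaceTime d) := fun n =>
    {z | ¬ (3 / ((n : ℝ) + 1) < z.2 0 ∧ ‖z.2‖ < (n : ℝ) + 1 - 1)} with hB
  have hc0 : Continuous fun z : SpaceTime d => z.2 0 := (coord_smooth 0).continuous.comp continuous_snd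
  have hBm : ∀ n, MeasurableSet (B n) := fun n => ((isOpen_lt continuous_const hc0).inter
        (isOpen_lt continuous_snd.norm continuous_const)).measurableSet.compl
  have hPfin : ∫⁻ z, ‖q z‖ₑ ^ 2 ≠ ⊤ := by
    have := hq.2
    rw [eLpNorm_lt_top_iff_lintegral_rpow_enorm_lt_top (by norm_num) (by norm_num)] at this
    simpa using this.ne
  have hN : Tendsto (fun n : ℕ => (n : ℝ) + 1) atTop atTop :=
    tendsto_atTop_add_const_right _ _ tendsto_natCast_atTop_atTop
  -- the mass of `q` near the boundary and near infinity tends to zero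
  have hQ : Tendsto (fun n => ∫⁻ z in B n, ‖q z‖ₑ ^ 2) atTop (𝓝 0) := by
    have h1 : Tendsto (fun n => ∫⁻ z, (B n).indicator (fun z => ‖q z‖ₑ ^ 2) z) atTop
        (𝓝 (∫⁻ _ : SpaceTime d, 0)) := by
      refine tendsto_lintegral_of_dominated_convergence (fun z => ‖q z‖ₑ ^ 2)
        (fun n => (hqm.enorm.pow_const 2).indicator (hBm n))
        (fun n => ae_of_all _ fun z => Set.indicator_le_self _ _ _) hPfin (ae_of_all _ fun z => ?_)
      refine tendsto_const_nhds.congr' ?_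
      by_cases hz : 0 < z.2 0
      · have e1 := (tendsto_const_nhds (x := (3 : ℝ))).div_atTop hN
        filter_upwards [e1.eventually_lt_const hz, hN.eventually_gt_atTop (‖z.2‖ + 1)] with n h2 h3
        refine (Set.indicator_of_notMem ?_ _).symm
        rw [hB, Set.mem_ofPred_eq, not_not]
        exact ⟨h2, by linarith⟩
      · have : q z = 0 := by simp [hqd, h0 z hz]
        refine Eventually.of_forall fun n => ?_
        by_cases hzB : z ∈ B n
        · simp [hzB, this]
        · simp [hzB]
    simp only [lintegral_zero] at h1
    refine h1.congr fun n => lintegral_indicator (hBm n) _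
  have hQ' : Tendsto (fun n => (∫⁻ z in B n, ‖q z‖ₑ ^ 2).toReal) atTop (𝓝 0) := by
    have := (ENNReal.tendsto_toReal ENNReal.zero_ne_top).comp hQ
    rwa [ENNReal.toReal_zero] at this
  set F : ℕ → SpaceTime d → ℝ≥0∞ := fun n z =>
    ENNReal.ofReal (χ n z.1 * ((z.2 0)⁻¹ * ζ n z.2) ^ 2) *
      ‖mol (ρ n) ({z | ‖z.2‖ ≤ 3 * ((n : ℝ) + 1)}.indicator v) z‖ₑ ^ 2 with hF
  have hFint : Tendsto (fun n => ∫⁻ z, F n z) atTop (𝓝 0) := by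
    refine tendsto_of_tendsto_of_tendsto_of_le_of_le tendsto_const_nhds ?_ (fun _ => zero_le)
      fun n => energy_truncated hδ hL hL.nonneg hlam hvm hq h0 hweak (hn1 n) hS (hχ n) (hχT n)
        (hχ0 n) (hχ1 n) (hχ' n) (hζt n) (hζs n) (hζ0 n) (hζ1 n) (hζc n) (hζ' n) (hρ n) (hρ0 n)
        (hρ1 n) (hρs n)
    rw [← ENNReal.ofReal_zero]
    refine ENNReal.tendsto_ofReal ?_
    have h1 : Tendsto (fun n : ℕ => 9 * S * (∫⁻ z, ‖q z‖ₑ ^ 2).toReal / ((n : ℝ) + 1) ^ 2) atTop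
        (𝓝 0) := tendsto_const_nhds.div_atTop ((tendsto_pow_atTop two_ne_zero).comp hN)
    have h2 := (h1.add ((hQ'.const_mul (9 / 4 * C ^ 2)).const_mul
      (2 * (2 * K ^ 2 * d / δ + K)))).const_mul (4 / δ)
    simp only [mul_zero, add_zero] at h2
    exact h2
  have hmolm : ∀ n, StronglyMeasurable (mol (ρ n) v) := fun n =>
    stronglyMeasurable_mol (hρ n).continuous hvm
  have hFm : ∀ n, Measurable (F n) := fun n => by
    have hset : MeasurableSet {z : SpaceTime d | ‖z.2‖ ≤ 3 * ((n : ℝ) + 1)} :=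
      (isClosed_le (by fun_prop) continuous_const).measurableSet
    have m1 : Measurable fun z : SpaceTime d => χ n z.1 * ((z.2 0)⁻¹ * ζ n z.2) ^ 2 :=
      ((hχ n).continuous.measurable.comp measurable_fst).mul
        ((hc0.measurable.inv.mul ((hζt n).continuous.measurable.comp measurable_snd)).pow_const 2)
    exact m1.ennreal_ofReal.mul
      ((stronglyMeasurable_mol (hρ n).continuous (hvm.indicator hset)).enorm.pow_const 2)
  -- Fatou's lemma
  have hlim : ∀ᵐ z, liminf (fun n => F n z) atTop = 0 := by
    have h1 : ∫⁻ z, liminf (fun n => F n z) atTop = 0 := by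
      have := lintegral_liminf_le (μ := volume) (u := atTop) hFm
      rw [hFint.liminf_eq] at this
      exact le_antisymm this zero_le
    rwa [lintegral_eq_zero_iff (Measurable.liminf hFm)] at h1
  -- the mollified functions converge almost everywhere
  have hmol : ∀ᵐ z, Tendsto (fun n => mol (ρ n) v z) atTop (𝓝 (v z)) := by
    have hset : MeasurableSet {z | Tendsto (fun n => mol (ρ n) v z) atTop (𝓝 (v z))} :=
      measurableSet_tendsto_fun (l := atTop) (fun n => (hmolm n).measurable) hvm.measurable
    rw [Measure.volume_eq_prod, Measure.ae_prod_iff_ae_ae hset]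
    filter_upwards [ae_memLp_slice hq] with t ht
    have hl : LocallyIntegrable fun y => v (t, y) := by
      have := (ht.locallyIntegrable (by norm_num)).continuous_smul
        (coord_smooth (d := d) 0).continuous
      exact this.congr (ae_of_all _ fun y => (hvq (t, y)).symm)
    exact hρc _ hl
  filter_upwards [hlim, hmol] with z hz1 hz2 hzT
  by_contra hvz
  have hz0 : 0 < z.2 0 := by
    by_contra h
    exact hvz (h0 z h)
  have hloc : ∀ᶠ n in atTop, F n z = ENNReal.ofReal (((z.2 0)⁻¹) ^ 2) * ‖mol (ρ n) v z‖ₑ ^ 2 := by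
    have e1 := (tendsto_const_nhds (x := (2 : ℝ))).div_atTop hN
    filter_upwards [hχt z.1 hzT, e1.eventually_lt_const hz0, hN.eventually_gt_atTop ‖z.2‖]
      with n h1 h2 h3
    have h4 : mol (ρ n) ({z | ‖z.2‖ ≤ 3 * ((n : ℝ) + 1)}.indicator v) z = mol (ρ n) v z := by
      refine integral_congr_ae (ae_of_all _ fun y => ?_)
      by_cases hy : ρ n (z.2 - y) = 0
      · simp [hy]
      · have h5 := hρs n _ hy
        have h6 : ‖y‖ ≤ ‖z.2‖ + ‖z.2 - y‖ := by simpa using norm_sub_le z.2 (z.2 - y)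
        have h7 : 1 / (2 * ((n : ℝ) + 1)) ≤ 1 := by
          rw [div_le_one (by linarith [hn1 n])]; linarith [hn1 n]
        simp only
        rw [Set.indicator_of_mem]
        change ‖y‖ ≤ _
        linarith [hn1 n]
    simp only [hF]
    rw [h4, h1, (hζc n z.2 h2 h3).1, one_mul, mul_one]
  have hconv : Tendsto (fun n => F n z) atTop
      (𝓝 (ENNReal.ofReal (((z.2 0)⁻¹) ^ 2) * ‖v z‖ₑ ^ 2)) := by
    refine Tendsto.congr' (hloc.mono fun n h => h.symm) ?_
    refine ENNReal.Tendsto.const_mul ?_ (Or.inr ENNReal.ofReal_ne_top)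
    exact (ENNReal.continuous_pow 2).continuousAt.tendsto.comp hz2.enorm
  rw [hconv.liminf_eq, mul_eq_zero, ENNReal.ofReal_eq_zero] at hz1
  rcases hz1 with h | h
  · have : 0 < ((z.2 0)⁻¹) ^ 2 := by positivity
    linarith
  · exact hvz (by simpa using h)

end VeryWeakUniqueness

/-! ### Test functions on space-time -/

section SpaceTimeTest

variable {d d₁ : ℕ} {F : Type*} [NormedAddCommGroup F] [NormedSpace ℝ F]

/-- The partial derivative `∂_i w` in space of a function on space-time. -/
abbrev sd (i : Fin d) (w : SpaceTime d → F) : SpaceTime d → F := dv (spaceDir i) w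

/-- The time derivative of a function on space-time. -/
abbrev td (w : SpaceTime d → F) : SpaceTime d → F := dv (timeDir d) w

lemma IsTest.slice {w : SpaceTime d → F} (hw : IsTest w) (t : ℝ) : IsTest fun x => w (t, x) := by
  refine ⟨hw.smooth.comp (contDiff_const.prodMk contDiff_id), ?_⟩
  refine HasCompactSupport.of_support_subset_isCompact (hw.compact.isCompact.image continuous_snd)
    fun x hx => ⟨(t, x), subset_tsupport _ hx, rfl⟩

lemma IsTest.timeSlice {w : SpaceTime d → F} (hw : IsTest w) (x : EuclideanSpace ℝ (Fin d)) :
    IsTest fun t => w (t, x) := by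
  refine ⟨hw.smooth.comp (contDiff_id.prodMk contDiff_const), ?_⟩
  refine HasCompactSupport.of_support_subset_isCompact (hw.compact.isCompact.image continuous_fst)
    fun t ht => ⟨(t, x), subset_tsupport _ ht, rfl⟩

lemma pd_slice {w : SpaceTime d → F} (hw : Differentiable ℝ w) (i : Fin d) (t : ℝ) :
    pd i (fun x => w (t, x)) = fun x => sd i w (t, x) := by
  ext1 x
  have h1 := (hw (t, x)).hasFDerivAt.comp x (hasFDerivAt_prodMk_right (𝕜 := ℝ) t x)
  rw [pd, dv, show (fun x => w (t, x)) = w ∘ fun x => (t, x) from rfl, h1.fderiv]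
  simp [dv, spaceDir]

lemma hasDerivAt_timeSlice {w : SpaceTime d → F} (hw : Differentiable ℝ w) (t : ℝ)
    (x : EuclideanSpace ℝ (Fin d)) : HasDerivAt (fun t => w (t, x)) (td w (t, x)) t := by
  have h1 := (hw (t, x)).hasFDerivAt.comp t (hasFDerivAt_prodMk_left (𝕜 := ℝ) t x)
  have h2 := h1.hasDerivAt
  have e : ((fderiv ℝ w (t, x)).comp (ContinuousLinearMap.inl ℝ ℝ _)) 1 = td w (t, x) := by
    simp [dv, timeDir]
  rw [← e]
  exact h2

lemma contDiff_spaceCoord (i : Fin d) : ContDiff ℝ ∞ fun z : SpaceTime d => z.2 i :=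
  (coord_smooth i).comp contDiff_snd

lemma sd_spaceCoord (i j : Fin d) (z : SpaceTime d) :
    sd i (fun z : SpaceTime d => z.2 j) z = if j = i then 1 else 0 := by
  have := congrFun (pd_slice ((contDiff_spaceCoord (d := d) j).differentiable (by simp)) i z.1) z.2
  rw [← pd_coord]
  exact this.symm

lemma td_spaceCoord (j : Fin d) (z : SpaceTime d) :
    td (fun z : SpaceTime d => z.2 j) z = 0 := by
  have h := hasDerivAt_timeSlice ((contDiff_spaceCoord (d := d) j).differentiable (by simp)) z.1 z.2
  exact h.unique (hasDerivAt_const z.1 (z.2 j))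

lemma IsTest.memLp {X : Type*} [NormedAddCommGroup X] [NormedSpace ℝ X] [MeasurableSpace X]
    [BorelSpace X] [SecondCountableTopologyEither X F] {μ : Measure X}
    [IsFiniteMeasureOnCompacts μ] {w : X → F} (hw : IsTest w) (p : ℝ≥0∞) : MemLp w p μ :=
  hw.continuous.memLp_of_hasCompactSupport hw.compact

lemma MemLp.integrable_real_inner {α : Type*} [MeasurableSpace α] {μ : Measure α} {H : Type*}
    [NormedAddCommGroup H] [InnerProductSpace ℝ H] {f g : α → H} (hf : MemLp f 2 μ)
    (hg : MemLp g 2 μ) : Integrable (fun x => inner ℝ (f x) (g x)) μ := by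
  refine (hf.norm.integrable_mul hg.norm).mono' (hf.1.inner hg.1) (ae_of_all _ fun x => ?_)
  exact norm_inner_le_norm _ _

lemma IsTest.inv_spaceCoord_smul [NeZero d] {Y : SpaceTime d → F} (hY : IsTest Y)
    (hs : tsupport Y ⊆ {z | 0 < z.2 0}) : IsTest (fun z => (z.2 0)⁻¹ • Y z) := by
  have hsub : tsupport (fun z : SpaceTime d => (z.2 0)⁻¹ • Y z) ⊆ tsupport Y :=
    closure_mono (Function.support_smul_subset_right _ _)
  refine ⟨contDiff_of_forall_tsupport fun z hz => ?_, hY.compact.mono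
    (Function.support_smul_subset_right _ _)⟩
  have h0 : z.2 0 ≠ 0 := (hs (hsub hz)).ne'
  exact ((contDiff_spaceCoord 0).contDiffAt.inv h0).smul hY.smooth.contDiffAt

lemma td_smul_spaceCoord [NeZero d] {w : SpaceTime d → F} (hw : IsTest w) (z : SpaceTime d) :
    td (fun z => z.2 0 • w z) z = z.2 0 • td w z := by
  have := congrFun (dv_smul ((contDiff_spaceCoord (0 : Fin d)).differentiable (by simp))
    hw.differentiable (timeDir d)) z
  rw [td, this]
  have h2 := td_spaceCoord (0 : Fin d) z
  rw [td] at h2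
  rw [h2, zero_smul, add_zero]

lemma sd_smul_spaceCoord [NeZero d] {w : SpaceTime d → F} (hw : IsTest w) (i : Fin d)
    (z : SpaceTime d) :
    sd i (fun z => z.2 0 • w z) z = z.2 0 • sd i w z + (if 0 = i then (1 : ℝ) else 0) • w z := by
  have := congrFun (dv_smul ((contDiff_spaceCoord (0 : Fin d)).differentiable (by simp))
    hw.differentiable (spaceDir i)) z
  rw [sd, this, ← sd_spaceCoord i 0 z]

lemma sd_sd_smul_spaceCoord [NeZero d] {w : SpaceTime d → F} (hw : IsTest w) (i j : Fin d)
    (z : SpaceTime d) :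
    sd i (sd j (fun z => z.2 0 • w z)) z = z.2 0 • sd i (sd j w) z +
      (if 0 = i then (1 : ℝ) else 0) • sd j w z + (if 0 = j then (1 : ℝ) else 0) • sd i w z := by
  have e : sd j (fun z => z.2 0 • w z) = fun z => z.2 0 • sd j w z +
      (if 0 = j then (1 : ℝ) else 0) • w z := funext fun z => sd_smul_spaceCoord hw j z
  have h1 : IsTest fun z : SpaceTime d => z.2 0 • sd j w z :=
    (hw.dv _).smul_left (contDiff_spaceCoord 0)
  have h2 : IsTest fun z : SpaceTime d => (if 0 = j then (1 : ℝ) else 0) • w z :=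
    hw.smul_left contDiff_const
  rw [e, sd, congrFun (dv_add h1.differentiable h2.differentiable (spaceDir i)) z,
    congrFun (dv_const_smul _ hw.differentiable (spaceDir i)) z]
  congr 1
  exact sd_smul_spaceCoord (hw.dv _) i z

end SpaceTimeTest

/-! ### The energy inequality for test functions -/

section ParabolicOperator

variable {d d₁ : ℕ}

/-- The operator `-w_t + ∑ L i j ∂_i ∂_j w - lam w`, with classical derivatives. -/
def parabolicOp (L : ℝ → Fin d → Fin d → Val d₁ →L[ℂ] Val d₁) (lam : ℝ)
    (w : SpaceTime d → Val d₁) (z : SpaceTime d) : Val d₁ :=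
  -td w z + ∑ i, ∑ j, L z.1 i j (sd i (sd j w) z) - lam • w z

variable {δ K : ℝ} {L : ℝ → Fin d → Fin d → Val d₁ →L[ℂ] Val d₁} {lam : ℝ}
  {w : SpaceTime d → Val d₁}

lemma clm_time_memLp (hL : IsParabolic δ K L) (hw : IsTest w) (i j : Fin d) :
    MemLp (fun z => L z.1 i j (w z)) 2 :=
  MemLp.clm_apply_time hL Measure.AbsolutelyContinuous.rfl (hw.memLp 2) i j

lemma parabolicOp_memLp (hL : IsParabolic δ K L) (hw : IsTest w) :
    MemLp (parabolicOp L lam w) 2 :=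
  (((hw.dv _).memLp 2).neg.add (memLp_finsetSum _ fun i _ => memLp_finsetSum _ fun j _ =>
    clm_time_memLp hL ((hw.dv _).dv _) i j)).sub ((hw.memLp 2).const_smul lam)

/-- The cylinder `(-∞, T) × ℝ^d`. -/
def timeSet (d : ℕ) (T : WithTop ℝ) : Set (SpaceTime d) := {z | (z.1 : WithTop ℝ) < T}

lemma isOpen_lt_coe (T : WithTop ℝ) : IsOpen {t : ℝ | (t : WithTop ℝ) < T} :=
  isOpen_Iio.preimage WithTop.continuous_coe

lemma timeSet_eq (T : WithTop ℝ) :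
    timeSet d T = {t : ℝ | (t : WithTop ℝ) < T} ×ˢ Set.univ := by
  ext z; simp [timeSet]

lemma restrict_timeSet (T : WithTop ℝ) :
    (volume : Measure (SpaceTime d)).restrict (timeSet d T) =
      ((volume : Measure ℝ).restrict {t : ℝ | (t : WithTop ℝ) < T}).prod volume := by
  rw [timeSet_eq, Measure.volume_eq_prod, ← Measure.prod_restrict, Measure.restrict_univ]

/-- The integral is `g T`, or `0` if `T = ∞`. -/
lemma setIntegral_deriv_nonneg {g g' : ℝ → ℝ} (hg : IsTest g) (hd : ∀ t, HasDerivAt g (g' t) t)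
    (h0 : ∀ t, 0 ≤ g t) (T : WithTop ℝ) :
    0 ≤ ∫ t in {t : ℝ | (t : WithTop ℝ) < T}, g' t := by
  have e : g' = deriv g := funext fun t => (hd t).deriv.symm
  have hi : Integrable g' := by rw [e]; exact hg.deriv.integrable
  induction T using WithTop.recTopCoe with
  | top =>
    have h1 : {t : ℝ | (t : WithTop ℝ) < ⊤} = Set.univ := by
      ext t; simp [WithTop.coe_lt_top]
    rw [h1, Measure.restrict_univ]
    have h2 := integral_eq_zero_of_hasDerivAt_of_integrable hd hi hg.integrable
    rw [h2]
  | coe s =>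
    have h1 : {t : ℝ | (t : WithTop ℝ) < (s : WithTop ℝ)} = Set.Iio s := by
      ext t; simp
    rw [h1, ← integral_Iic_eq_integral_Iio]
    have h3 : Tendsto g atBot (𝓝 0) :=
      hg.compact.is_zero_at_infty.mono_left atBot_le_cocompact
    rw [integral_Iic_of_hasDerivAt_of_tendsto (hd s).continuousAt.continuousWithinAt
      (fun t _ => hd t) hi.integrableOn h3, sub_zero]
    exact h0 s

lemma setIntegral_inner_td_nonneg (hw : IsTest w) (T : WithTop ℝ) :
    0 ≤ ∫ z in timeSet d T, inner ℝ (w z) (td w z) := by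
  have hi : Integrable fun z => inner ℝ (w z) (td w z) :=
    IsTest.inner_integrable hw.continuous (hw.dv _)
  have hi' := hi.restrict (s := timeSet d T)
  rw [restrict_timeSet] at hi' ⊢
  rw [integral_prod_symm _ hi']
  refine integral_nonneg fun x => ?_
  have hw' := hw.timeSlice x
  have hd := fun t => hasDerivAt_timeSlice hw.differentiable t x
  have h1 : ∀ t, HasDerivAt (fun t => 1 / 2 * ‖w (t, x)‖ ^ 2) (inner ℝ (w (t, x)) (td w (t, x))) t := by
    intro t
    have := ((hd t).norm_sq).const_mul (1 / 2)
    rw [show inner ℝ (w (t, x)) (td w (t, x)) = 1 / 2 * (2 * inner ℝ (w (t, x)) (td w (t, x))) by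
      ring]
    exact this
  have h2 : IsTest fun t => 1 / 2 * ‖w (t, x)‖ ^ 2 := by
    refine ⟨contDiff_const.mul (hw'.smooth.norm_sq ℝ), hw'.compact.mono fun t ht => ?_⟩
    contrapose! ht
    simp only [Function.mem_support, not_not] at ht ⊢
    simp [ht]
  exact setIntegral_deriv_nonneg h2 h1 (fun t => by positivity) T

/-- The energy inequality: the equation is multiplied by `w` and integrated up to time `T`; the
elliptic part is treated with `garding` at each time. -/
lemma energy_test (hL : IsParabolic δ K L) (hw : IsTest w) (T : WithTop ℝ) :
    δ * (∫ z in timeSet d T, ∑ i, ‖sd i w z‖ ^ 2) + lam * (∫ z in timeSet d T, ‖w z‖ ^ 2) ≤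
      - ∫ z in timeSet d T, inner ℝ (w z) (parabolicOp L lam w z) := by
  have i1 : Integrable fun z => inner ℝ (w z) (td w z) :=
    IsTest.inner_integrable hw.continuous (hw.dv _)
  have i2 : ∀ i j, Integrable fun z => inner ℝ (w z) (L z.1 i j (sd i (sd j w) z)) := fun i j =>
    MemLp.integrable_real_inner (hw.memLp 2) (clm_time_memLp hL ((hw.dv _).dv _) i j)
  have i2' : Integrable fun z => ∑ i, ∑ j, inner ℝ (w z) (L z.1 i j (sd i (sd j w) z)) :=
    integrable_finsetSum _ fun i _ => integrable_finsetSum _ fun j _ => i2 i j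
  have i3 : Integrable fun z => lam * ‖w z‖ ^ 2 := hw.normSq_integrable.const_mul lam
  have i4 : Integrable fun z => ∑ i, ‖sd i w z‖ ^ 2 :=
    integrable_finsetSum _ fun i _ => (hw.dv _).normSq_integrable
  have e : ∀ z, inner ℝ (w z) (parabolicOp L lam w z) = -inner ℝ (w z) (td w z) +
      (∑ i, ∑ j, inner ℝ (w z) (L z.1 i j (sd i (sd j w) z))) - lam * ‖w z‖ ^ 2 := fun z => by
    simp only [parabolicOp, inner_sub_right, inner_add_right, inner_neg_right, inner_sum,
      real_inner_smul_right, real_inner_self_eq_norm_sq]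
  have i12 : Integrable fun z => -inner ℝ (w z) (td w z) +
      (∑ i, ∑ j, inner ℝ (w z) (L z.1 i j (sd i (sd j w) z))) := i1.neg.add i2'
  have i1n : Integrable fun z => -inner ℝ (w z) (td w z) := i1.neg
  simp_rw [e]
  rw [integral_sub i12.restrict i3.restrict, integral_add i1n.restrict i2'.restrict,
    integral_neg, integral_const_mul]
  have h1 := setIntegral_inner_td_nonneg hw T
  have h2 : δ * (∫ z in timeSet d T, ∑ i, ‖sd i w z‖ ^ 2) ≤
      - ∫ z in timeSet d T, ∑ i, ∑ j, inner ℝ (w z) (L z.1 i j (sd i (sd j w) z)) := by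
    have j2 := i2'.restrict (s := timeSet d T)
    have j4 := i4.restrict (s := timeSet d T)
    rw [restrict_timeSet] at j2 j4 ⊢
    rw [integral_prod _ j2, integral_prod _ j4, ← integral_const_mul, ← integral_neg]
    refine integral_mono (j4.integral_prod_left.const_mul δ) j2.integral_prod_left.neg fun t => ?_
    have hs := hw.slice t
    have h3 := garding (hL.ell t) (fun x => w (t, x)) hs.smooth hs.compact
    simp only [pd_slice hw.differentiable] at h3
    refine h3.trans (le_of_eq ?_)
    have k1 : ∀ i j, Integrable fun x => inner ℝ (w (t, x)) (L t i j (sd i (sd j w) (t, x))) :=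
      fun i j => IsTest.inner_integrable hs.continuous
        ((((hw.dv _).dv _).slice t).clm ((L t i j).restrictScalars ℝ))
    have k2 : ∀ i j, Integrable fun x => inner ℝ (sd i w (t, x)) (L t i j (sd j w (t, x))) :=
      fun i j => IsTest.inner_integrable ((hw.dv _).slice t).continuous
        ((((hw.dv _)).slice t).clm ((L t i j).restrictScalars ℝ))
    simp only
    rw [integral_finsetSum _ fun i _ => integrable_finsetSum _ fun j _ => k1 i j,
      integral_finsetSum _ fun i _ => integrable_finsetSum _ fun j _ => k2 i j,
      ← Finset.sum_neg_distrib]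
    refine Finset.sum_congr rfl fun i _ => ?_
    rw [integral_finsetSum _ fun j _ => k1 i j, integral_finsetSum _ fun j _ => k2 i j,
      ← Finset.sum_neg_distrib]
    refine Finset.sum_congr rfl fun j _ => ?_
    have hg : IsTest fun x => L t i j (sd j w (t, x)) :=
      ((hw.dv _).slice t).clm ((L t i j).restrictScalars ℝ)
    have h4 := integral_inner_dv (μ := volume) hs.smooth hg (EuclideanSpace.single i 1)
    have e5 : dv (EuclideanSpace.single i 1) (fun x => L t i j (sd j w (t, x))) =
        fun x => L t i j (sd i (sd j w) (t, x)) := by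
      have := dv_clm ((L t i j).restrictScalars ℝ) ((hw.dv (spaceDir j)).slice t).differentiable
        (EuclideanSpace.single i 1)
      refine this.trans (funext fun x => ?_)
      have h6 := congrFun (pd_slice (hw.dv (spaceDir j)).differentiable i t) x
      exact congrArg (L t i j) h6
    have e6 : dv (EuclideanSpace.single i 1) (fun x => w (t, x)) = fun x => sd i w (t, x) :=
      pd_slice hw.differentiable i t
    rw [e5, e6] at h4
    linarith
  linarith

end ParabolicOperator

/-! ### Estimates of orders zero, one and two -/

section Estimate

variable {d d₁ : ℕ} {δ K : ℝ} {L : ℝ → Fin d → Fin d → Val d₁ →L[ℂ] Val d₁} {lam : ℝ}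
  {w φ : SpaceTime d → Val d₁}

lemma neg_inner_le_of_pos {H : Type*} [NormedAddCommGroup H] [InnerProductSpace ℝ H] {c : ℝ}
    (hc : 0 < c) (a b : H) : -inner ℝ a b ≤ c * ‖a‖ ^ 2 + 1 / (4 * c) * ‖b‖ ^ 2 := by
  have h1 : -inner ℝ a b ≤ ‖a‖ * ‖b‖ := (neg_le_abs _).trans (abs_real_inner_le_norm a b)
  have h2 : c * ‖a‖ ^ 2 + 1 / (4 * c) * ‖b‖ ^ 2 - ‖a‖ * ‖b‖ = c * (‖a‖ - 1 / (2 * c) * ‖b‖) ^ 2 := by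
    field_simp
    ring
  have : 0 ≤ c * (‖a‖ - 1 / (2 * c) * ‖b‖) ^ 2 := by positivity
  linarith

lemma parabolicOp_normSq_integrable (hL : IsParabolic δ K L) (hw : IsTest w) :
    Integrable fun z => ‖parabolicOp L lam w z‖ ^ 2 :=
  (parabolicOp_memLp hL hw).integrable_norm_pow (by norm_num)

/-- The bound of order zero, without a weight. -/
lemma sq_mul_integral_normSq_le (hδ : 0 < δ) (hL : IsParabolic δ K L) (hlam : 0 ≤ lam)
    (hw : IsTest w) (T : WithTop ℝ) :
    lam ^ 2 * (∫ z in timeSet d T, ‖w z‖ ^ 2) ≤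
      ∫ z in timeSet d T, ‖parabolicOp L lam w z‖ ^ 2 := by
  rcases hlam.eq_or_lt with rfl | hlam
  · rw [zero_pow two_ne_zero, zero_mul]
    exact integral_nonneg fun z => by positivity
  have h1 := energy_test (lam := lam) hL hw T
  have h2 : 0 ≤ δ * (∫ z in timeSet d T, ∑ i, ‖sd i w z‖ ^ 2) :=
    mul_nonneg hδ.le (integral_nonneg fun z => Finset.sum_nonneg fun i _ => by positivity)
  have i1 : Integrable fun z => inner ℝ (w z) (parabolicOp L lam w z) :=
    MemLp.integrable_real_inner (hw.memLp 2) (parabolicOp_memLp hL hw)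
  have h3 : - ∫ z in timeSet d T, inner ℝ (w z) (parabolicOp L lam w z) ≤
      lam / 2 * (∫ z in timeSet d T, ‖w z‖ ^ 2) +
        1 / (4 * (lam / 2)) * ∫ z in timeSet d T, ‖parabolicOp L lam w z‖ ^ 2 := by
    have j1 := (hw.normSq_integrable (μ := volume)).const_mul (lam / 2)
    have j2 := (parabolicOp_normSq_integrable (lam := lam) hL hw).const_mul (1 / (4 * (lam / 2)))
    rw [← integral_neg, ← integral_const_mul, ← integral_const_mul,
      ← integral_add j1.restrict j2.restrict]
    exact integral_mono i1.neg.restrict (j1.add j2).restrict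
      fun z => neg_inner_le_of_pos (by positivity) _ _
  have h4 : lam / 2 * (∫ z in timeSet d T, ‖w z‖ ^ 2) ≤
      1 / (2 * lam) * ∫ z in timeSet d T, ‖parabolicOp L lam w z‖ ^ 2 := by
    rw [show 4 * (lam / 2) = 2 * lam by ring] at h3
    linarith
  have h5 := mul_le_mul_of_nonneg_left h4 (by positivity : 0 ≤ 2 * lam)
  calc _ = 2 * lam * (lam / 2 * (∫ z in timeSet d T, ‖w z‖ ^ 2)) := by ring
    _ ≤ _ := h5
    _ = _ := by field_simp

/-- The coefficients do not depend on space, so the operator commutes with `∂_k`. At a fixed time no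
regularity of the coefficients is lost. -/
lemma pd_parabolicOp_slice (hw : IsTest w) (k : Fin d) (t : ℝ) :
    IsTest (fun x => parabolicOp L lam w (t, x)) ∧
    dv (EuclideanSpace.single k 1) (fun x => parabolicOp L lam w (t, x)) =
      fun x => parabolicOp L lam (sd k w) (t, x) := by
  have hL' : ∀ i j, IsTest fun x => L t i j (sd i (sd j w) (t, x)) := fun i j =>
    (((hw.dv _).dv _).slice t).clm ((L t i j).restrictScalars ℝ)
  have h1 : IsTest fun x => -td w (t, x) := ((hw.dv _).slice t).neg
  have h2' : ∀ i, IsTest fun x => ∑ j, L t i j (sd i (sd j w) (t, x)) := fun i =>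
    IsTest.sum _ fun j => hL' i j
  have h2 : IsTest fun x => ∑ i, ∑ j, L t i j (sd i (sd j w) (t, x)) := IsTest.sum _ h2'
  have h3 : IsTest fun x => lam • w (t, x) := (hw.slice t).smul_left contDiff_const
  refine ⟨(h1.add h2).sub h3, ?_⟩
  have e1 : dv (EuclideanSpace.single k 1) (fun x => -td w (t, x)) =
      fun x => -td (sd k w) (t, x) := by
    rw [dv_neg]
    funext x
    have := congrFun (pd_slice (hw.dv (timeDir d)).differentiable k t) x
    rw [pd] at this
    rw [this, td, dv_comm hw.smooth]
  have e3 : dv (EuclideanSpace.single k 1) (fun x => lam • w (t, x)) =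
      fun x => lam • sd k w (t, x) := by
    rw [dv_const_smul _ (hw.slice t).differentiable]
    funext x
    rw [← congrFun (pd_slice hw.differentiable k t) x]
  have e2 : dv (EuclideanSpace.single k 1) (fun x => ∑ i, ∑ j, L t i j (sd i (sd j w) (t, x))) =
      fun x => ∑ i, ∑ j, L t i j (sd i (sd j (sd k w)) (t, x)) := by
    rw [dv_sum _ fun i => (h2' i).differentiable]
    funext x
    refine Finset.sum_congr rfl fun i _ => ?_
    rw [dv_sum _ fun j => (hL' i j).differentiable]
    refine Finset.sum_congr rfl fun j _ => ?_
    have h4 := congrFun (dv_clm ((L t i j).restrictScalars ℝ)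
      (((hw.dv (spaceDir j)).dv (spaceDir i)).slice t).differentiable
      (EuclideanSpace.single k 1)) x
    refine h4.trans (congrArg (L t i j) ?_)
    have h5 := congrFun (pd_slice ((hw.dv (spaceDir j)).dv (spaceDir i)).differentiable k t) x
    refine h5.trans ?_
    rw [sd, dv_comm (hw.dv _).smooth, dv_comm hw.smooth (spaceDir k)]
  have e12 := dv_add h1.differentiable h2.differentiable (EuclideanSpace.single k 1)
  have e123 := dv_sub (h1.add h2).differentiable h3.differentiable (EuclideanSpace.single k 1)
  rw [e12, e1, e2, e3] at e123
  exact e123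

lemma setIntegral_inner_sd_parabolicOp (hL : IsParabolic δ K L) (hw : IsTest w) (k : Fin d)
    (T : WithTop ℝ) :
    ∫ z in timeSet d T, inner ℝ (sd k w z) (parabolicOp L lam (sd k w) z) =
      - ∫ z in timeSet d T, inner ℝ (sd k (sd k w) z) (parabolicOp L lam w z) := by
  have i1 : Integrable fun z => inner ℝ (sd k w z) (parabolicOp L lam (sd k w) z) :=
    MemLp.integrable_real_inner ((hw.dv _).memLp 2) (parabolicOp_memLp hL (hw.dv _))
  have i2 : Integrable fun z => inner ℝ (sd k (sd k w) z) (parabolicOp L lam w z) :=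
    MemLp.integrable_real_inner (((hw.dv _).dv _).memLp 2) (parabolicOp_memLp hL hw)
  have j1 := i1.restrict (s := timeSet d T)
  have j2 := i2.restrict (s := timeSet d T)
  rw [restrict_timeSet] at j1 j2 ⊢
  rw [integral_prod _ j1, integral_prod _ j2, ← integral_neg]
  refine integral_congr_ae (ae_of_all _ fun t => ?_)
  obtain ⟨h1, h2⟩ := pd_parabolicOp_slice (L := L) (lam := lam) hw k t
  have h3 := integral_inner_dv (μ := volume) ((hw.dv (spaceDir k)).slice t).smooth h1
    (EuclideanSpace.single k 1)
  have h4 : dv (EuclideanSpace.single k 1) (fun x => sd k w (t, x)) =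
    fun x => sd k (sd k w) (t, x) := pd_slice (hw.dv _).differentiable k t
  rw [h2, h4] at h3
  exact h3

/-- The bound of order two, without a weight, from the energy inequality for `∂_k w`. -/
lemma integral_normSq_sd_sd_le (hδ : 0 < δ) (hL : IsParabolic δ K L)
    (hw : IsTest w) (k : Fin d) (T : WithTop ℝ) :
    δ / 2 * (∫ z in timeSet d T, ∑ i, ‖sd i (sd k w) z‖ ^ 2) +
      lam * (∫ z in timeSet d T, ‖sd k w z‖ ^ 2) ≤
      1 / (2 * δ) * ∫ z in timeSet d T, ‖parabolicOp L lam w z‖ ^ 2 := by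
  have h1 := energy_test (lam := lam) hL (hw.dv (spaceDir k)) T
  rw [setIntegral_inner_sd_parabolicOp hL hw] at h1
  have i1 : Integrable fun z => -inner ℝ (sd k (sd k w) z) (parabolicOp L lam w z) :=
    (MemLp.integrable_real_inner (((hw.dv _).dv _).memLp 2) (parabolicOp_memLp hL hw)).neg
  have i2 : Integrable fun z => ∑ i, ‖sd i (sd k w) z‖ ^ 2 :=
    integrable_finsetSum _ fun i _ => ((hw.dv _).dv _).normSq_integrable
  have h3 : ∫ z in timeSet d T, inner ℝ (sd k (sd k w) z) (parabolicOp L lam w z) ≤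
      δ / 2 * (∫ z in timeSet d T, ∑ i, ‖sd i (sd k w) z‖ ^ 2) +
        1 / (4 * (δ / 2)) * ∫ z in timeSet d T, ‖parabolicOp L lam w z‖ ^ 2 := by
    have j1 := i2.const_mul (δ / 2)
    have j2 := (parabolicOp_normSq_integrable (lam := lam) hL hw).const_mul (1 / (4 * (δ / 2)))
    rw [← integral_const_mul, ← integral_const_mul, ← integral_add j1.restrict j2.restrict]
    refine integral_mono
      (MemLp.integrable_real_inner (((hw.dv _).dv _).memLp 2) (parabolicOp_memLp hL hw)).restrict
      (j1.add j2).restrict fun z => ?_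
    have h4 := neg_inner_le_of_pos (half_pos hδ) (-sd k (sd k w) z) (parabolicOp L lam w z)
    rw [inner_neg_left, neg_neg, norm_neg] at h4
    have h5 : ‖sd k (sd k w) z‖ ^ 2 ≤ ∑ i, ‖sd i (sd k w) z‖ ^ 2 :=
      Finset.single_le_sum (f := fun i => ‖sd i (sd k w) z‖ ^ 2) (fun i _ => by positivity)
        (Finset.mem_univ k)
    have h6 : δ / 2 * ‖sd k (sd k w) z‖ ^ 2 ≤ δ / 2 * ∑ i, ‖sd i (sd k w) z‖ ^ 2 := by gcongr
    simp only
    linarith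
  rw [show 4 * (δ / 2) = 2 * δ by ring] at h3
  rw [neg_neg] at h1
  linarith

variable [NeZero d]

lemma setIntegral_hardy (hφ : IsTest φ) (hs : tsupport φ ⊆ {z | 0 < z.2 0}) (T : WithTop ℝ) :
    ∫ z in timeSet d T, ‖(z.2 0)⁻¹ • φ z‖ ^ 2 ≤
      4 * ∫ z in timeSet d T, ∑ i, ‖sd i φ z‖ ^ 2 := by
  have i1 : Integrable fun z => ‖(z.2 0)⁻¹ • φ z‖ ^ 2 :=
    (hφ.inv_spaceCoord_smul hs).normSq_integrable
  have i2 : Integrable fun z => ∑ i, ‖sd i φ z‖ ^ 2 :=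
    integrable_finsetSum _ fun i _ => (hφ.dv _).normSq_integrable
  have j1 := i1.restrict (s := timeSet d T)
  have j2 := i2.restrict (s := timeSet d T)
  rw [restrict_timeSet] at j1 j2 ⊢
  rw [integral_prod _ j1, integral_prod _ j2, ← integral_const_mul]
  refine integral_mono j1.integral_prod_left (j2.integral_prod_left.const_mul 4) fun t => ?_
  have hsl : tsupport (fun x => φ (t, x)) ⊆ {x | 0 < x 0} := fun x hx =>
    hs (tsupport_comp_subset_preimage φ (f := fun x => (t, x)) (by fun_prop) hx)
  refine (hardy (hφ.slice t) hsl).trans ?_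
  rw [pd_slice hφ.differentiable]
  refine mul_le_mul_of_nonneg_left (integral_mono ((hφ.dv (spaceDir 0)).slice t).normSq_integrable
    (integrable_finsetSum _ fun i _ => ((hφ.dv (spaceDir i)).slice t).normSq_integrable)
    fun x => ?_) (by norm_num)
  exact Finset.single_le_sum (f := fun i => ‖sd i φ (t, x)‖ ^ 2) (fun i _ => by positivity)
    (Finset.mem_univ 0)

/-- The commutator of the operator with multiplication by `x_1` is of order one. -/
lemma parabolicOp_spaceCoord_smul (hφ : IsTest φ) (z : SpaceTime d) :
    parabolicOp L lam (fun z => z.2 0 • φ z) z = z.2 0 • parabolicOp L lam φ z +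
      ((∑ j, L z.1 0 j (sd j φ z)) + ∑ i, L z.1 i 0 (sd i φ z)) := by
  have hr : ∀ (i j : Fin d) (c : ℝ) (y : Val d₁), L z.1 i j (c • y) = c • L z.1 i j y :=
    fun i j c y => (L z.1 i j).map_smul_of_tower c y
  simp only [parabolicOp, td_smul_spaceCoord hφ, sd_sd_smul_spaceCoord hφ, map_add, hr,
    Finset.sum_add_distrib]
  have e1 : ∑ i, ∑ j, (if 0 = i then (1 : ℝ) else 0) • L z.1 i j (sd j φ z) =
      ∑ j, L z.1 0 j (sd j φ z) := by
    rw [Finset.sum_eq_single 0 (fun i _ hi => by simp [hi.symm]) (by simp)]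
    simp
  have e2 : ∑ i, ∑ j, (if 0 = j then (1 : ℝ) else 0) • L z.1 i j (sd i φ z) =
      ∑ i, L z.1 i 0 (sd i φ z) := by
    refine Finset.sum_congr rfl fun i _ => ?_
    rw [Finset.sum_eq_single 0 (fun j _ hj => by simp [hj.symm]) (by simp)]
    simp
  rw [e1, e2, smul_sub, smul_add, smul_neg, Finset.smul_sum, smul_comm lam]
  simp only [Finset.smul_sum]
  abel

lemma norm_commutator_sq_le (hL : IsParabolic δ K L) (z : SpaceTime d) (y : Fin d → Val d₁) :
    ‖(∑ j, L z.1 0 j (y j)) + ∑ i, L z.1 i 0 (y i)‖ ^ 2 ≤ 4 * K ^ 2 * d * ∑ i, ‖y i‖ ^ 2 := by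
  have h1 : ‖(∑ j, L z.1 0 j (y j)) + ∑ i, L z.1 i 0 (y i)‖ ≤ 2 * K * ∑ i, ‖y i‖ := by
    refine (norm_add_le _ _).trans ?_
    have a1 : ‖∑ j, L z.1 0 j (y j)‖ ≤ ∑ j, K * ‖y j‖ :=
      norm_sum_le_of_le _ fun j _ => (L z.1 0 j).le_of_opNorm_le (hL.bound _ _ _) _
    have a2 : ‖∑ i, L z.1 i 0 (y i)‖ ≤ ∑ j, K * ‖y j‖ :=
      norm_sum_le_of_le _ fun i _ => (L z.1 i 0).le_of_opNorm_le (hL.bound _ _ _) _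
    rw [← Finset.mul_sum] at a1 a2
    linarith
  have h2 : (∑ i, ‖y i‖) ^ 2 ≤ d * ∑ i, ‖y i‖ ^ 2 := by
    simpa using sq_sum_le_card_mul_sum_sq (s := (Finset.univ : Finset (Fin d))) (f := fun i => ‖y i‖)
  calc _ ≤ (2 * K * ∑ i, ‖y i‖) ^ 2 := by gcongr
    _ = 4 * K ^ 2 * (∑ i, ‖y i‖) ^ 2 := by ring
    _ ≤ 4 * K ^ 2 * (d * ∑ i, ‖y i‖ ^ 2) := by gcongr
    _ = _ := by ring

lemma spaceCoord_smul_parabolicOp_memLp (hL : IsParabolic δ K L) (hφ : IsTest φ) :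
    MemLp (fun z => z.2 0 • parabolicOp L lam φ z) 2 := by
  have h1 : IsTest fun z : SpaceTime d => z.2 0 • φ z := hφ.smul_left (contDiff_spaceCoord 0)
  have h2 : MemLp (fun z => (∑ j, L z.1 0 j (sd j φ z)) + ∑ i, L z.1 i 0 (sd i φ z)) 2 :=
    (memLp_finsetSum _ fun j _ => clm_time_memLp hL (hφ.dv _) 0 j).add
      (memLp_finsetSum _ fun i _ => clm_time_memLp hL (hφ.dv _) i 0)
  refine ((parabolicOp_memLp (lam := lam) hL h1).sub h2).ae_eq (ae_of_all _ fun z => ?_)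
  simp only [Pi.sub_apply]
  rw [parabolicOp_spaceCoord_smul hφ, add_sub_cancel_right]

/-- The bound of order one. The right-hand side of the energy inequality is split as
`⟨M⁻¹ φ, M (parabolicOp L lam φ)⟩`, and `M⁻¹ φ` is absorbed with Hardy's inequality. -/
lemma integral_normSq_sd_le (hδ : 0 < δ) (hL : IsParabolic δ K L)
    (hφ : IsTest φ) (hs : tsupport φ ⊆ {z | 0 < z.2 0}) (T : WithTop ℝ) :
    δ / 2 * (∫ z in timeSet d T, ∑ i, ‖sd i φ z‖ ^ 2) + lam * (∫ z in timeSet d T, ‖φ z‖ ^ 2) ≤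
      2 / δ * ∫ z in timeSet d T, ‖z.2 0 • parabolicOp L lam φ z‖ ^ 2 := by
  have h1 := energy_test (lam := lam) hL hφ T
  have h2 := setIntegral_hardy hφ hs T
  have hp := spaceCoord_smul_parabolicOp_memLp (lam := lam) hL hφ
  have hq := (hφ.inv_spaceCoord_smul hs)
  have e : ∀ z, inner ℝ (φ z) (parabolicOp L lam φ z) =
      inner ℝ ((z.2 0)⁻¹ • φ z) (z.2 0 • parabolicOp L lam φ z) := fun z => by
    by_cases hz : φ z = 0
    · simp [hz]
    · have hz0 : z.2 0 ≠ 0 := (hs (subset_tsupport _ hz)).ne'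
      rw [real_inner_smul_left, real_inner_smul_right, inv_mul_cancel_left₀ hz0]
  have h3 : - ∫ z in timeSet d T, inner ℝ (φ z) (parabolicOp L lam φ z) ≤
      δ / 8 * (∫ z in timeSet d T, ‖(z.2 0)⁻¹ • φ z‖ ^ 2) +
        1 / (4 * (δ / 8)) * ∫ z in timeSet d T, ‖z.2 0 • parabolicOp L lam φ z‖ ^ 2 := by
    have j1 := (hq.normSq_integrable (μ := volume)).const_mul (δ / 8)
    have j2 : Integrable fun z => 1 / (4 * (δ / 8)) * ‖z.2 0 • parabolicOp L lam φ z‖ ^ 2 :=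
      (hp.integrable_norm_pow (by norm_num)).const_mul _
    rw [← integral_neg, ← integral_const_mul, ← integral_const_mul,
      ← integral_add j1.restrict j2.restrict]
    simp_rw [e]
    exact integral_mono (MemLp.integrable_real_inner (hq.memLp 2) hp).neg.restrict
      (j1.add j2).restrict fun z => neg_inner_le_of_pos (by positivity) _ _
  rw [show 1 / (4 * (δ / 8)) = 2 / δ by field_simp; norm_num] at h3
  nlinarith

end Estimate

/-! ### The a priori estimate for test functions -/

section Estimate

lemma eLpNorm_two_le_of_integral_sq_le {α F G : Type*} [MeasurableSpace α] {μ : Measure α}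
    [NormedAddCommGroup F] [NormedAddCommGroup G] {f : α → F} {g : α → G} {C : ℝ}
    (hf : MemLp f 2 μ) (hg : MemLp g 2 μ) (hC : 0 ≤ C)
    (h : ∫ x, ‖f x‖ ^ 2 ∂μ ≤ C * ∫ x, ‖g x‖ ^ 2 ∂μ) :
    eLpNorm f 2 μ ≤ ENNReal.ofReal (√C) * eLpNorm g 2 μ := by
  rw [hf.eLpNorm_eq_integral_rpow_norm (by norm_num) (by norm_num),
    hg.eLpNorm_eq_integral_rpow_norm (by norm_num) (by norm_num),
    ← ENNReal.ofReal_mul (Real.sqrt_nonneg _)]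
  refine ENNReal.ofReal_le_ofReal ?_
  simp only [ENNReal.toReal_ofNat, Real.rpow_two, ← one_div, ← Real.sqrt_eq_rpow]
  rw [← Real.sqrt_mul hC]
  exact Real.sqrt_le_sqrt h

variable {δ K : ℝ}

lemma norm_add_three_sq_le {H : Type*} [NormedAddCommGroup H] (a b c : H) :
    ‖a + b + c‖ ^ 2 ≤ 3 * (‖a‖ ^ 2 + ‖b‖ ^ 2 + ‖c‖ ^ 2) := by
  have h : ‖a + b + c‖ ≤ ‖a‖ + ‖b‖ + ‖c‖ := norm_add₃_le
  have h2 : ‖a + b + c‖ ^ 2 ≤ (‖a‖ + ‖b‖ + ‖c‖) ^ 2 := by gcongr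
  nlinarith [sq_nonneg (‖a‖ - ‖b‖), sq_nonneg (‖a‖ - ‖c‖), sq_nonneg (‖b‖ - ‖c‖)]

lemma ite_smul_norm_sq_le {H : Type*} [NormedAddCommGroup H] [NormedSpace ℝ H] (p : Prop)
    [Decidable p] (y : H) : ‖(if p then (1 : ℝ) else 0) • y‖ ^ 2 ≤ ‖y‖ ^ 2 := by
  split_ifs <;> simp

/-- The a priori estimate, for test functions and with squared norms. The weight `x_1` of the
highest order terms is moved into the function: `v = x_1 φ` satisfies the equation with a right-hand
side that consists of `x_1 (parabolicOp L lam φ)` and first derivatives of `φ`. The latter are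
bounded by `integral_normSq_sd_le`, so the unweighted estimates apply to `v`. -/
theorem exists_integral_bound (d d₁ : ℕ) [NeZero d] (hδ : 0 < δ) : ∃ C : ℝ, 0 ≤ C ∧
    ∀ L : ℝ → Fin d → Fin d → Val d₁ →L[ℂ] Val d₁, IsParabolic δ K L → ∀ lam : ℝ, 0 ≤ lam →
    ∀ (T : WithTop ℝ) (φ : SpaceTime d → Val d₁), IsTest φ → tsupport φ ⊆ {z | 0 < z.2 0} →
    (∫ z in timeSet d T, ‖(z.2 0)⁻¹ • φ z‖ ^ 2 ≤
      C * ∫ z in timeSet d T, ‖z.2 0 • parabolicOp L lam φ z‖ ^ 2) ∧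
    (∀ i, ∫ z in timeSet d T, ‖sd i φ z‖ ^ 2 ≤
      C * ∫ z in timeSet d T, ‖z.2 0 • parabolicOp L lam φ z‖ ^ 2) ∧
    (∀ i j, ∫ z in timeSet d T, ‖z.2 0 • sd i (sd j φ) z‖ ^ 2 ≤
      C * ∫ z in timeSet d T, ‖z.2 0 • parabolicOp L lam φ z‖ ^ 2) ∧
    (∫ z in timeSet d T, ‖z.2 0 • td φ z‖ ^ 2 ≤
      C * ∫ z in timeSet d T, ‖z.2 0 • parabolicOp L lam φ z‖ ^ 2) ∧
    (∫ z in timeSet d T, ‖lam • z.2 0 • φ z‖ ^ 2 ≤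
      C * ∫ z in timeSet d T, ‖z.2 0 • parabolicOp L lam φ z‖ ^ 2) ∧
    (∀ i, ∫ z in timeSet d T, ‖√lam • z.2 0 • sd i φ z‖ ^ 2 ≤
      C * ∫ z in timeSet d T, ‖z.2 0 • parabolicOp L lam φ z‖ ^ 2) := by
  set c := 2 + 32 * K ^ 2 * d / δ ^ 2 with hc
  have hc0 : 0 ≤ c := by positivity
  set C := 16 / δ ^ 2 + 3 * (c / δ ^ 2 + 8 / δ ^ 2) + (c / δ + 4 / δ) +
    3 * (2 * c + K ^ 2 * d ^ 3 * (c / δ ^ 2)) with hC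
  have k1 : 0 ≤ 16 / δ ^ 2 := by positivity
  have k2 : 0 ≤ 3 * (c / δ ^ 2 + 8 / δ ^ 2) := by positivity
  have k3 : 0 ≤ c / δ + 4 / δ := by positivity
  have k4 : 0 ≤ 3 * (K ^ 2 * d ^ 3 * (c / δ ^ 2)) := by positivity
  refine ⟨C, by positivity, fun L hL lam hlam T φ hφ hs => ?_⟩
  set F := ∫ z in timeSet d T, ‖z.2 0 • parabolicOp L lam φ z‖ ^ 2 with hF
  have hF0 : 0 ≤ F := integral_nonneg fun z => by positivity
  set v : SpaceTime d → Val d₁ := fun z => z.2 0 • φ z with hv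
  have hvt : IsTest v := hφ.smul_left (contDiff_spaceCoord 0)
  have hle : ∀ {a b : ℝ}, a ≤ b * F → b ≤ C → a ≤ C * F := fun h1 h2 =>
    h1.trans (mul_le_mul_of_nonneg_right h2 hF0)
  have iX : Integrable fun z => ∑ i, ‖sd i φ z‖ ^ 2 :=
    integrable_finsetSum _ fun i _ => (hφ.dv _).normSq_integrable
  set X1 := ∫ z in timeSet d T, ∑ i, ‖sd i φ z‖ ^ 2 with hX1
  have hX1n : 0 ≤ X1 := integral_nonneg fun z => Finset.sum_nonneg fun i _ => by positivity
  have hX : ∀ i, ∫ z in timeSet d T, ‖sd i φ z‖ ^ 2 ≤ X1 := fun i =>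
    integral_mono (hφ.dv _).normSq_integrable.restrict iX.restrict fun z =>
      Finset.single_le_sum (f := fun i => ‖sd i φ z‖ ^ 2) (fun i _ => by positivity)
        (Finset.mem_univ i)
  -- the unweighted integrals of `φ` and of its first derivatives
  have h1 := integral_normSq_sd_le (lam := lam) hδ hL hφ hs T
  rw [← hF, ← hX1] at h1
  set X0 := ∫ z in timeSet d T, ‖φ z‖ ^ 2 with hX0
  have hX0n : 0 ≤ X0 := integral_nonneg fun z => by positivity
  have hX1F : X1 ≤ 4 / δ ^ 2 * F := by
    have : δ / 2 * X1 ≤ 2 / δ * F := by linarith [mul_nonneg hlam hX0n]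
    calc X1 = 2 / δ * (δ / 2 * X1) := by field_simp
      _ ≤ 2 / δ * (2 / δ * F) := by gcongr
      _ = _ := by ring
  have hX0F : lam * X0 ≤ 2 / δ * F := by linarith [mul_nonneg hδ.le hX1n]
  -- the equation for `v`, up to the commutator with `x_1`
  set G := ∫ z in timeSet d T, ‖parabolicOp L lam v z‖ ^ 2 with hG
  have hp := spaceCoord_smul_parabolicOp_memLp (lam := lam) hL hφ
  have ip : Integrable fun z => ‖z.2 0 • parabolicOp L lam φ z‖ ^ 2 :=
    hp.integrable_norm_pow (by norm_num)
  have hGF : G ≤ c * F := by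
    have j1 := ip.const_mul 2
    have j2 := iX.const_mul (8 * K ^ 2 * d)
    have : G ≤ 2 * F + 8 * K ^ 2 * d * X1 := by
      rw [hF, hX1, ← integral_const_mul, ← integral_const_mul,
        ← integral_add j1.restrict j2.restrict]
      refine integral_mono (parabolicOp_normSq_integrable hL hvt).restrict (j1.add j2).restrict
        fun z => ?_
      simp only
      rw [parabolicOp_spaceCoord_smul hφ]
      have h2 := norm_commutator_sq_le hL z fun i => sd i φ z
      refine (pow_le_pow_left₀ (norm_nonneg _) (norm_add_le _ _) 2).trans ?_
      refine add_sq_le.trans ?_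
      linarith
    calc G ≤ 2 * F + 8 * K ^ 2 * d * X1 := this
      _ ≤ 2 * F + 8 * K ^ 2 * d * (4 / δ ^ 2 * F) := by gcongr
      _ = _ := by rw [hc]; ring
  have hY0 : lam ^ 2 * (∫ z in timeSet d T, ‖v z‖ ^ 2) ≤ c * F :=
    (sq_mul_integral_normSq_le hδ hL hlam hvt T).trans hGF
  have iY : ∀ k, Integrable fun z => ∑ i, ‖sd i (sd k v) z‖ ^ 2 := fun k =>
    integrable_finsetSum _ fun i _ => ((hvt.dv _).dv _).normSq_integrable
  have hYn : ∀ k, 0 ≤ ∫ z in timeSet d T, ∑ i, ‖sd i (sd k v) z‖ ^ 2 := fun k =>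
    integral_nonneg fun z => Finset.sum_nonneg fun i _ => by positivity
  have hY1n : ∀ k, 0 ≤ ∫ z in timeSet d T, ‖sd k v z‖ ^ 2 := fun k =>
    integral_nonneg fun z => by positivity
  have hY : ∀ k, δ / 2 * (∫ z in timeSet d T, ∑ i, ‖sd i (sd k v) z‖ ^ 2) +
      lam * (∫ z in timeSet d T, ‖sd k v z‖ ^ 2) ≤ 1 / (2 * δ) * (c * F) := fun k =>
    (integral_normSq_sd_sd_le (lam := lam) hδ hL hvt k T).trans (by gcongr)
  have hY2 : ∀ k, ∫ z in timeSet d T, ∑ i, ‖sd i (sd k v) z‖ ^ 2 ≤ c / δ ^ 2 * F := fun k => by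
    have h2 := hY k
    have h3 := mul_nonneg hlam (hY1n k)
    calc _ = 2 / δ * (δ / 2 * (∫ z in timeSet d T, ∑ i, ‖sd i (sd k v) z‖ ^ 2)) := by field_simp
      _ ≤ 2 / δ * (1 / (2 * δ) * (c * F)) :=
          mul_le_mul_of_nonneg_left (by linarith) (by positivity)
      _ = _ := by field_simp
  have hY1 : ∀ k, lam * (∫ z in timeSet d T, ‖sd k v z‖ ^ 2) ≤ c / (2 * δ) * F := fun k => by
    have h2 := hY k
    have h3 := mul_nonneg (half_pos hδ).le (hYn k)
    calc _ ≤ 1 / (2 * δ) * (c * F) := by linarith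
      _ = _ := by ring
  have hY2' : ∀ i k, ∫ z in timeSet d T, ‖sd i (sd k v) z‖ ^ 2 ≤ c / δ ^ 2 * F := fun i k =>
    (integral_mono ((hvt.dv _).dv _).normSq_integrable.restrict (iY k).restrict fun z =>
      Finset.single_le_sum (f := fun i => ‖sd i (sd k v) z‖ ^ 2) (fun i _ => by positivity)
        (Finset.mem_univ i)).trans (hY2 k)
  -- back from `v` to `φ`; the time derivative is computed from the equation
  refine ⟨?_, fun i => ?_, fun i j => ?_, ?_, ?_, fun i => ?_⟩
  · refine hle ((setIntegral_hardy hφ hs T).trans (mul_le_mul_of_nonneg_left hX1F (by norm_num)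
      |>.trans_eq (?_ : _ = 16 / δ ^ 2 * F))) ?_
    · ring
    · rw [hC]; linarith
  · refine hle ((hX i).trans hX1F) ?_
    have : 4 / δ ^ 2 = 1 / 4 * (16 / δ ^ 2) := by ring
    rw [hC]; linarith
  · refine hle (b := 3 * (c / δ ^ 2 + 8 / δ ^ 2)) ?_ (by rw [hC]; linarith)
    have j1 := (((hvt.dv (spaceDir j)).dv (spaceDir i)).normSq_integrable (μ := volume))
    have j2 := ((hφ.dv (spaceDir j)).normSq_integrable (μ := volume))
    have j3 := ((hφ.dv (spaceDir i)).normSq_integrable (μ := volume))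
    have j12 : Integrable fun z => ‖sd i (sd j v) z‖ ^ 2 + ‖sd j φ z‖ ^ 2 := j1.add j2
    have j123 : Integrable fun z => ‖sd i (sd j v) z‖ ^ 2 + ‖sd j φ z‖ ^ 2 + ‖sd i φ z‖ ^ 2 :=
      j12.add j3
    have h2 : IsTest fun z => z.2 0 • sd i (sd j φ) z :=
      ((hφ.dv _).dv _).smul_left (contDiff_spaceCoord 0)
    have h3 : ∫ z in timeSet d T, ‖z.2 0 • sd i (sd j φ) z‖ ^ 2 ≤
        ∫ z in timeSet d T, 3 * (‖sd i (sd j v) z‖ ^ 2 + ‖sd j φ z‖ ^ 2 + ‖sd i φ z‖ ^ 2) := by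
      refine integral_mono h2.normSq_integrable.restrict (j123.const_mul 3).restrict fun z => ?_
      have e : z.2 0 • sd i (sd j φ) z = sd i (sd j v) z +
          (if 0 = i then (1 : ℝ) else 0) • -sd j φ z +
          (if 0 = j then (1 : ℝ) else 0) • -sd i φ z := by
        rw [sd_sd_smul_spaceCoord hφ]
        simp only [smul_neg]
        abel
      simp only
      rw [e]
      refine (norm_add_three_sq_le _ _ _).trans ?_
      have a1 := ite_smul_norm_sq_le (0 = i) (-sd j φ z)
      have a2 := ite_smul_norm_sq_le (0 = j) (-sd i φ z)
      rw [norm_neg] at a1 a2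
      gcongr
    rw [integral_const_mul, integral_add j12.restrict j3.restrict,
      integral_add j1.restrict j2.restrict] at h3
    have h8 : 8 / δ ^ 2 * F = 4 / δ ^ 2 * F + 4 / δ ^ 2 * F := by ring
    have := hX i
    have := hX j
    have := hY2' i j
    rw [mul_assoc, add_mul]
    linarith
  · refine hle (b := 3 * (2 * c + K ^ 2 * d ^ 3 * (c / δ ^ 2))) ?_ (by rw [hC]; linarith)
    have j1 := parabolicOp_normSq_integrable (lam := lam) hL hvt
    have j2 : Integrable fun z => K ^ 2 * d ^ 2 * ∑ k, ∑ i, ‖sd i (sd k v) z‖ ^ 2 :=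
      (integrable_finsetSum _ fun k _ => iY k).const_mul _
    have j3 : Integrable fun z => lam ^ 2 * ‖v z‖ ^ 2 := hvt.normSq_integrable.const_mul _
    have j12 : Integrable fun z => ‖parabolicOp L lam v z‖ ^ 2 +
      K ^ 2 * d ^ 2 * ∑ k, ∑ i, ‖sd i (sd k v) z‖ ^ 2 := j1.add j2
    have j123 : Integrable fun z => ‖parabolicOp L lam v z‖ ^ 2 +
      K ^ 2 * d ^ 2 * (∑ k, ∑ i, ‖sd i (sd k v) z‖ ^ 2) + lam ^ 2 * ‖v z‖ ^ 2 := j12.add j3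
    have h2 : IsTest fun z => z.2 0 • td φ z := (hφ.dv _).smul_left (contDiff_spaceCoord 0)
    have h3 : ∫ z in timeSet d T, ‖z.2 0 • td φ z‖ ^ 2 ≤
        ∫ z in timeSet d T, 3 * (‖parabolicOp L lam v z‖ ^ 2 +
          K ^ 2 * d ^ 2 * (∑ k, ∑ i, ‖sd i (sd k v) z‖ ^ 2) + lam ^ 2 * ‖v z‖ ^ 2) := by
      refine integral_mono h2.normSq_integrable.restrict (j123.const_mul 3).restrict fun z => ?_
      have e : z.2 0 • td φ z = -parabolicOp L lam v z +
          ∑ i, ∑ j, L z.1 i j (sd i (sd j v) z) + -(lam • v z) := by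
        rw [parabolicOp, td_smul_spaceCoord hφ]
        abel
      simp only
      rw [e]
      refine (norm_add_three_sq_le _ _ _).trans ?_
      rw [norm_neg, norm_neg, norm_smul, mul_pow, Real.norm_eq_abs, sq_abs]
      have a1 : ‖∑ i, ∑ j, L z.1 i j (sd i (sd j v) z)‖ ≤ ∑ i, ∑ j, K * ‖sd i (sd j v) z‖ :=
        norm_sum_le_of_le _ fun i _ => norm_sum_le_of_le _ fun j _ =>
          (L z.1 i j).le_of_opNorm_le (hL.bound _ _ _) _
      simp only [← Finset.mul_sum] at a1
      have a2 : (∑ i, ∑ j, ‖sd i (sd j v) z‖) ^ 2 ≤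
          d ^ 2 * ∑ k, ∑ i, ‖sd i (sd k v) z‖ ^ 2 := by
        calc (∑ i, ∑ j, ‖sd i (sd j v) z‖) ^ 2
            ≤ d * ∑ i, (∑ j, ‖sd i (sd j v) z‖) ^ 2 := by
              simpa using sq_sum_le_card_mul_sum_sq (s := (Finset.univ : Finset (Fin d)))
                (f := fun i => ∑ j, ‖sd i (sd j v) z‖)
          _ ≤ d * ∑ i, (d * ∑ j, ‖sd i (sd j v) z‖ ^ 2) := by
              gcongr with i
              simpa using sq_sum_le_card_mul_sum_sq (s := (Finset.univ : Finset (Fin d)))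
                (f := fun j => ‖sd i (sd j v) z‖)
          _ = _ := by
              rw [← Finset.mul_sum, Finset.sum_comm]
              ring
      have a3 : ‖∑ i, ∑ j, L z.1 i j (sd i (sd j v) z)‖ ^ 2 ≤
          K ^ 2 * d ^ 2 * ∑ k, ∑ i, ‖sd i (sd k v) z‖ ^ 2 := by
        calc _ ≤ (K * ∑ i, ∑ j, ‖sd i (sd j v) z‖) ^ 2 := by gcongr
          _ = K ^ 2 * (∑ i, ∑ j, ‖sd i (sd j v) z‖) ^ 2 := by ring
          _ ≤ K ^ 2 * (d ^ 2 * ∑ k, ∑ i, ‖sd i (sd k v) z‖ ^ 2) := by gcongr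
          _ = _ := by ring
      gcongr
    rw [integral_const_mul, integral_add j12.restrict j3.restrict,
      integral_add j1.restrict j2.restrict, integral_const_mul, integral_const_mul,
      integral_finsetSum _ fun k _ => (iY k).restrict] at h3
    have h4 : ∑ k, ∫ z in timeSet d T, ∑ i, ‖sd i (sd k v) z‖ ^ 2 ≤ d * (c / δ ^ 2 * F) := by
      calc _ ≤ ∑ _k : Fin d, c / δ ^ 2 * F := Finset.sum_le_sum fun k _ => hY2 k
        _ = _ := by simp
    have h5 : K ^ 2 * d ^ 2 * (∑ k, ∫ z in timeSet d T, ∑ i, ‖sd i (sd k v) z‖ ^ 2) ≤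
        K ^ 2 * d ^ 2 * (d * (c / δ ^ 2 * F)) := by gcongr
    have h6 : 3 * (2 * c + K ^ 2 * d ^ 3 * (c / δ ^ 2)) * F =
      3 * (c * F + K ^ 2 * d ^ 2 * (d * (c / δ ^ 2 * F)) + c * F) := by ring
    rw [h6]
    linarith
  · refine hle (b := c) ?_ (by rw [hC]; linarith)
    have e : ∀ z, ‖lam • z.2 0 • φ z‖ ^ 2 = lam ^ 2 * ‖v z‖ ^ 2 := fun z => by
      rw [norm_smul, mul_pow, Real.norm_eq_abs, sq_abs]
    simp_rw [e]
    rwa [integral_const_mul]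
  · refine hle (b := c / δ + 4 / δ) ?_ (by rw [hC]; linarith)
    have j1 : Integrable fun z => lam * ‖sd i v z‖ ^ 2 := (hvt.dv _).normSq_integrable.const_mul _
    have j2 : Integrable fun z => lam * ‖φ z‖ ^ 2 := hφ.normSq_integrable.const_mul _
    have j12 : Integrable fun z => lam * ‖sd i v z‖ ^ 2 + lam * ‖φ z‖ ^ 2 := j1.add j2
    have h2 : IsTest fun z => √lam • z.2 0 • sd i φ z :=
      ((hφ.dv _).smul_left (contDiff_spaceCoord 0)).smul_left contDiff_const
    have h3 : ∫ z in timeSet d T, ‖√lam • z.2 0 • sd i φ z‖ ^ 2 ≤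
        ∫ z in timeSet d T, 2 * (lam * ‖sd i v z‖ ^ 2 + lam * ‖φ z‖ ^ 2) := by
      refine integral_mono h2.normSq_integrable.restrict (j12.const_mul 2).restrict fun z => ?_
      have e : z.2 0 • sd i φ z = sd i v z + (if 0 = i then (1 : ℝ) else 0) • -φ z := by
        rw [sd_smul_spaceCoord hφ, smul_neg]
        abel
      simp only
      rw [norm_smul, mul_pow, Real.norm_eq_abs, sq_abs, Real.sq_sqrt hlam, e, ← mul_add,
        mul_left_comm]
      refine mul_le_mul_of_nonneg_left ?_ hlam
      have a1 := ite_smul_norm_sq_le (0 = i) (-φ z)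
      rw [norm_neg] at a1
      refine (pow_le_pow_left₀ (norm_nonneg _) (norm_add_le _ _) 2).trans (add_sq_le.trans ?_)
      linarith
    rw [integral_const_mul, integral_add j1.restrict j2.restrict, integral_const_mul,
      integral_const_mul] at h3
    have := hY1 i
    have e2 : (c / δ + 4 / δ) * F = 2 * (c / (2 * δ) * F + 2 / δ * F) := by ring
    rw [e2]
    linarith

end Estimate

/-! ### The adjoint problem and density of the range -/

section ProductTest

variable {d d₁ : ℕ} {χ : ℝ → ℝ} {η : EuclideanSpace ℝ (Fin d) → ℝ}

lemma sd_prod_mul (hχ : IsTest χ) (hη : IsTest η) (i : Fin d) :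
    sd i (fun z : SpaceTime d => χ z.1 * η z.2) = fun z => χ z.1 * pd i η z.2 := by
  ext1 z
  have h1 := congrFun (pd_slice (hχ.prod_mul hη).differentiable i z.1) z.2
  have h2 := congrFun (dv_const_smul (χ z.1) hη.differentiable (EuclideanSpace.single i 1)) z.2
  exact h1.symm.trans h2

lemma td_prod_mul (hχ : IsTest χ) (hη : IsTest η) :
    td (fun z : SpaceTime d => χ z.1 * η z.2) = fun z => deriv χ z.1 * η z.2 := by
  ext1 z
  have h1 := hasDerivAt_timeSlice (hχ.prod_mul hη).differentiable z.1 z.2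
  exact h1.unique ((hχ.differentiable z.1).hasDerivAt.mul_const (η z.2))

lemma dv_smul_const {X F : Type*} [NormedAddCommGroup X] [NormedSpace ℝ X] [NormedAddCommGroup F]
    [NormedSpace ℝ F] {a : X → ℝ} (ha : Differentiable ℝ a) (y : F) (v : X) :
    dv v (fun x => a x • y) = fun x => dv v a x • y :=
  dv_clm ((ContinuousLinearMap.id ℝ ℝ).smulRight y) ha v

lemma IsTest.comp_neg (hχ : IsTest χ) : IsTest fun t => χ (-t) :=
  ⟨hχ.smooth.comp contDiff_neg, hχ.compact.comp_homeomorph (Homeomorph.neg ℝ)⟩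

/-- The operator on a time-reversed product: with adjoint coefficients this is the expression that
occurs in `weakIntegrand` for the adjoint problem. -/
lemma parabolicOp_prod {L : ℝ → Fin d → Fin d → Val d₁ →L[ℂ] Val d₁} {lam : ℝ} (hχ : IsTest χ)
    (hη : IsTest η) (y : Val d₁) (z : SpaceTime d) :
    parabolicOp L lam (fun z : SpaceTime d => (χ (-z.1) * η z.2) • y) z =
      (deriv χ (-z.1) * η z.2) • y +
        ∑ i, ∑ j, (χ (-z.1) * pd i (pd j η) z.2) • L z.1 i j y - (lam * (χ (-z.1) * η z.2)) • y := by
  have hχ' := hχ.comp_neg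
  have e1 : td (fun z : SpaceTime d => (χ (-z.1) * η z.2) • y) z =
      -((deriv χ (-z.1) * η z.2) • y) := by
    rw [td, dv_smul_const (hχ'.prod_mul hη).differentiable]
    have := congrFun (td_prod_mul hχ' hη) z
    rw [td] at this
    simp only [this, deriv_comp_neg, neg_mul, neg_smul]
  have e2 : ∀ i j, sd i (sd j (fun z : SpaceTime d => (χ (-z.1) * η z.2) • y)) z =
      (χ (-z.1) * pd i (pd j η) z.2) • y := by
    intro i j
    have h1 : sd j (fun z : SpaceTime d => (χ (-z.1) * η z.2) • y) =
        fun z => (χ (-z.1) * pd j η z.2) • y := by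
      rw [sd, dv_smul_const (hχ'.prod_mul hη).differentiable, ← sd, sd_prod_mul hχ' hη]
    rw [h1, sd, dv_smul_const (hχ'.prod_mul (hη.dv _)).differentiable]
    exact congrArg (· • y) (congrFun (sd_prod_mul hχ' (hη.dv _) i) z)
  simp only [parabolicOp, e1, e2, neg_neg, smul_smul,
    fun i j => (L z.1 i j).map_smul_of_tower (χ (-z.1) * pd i (pd j η) z.2) y]

end ProductTest

section Adjoint

variable {d d₁ : ℕ} {δ K : ℝ} {L : ℝ → Fin d → Fin d → Val d₁ →L[ℂ] Val d₁}

lemma real_inner_adjoint_right (B : Val d₁ →L[ℂ] Val d₁) (x y : Val d₁) :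
    inner ℝ x (ContinuousLinearMap.adjoint B y) = inner ℝ (B x) y := by
  rw [real_inner_eq_re, real_inner_eq_re, ContinuousLinearMap.adjoint_inner_right]

/-- The coefficients of the adjoint problem after the reversal of time. -/
lemma IsParabolic.adjoint_neg (hL : IsParabolic δ K L) :
    IsParabolic δ K fun t i j => ContinuousLinearMap.adjoint (L (-t) i j) where
  meas i j := ContinuousLinearMap.adjoint.continuous.comp_aestronglyMeasurable
    ((hL.meas i j).comp_measurePreserving (Measure.measurePreserving_neg volume))
  bound t i j := by
    rw [LinearIsometryEquiv.norm_map]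
    exact hL.bound _ _ _
  ell t ξ θ := by
    simp only [real_inner_adjoint_right, real_inner_comm θ]
    exact hL.ell (-t) ξ θ

end Adjoint

section Density

variable {d d₁ : ℕ} {δ K : ℝ} {L : ℝ → Fin d → Fin d → Val d₁ →L[ℂ] Val d₁} {lam : ℝ}

lemma parabolicOp_add {φ ψ : SpaceTime d → Val d₁} (hφ : IsTest φ) (hψ : IsTest ψ)
    (z : SpaceTime d) : parabolicOp L lam (fun z => φ z + ψ z) z =
      parabolicOp L lam φ z + parabolicOp L lam ψ z := by
  have e : ∀ i j, sd i (sd j fun z => φ z + ψ z) =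
      fun z => sd i (sd j φ) z + sd i (sd j ψ) z := fun i j => by
    rw [sd, sd, dv_add hφ.differentiable hψ.differentiable,
      dv_add (hφ.dv _).differentiable (hψ.dv _).differentiable]
  have e2 : td (fun z => φ z + ψ z) = fun z => td φ z + td ψ z :=
    dv_add hφ.differentiable hψ.differentiable _
  simp only [parabolicOp, e, e2, map_add, Finset.sum_add_distrib, smul_add]
  abel

lemma parabolicOp_const_smul {φ : SpaceTime d → Val d₁} (hφ : IsTest φ) (c : ℝ)
    (z : SpaceTime d) : parabolicOp L lam (fun z => c • φ z) z = c • parabolicOp L lam φ z := by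
  have e : ∀ i j, sd i (sd j fun z => c • φ z) = fun z => c • sd i (sd j φ) z := fun i j => by
    rw [sd, sd, dv_const_smul _ hφ.differentiable, dv_const_smul _ (hφ.dv _).differentiable]
  have e2 : td (fun z => c • φ z) = fun z => c • td φ z := dv_const_smul _ hφ.differentiable _
  simp only [parabolicOp, e, e2, fun i j (y : Val d₁) => (L z.1 i j).map_smul_of_tower c y,
    smul_sub, smul_add, Finset.smul_sum, smul_neg, smul_comm c lam]

variable [NeZero d]

/-- The test functions with support in the half space. -/
structure IsHalfTest (φ : SpaceTime d → Val d₁) : Prop extends IsTest φ where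
  supp : tsupport φ ⊆ {z | 0 < z.2 0}

lemma IsHalfTest.const_smul {φ : SpaceTime d → Val d₁} (hφ : IsHalfTest φ) (c : ℝ) :
    IsHalfTest fun z => c • φ z := by
  have h1 : IsTest fun z => c • φ z := hφ.toIsTest.smul_left (a := fun _ => c) contDiff_const
  have h2 : Function.support (fun z => c • φ z) ⊆ Function.support φ :=
    Function.support_const_smul_subset c φ
  exact ⟨h1, (closure_mono h2).trans hφ.supp⟩

lemma measurableSet_halfCylinder (T : WithTop ℝ) : MeasurableSet (halfCylinder d T) :=
  (((isOpen_lt_coe T).preimage continuous_fst).inter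
    (isOpen_lt continuous_const (contDiff_spaceCoord (0 : Fin d)).continuous)).measurableSet

/-- The image of the test functions under `M` composed with the operator, as a subspace of
`L²`. -/
def rangeOp (L : ℝ → Fin d → Fin d → Val d₁ →L[ℂ] Val d₁) (lam : ℝ) (T : WithTop ℝ) :
    Submodule ℝ (Lp (Val d₁) 2 (cylMeasure d T)) where
  carrier := {g | ∃ φ, IsHalfTest φ ∧
    g =ᵐ[cylMeasure d T] fun z => z.2 0 • parabolicOp L lam φ z}
  add_mem' := by
    rintro g h ⟨φ, hφ, hg⟩ ⟨ψ, hψ, hh⟩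
    refine ⟨fun z => φ z + ψ z, ⟨hφ.toIsTest.add hψ.toIsTest, (tsupport_add φ ψ).trans
      (Set.union_subset hφ.supp hψ.supp)⟩, ?_⟩
    filter_upwards [hg, hh, Lp.coeFn_add g h] with z h1 h2 h3
    rw [h3, Pi.add_apply, h1, h2, parabolicOp_add hφ.toIsTest hψ.toIsTest, smul_add]
  zero_mem' := by
    have h0 : IsHalfTest (fun _ : SpaceTime d => (0 : Val d₁)) :=
      ⟨⟨contDiff_const, HasCompactSupport.intro isCompact_empty fun _ _ => rfl⟩, by
        have : tsupport (fun _ : SpaceTime d => (0 : Val d₁)) = ∅ := tsupport_eq_empty_iff.2 rfl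
        rw [this]; exact Set.empty_subset _⟩
    refine ⟨_, h0, ?_⟩
    filter_upwards [Lp.coeFn_zero (Val d₁) 2 (cylMeasure d T)] with z hz
    have := parabolicOp_const_smul (L := L) (lam := lam) h0.toIsTest 0 z
    simp only [smul_zero, zero_smul] at this
    rw [hz, this, smul_zero, Pi.zero_apply]
  smul_mem' := by
    rintro c g ⟨φ, hφ, hg⟩
    refine ⟨fun z => c • φ z, hφ.const_smul c, ?_⟩
    filter_upwards [hg, Lp.coeFn_smul c g] with z h1 h2
    rw [h2, Pi.smul_apply, h1, parabolicOp_const_smul hφ.toIsTest, smul_comm]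

lemma spaceCoord_smul_parabolicOp_memLp_cyl (hL : IsParabolic δ K L) {φ : SpaceTime d → Val d₁}
    (hφ : IsTest φ) (T : WithTop ℝ) :
    MemLp (fun z => z.2 0 • parabolicOp L lam φ z) 2 (cylMeasure d T) :=
  (spaceCoord_smul_parabolicOp_memLp hL hφ).restrict _

/-- The range is dense: a function `w` orthogonal to it, multiplied by `x_1`, extended by zero and
with time reversed, is a very weak solution of the adjoint problem on `ℝ × ℝ^d_+`. It vanishes by
`ae_eq_zero_of_weakIntegrand`. -/
theorem rangeOp_topologicalClosure (hδ : 0 < δ) (hL : IsParabolic δ K L) (hlam : 0 ≤ lam)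
    (T : WithTop ℝ) : (rangeOp L lam T).topologicalClosure = ⊤ := by
  rw [Submodule.topologicalClosure_eq_top_iff, Submodule.eq_bot_iff]
  intro w hw
  have hw' : ∀ φ, IsHalfTest φ →
      ∫ z in halfCylinder d T, inner ℝ (z.2 0 • parabolicOp L lam φ z) (w z) = 0 := by
    intro φ hφ
    have hm := spaceCoord_smul_parabolicOp_memLp_cyl (lam := lam) hL hφ.toIsTest T
    have h1 := (Submodule.mem_orthogonal _ _).1 hw (hm.toLp _) ⟨φ, hφ, hm.coeFn_toLp⟩
    rw [L2.inner_def] at h1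
    rw [← h1]
    refine integral_congr_ae ?_
    filter_upwards [hm.coeFn_toLp] with z hz
    rw [hz]
  have hwm : StronglyMeasurable w := Lp.stronglyMeasurable w
  have hH := measurableSet_halfCylinder (d := d) T
  set R : SpaceTime d → SpaceTime d := fun z => (-z.1, z.2) with hR
  have hRm : MeasurePreserving R volume volume :=
    (Measure.measurePreserving_neg (volume : Measure ℝ)).prod (MeasurePreserving.id volume)
  have hRe : MeasurableEmbedding R :=
    ((Homeomorph.neg ℝ).prodCongr (Homeomorph.refl _)).measurableEmbedding
  have hRR : ∀ z, R (R z) = z := fun z => by simp [hR]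
  set q : SpaceTime d → Val d₁ := fun z => (halfCylinder d T).indicator w (R z) with hq
  set v : SpaceTime d → Val d₁ := fun z => z.2 0 • q z with hv
  have hqm : StronglyMeasurable q := (hwm.indicator hH).comp_measurable hRm.measurable
  have hvm : StronglyMeasurable v :=
    (contDiff_spaceCoord (0 : Fin d)).continuous.stronglyMeasurable.smul hqm
  have hq0 : ∀ z : SpaceTime d, ¬ 0 < z.2 0 → q z = 0 := fun z hz =>
    Set.indicator_of_notMem (fun h => hz h.2) _
  have hqL : MemLp q 2 := by
    have : MemLp ((halfCylinder d T).indicator w) 2 := (memLp_indicator_iff_restrict hH).2 (Lp.memLp w)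
    exact this.comp_measurePreserving hRm
  have hqv : ∀ z : SpaceTime d, (z.2 0)⁻¹ • v z = q z := fun z => by
    by_cases hz : 0 < z.2 0
    · rw [hv, inv_smul_smul₀ hz.ne']
    · simp [hv, hq0 z hz]
  have key := ae_eq_zero_of_weakIntegrand hδ hL.adjoint_neg hlam (T := ⊤) hvm
    (hqL.ae_eq (ae_of_all _ fun z => (hqv z).symm)) (fun z hz => by simp [hv, hq0 z hz])
    (fun χ η hχ hη _ hηs => ?_)
  · -- so `v` vanishes, and with it `w`
    have h1 : ∀ᵐ z, q z = 0 := by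
      filter_upwards [key] with z hz
      rw [← hqv, hz (WithTop.coe_lt_top _), smul_zero]
    have h2 : ∀ᵐ z, (halfCylinder d T).indicator w z = 0 := by
      filter_upwards [hRm.quasiMeasurePreserving.ae h1] with z hz
      simpa only [hq, hRR] using hz
    rw [Lp.ext_iff]
    filter_upwards [Lp.coeFn_zero (Val d₁) 2 (cylMeasure d T),
      (ae_restrict_iff' hH).2 (h2.mono fun z hz hz' => by
        rwa [Set.indicator_of_mem hz'] at hz : ∀ᵐ z, z ∈ halfCylinder d T → w z = 0)] with z e1 e2
    rw [e1, e2, Pi.zero_apply]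
  · -- the weak formulation for the adjoint problem
    -- without integrability the integral is `0` by convention
    by_cases hi : Integrable (weakIntegrand
      (fun t i j => ContinuousLinearMap.adjoint (L (-t) i j)) lam χ η v)
    swap
    · exact integral_undef hi
    refine ext_inner_left ℝ fun y => ?_
    rw [inner_zero_right, ← integral_inner hi]
    have hφ : IsHalfTest fun z : SpaceTime d => (χ (-z.1) * η z.2) • y := by
      refine ⟨(hχ.comp_neg.prod_mul hη).smul_right contDiff_const, ?_⟩
      refine Set.Subset.trans ?_ ((tsupport_comp_subset_preimage η continuous_snd).trans
        (Set.preimage_mono hηs))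
      refine closure_mono fun z hz => ?_
      simp only [Function.mem_support, ne_eq, smul_eq_zero, mul_eq_zero, not_or] at hz
      exact hz.1.2
    rw [← hw' _ hφ, ← integral_indicator hH]
    symm
    rw [← hRm.integral_comp hRe]
    refine integral_congr_ae (ae_of_all _ fun z => ?_)
    have e0 : (halfCylinder d T).indicator (fun z : SpaceTime d => inner ℝ
        (z.2 0 • parabolicOp L lam (fun z : SpaceTime d => (χ (-z.1) * η z.2) • y) z) (w z)) (R z) =
        inner ℝ (parabolicOp L lam (fun z : SpaceTime d => (χ (-z.1) * η z.2) • y) (R z)) (v z) := by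
      by_cases hz : R z ∈ halfCylinder d T
      · rw [Set.indicator_of_mem hz, hv, hq, real_inner_smul_left, real_inner_smul_right]
        simp only [Set.indicator_of_mem hz]
        rfl
      · rw [Set.indicator_of_notMem hz, hv, hq]
        simp only [Set.indicator_of_notMem hz]
        simp
    simp only
    rw [e0, parabolicOp_prod hχ hη]
    simp only [hR, neg_neg, weakIntegrand, inner_sub_left, inner_sub_right, inner_add_left,
      inner_add_right, sum_inner, inner_sum, real_inner_smul_left, real_inner_smul_right,
      real_inner_adjoint_right]

end Density

/-! ### Limits of test functions -/

section Limits

variable {d d₁ : ℕ} {δ K : ℝ} {L : ℝ → Fin d → Fin d → Val d₁ →L[ℂ] Val d₁} {lam : ℝ}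

lemma parabolicOp_eq_zero {φ : SpaceTime d → Val d₁} {z : SpaceTime d} (hz : z ∉ tsupport φ) :
    parabolicOp L lam φ z = 0 := by
  have h0 : φ z = 0 := image_eq_zero_of_notMem_tsupport hz
  have h1 : td φ z = 0 := image_eq_zero_of_notMem_tsupport fun h => hz (tsupport_dv_subset _ _ h)
  have h2 : ∀ i j, sd i (sd j φ) z = 0 := fun i j => image_eq_zero_of_notMem_tsupport
    fun h => hz (tsupport_dv_subset _ _ (tsupport_dv_subset _ _ h))
  simp [parabolicOp, h0, h1, h2]

variable [NeZero d]

lemma cylMeasure_eq_restrict (T : WithTop ℝ) : cylMeasure d T =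
    ((volume : Measure (SpaceTime d)).restrict (timeSet d T)).restrict {z | 0 < z.2 0} := by
  have : MeasurableSet {z : SpaceTime d | 0 < z.2 0} :=
    (isOpen_lt continuous_const (contDiff_spaceCoord (0 : Fin d)).continuous).measurableSet
  rw [Measure.restrict_restrict this, Set.inter_comm]
  rfl

lemma mulM_one {F : Type*} [AddCommGroup F] [Module ℝ F] (g : SpaceTime d → F) :
    mulM 1 g = fun z => z.2 0 • g z := by
  funext z; simp [mulM]

lemma mulM_neg_one {F : Type*} [AddCommGroup F] [Module ℝ F] (g : SpaceTime d → F) :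
    mulM (-1) g = fun z => (z.2 0)⁻¹ • g z := by
  funext z; simp [mulM]

lemma IsHalfTest.sub {φ ψ : SpaceTime d → Val d₁} (hφ : IsHalfTest φ) (hψ : IsHalfTest ψ) :
    IsHalfTest fun z => φ z - ψ z := by
  refine ⟨hφ.toIsTest.sub hψ.toIsTest, (closure_minimal ?_ ((isClosed_tsupport φ).union
    (isClosed_tsupport ψ))).trans (Set.union_subset hφ.supp hψ.supp)⟩
  intro z hz
  by_contra h
  rw [Set.mem_union, not_or] at h
  exact hz (by simp [image_eq_zero_of_notMem_tsupport h.1, image_eq_zero_of_notMem_tsupport h.2])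

lemma parabolicOp_sub {φ ψ : SpaceTime d → Val d₁} (hφ : IsTest φ) (hψ : IsTest ψ) :
    mulM 1 (parabolicOp L lam fun z => φ z - ψ z) =
      mulM 1 (parabolicOp L lam φ) - mulM 1 (parabolicOp L lam ψ) := by
  funext z
  have h1 : IsTest fun z => (-1 : ℝ) • ψ z := hψ.smul_left (a := fun _ => -1) contDiff_const
  have h2 := parabolicOp_add (L := L) (lam := lam) hφ h1 z
  rw [parabolicOp_const_smul hψ] at h2
  simp only [neg_smul, one_smul, ← sub_eq_add_neg] at h2
  simp only [mulM, h2, Pi.sub_apply, smul_sub]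

/-- The a priori estimate for test functions, in terms of norms on the half space cylinder. -/
theorem exists_eLpNorm_bound (d d₁ : ℕ) [NeZero d] (hδ : 0 < δ) (K : ℝ) : ∃ N : ℝ≥0,
    ∀ L : ℝ → Fin d → Fin d → Val d₁ →L[ℂ] Val d₁, IsParabolic δ K L → ∀ lam : ℝ, 0 ≤ lam →
    ∀ (T : WithTop ℝ) (φ : SpaceTime d → Val d₁), IsHalfTest φ →
    (eLpNorm (mulM (-1) φ) 2 (cylMeasure d T) ≤
      N * eLpNorm (mulM 1 (parabolicOp L lam φ)) 2 (cylMeasure d T)) ∧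
    (∀ i, eLpNorm (sd i φ) 2 (cylMeasure d T) ≤
      N * eLpNorm (mulM 1 (parabolicOp L lam φ)) 2 (cylMeasure d T)) ∧
    (∀ i j, eLpNorm (mulM 1 (sd i (sd j φ))) 2 (cylMeasure d T) ≤
      N * eLpNorm (mulM 1 (parabolicOp L lam φ)) 2 (cylMeasure d T)) ∧
    (eLpNorm (mulM 1 (td φ)) 2 (cylMeasure d T) ≤
      N * eLpNorm (mulM 1 (parabolicOp L lam φ)) 2 (cylMeasure d T)) ∧
    (eLpNorm (lam • mulM 1 φ) 2 (cylMeasure d T) ≤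
      N * eLpNorm (mulM 1 (parabolicOp L lam φ)) 2 (cylMeasure d T)) ∧
    (∀ i, eLpNorm (√lam • mulM 1 (sd i φ)) 2 (cylMeasure d T) ≤
      N * eLpNorm (mulM 1 (parabolicOp L lam φ)) 2 (cylMeasure d T)) := by
  obtain ⟨C, hC, H⟩ := exists_integral_bound (K := K) d d₁ hδ
  refine ⟨Real.toNNReal (√C), fun L hL lam hlam T φ hφ => ?_⟩
  have hp : MemLp (mulM 1 (parabolicOp L lam φ)) 2 (volume.restrict (timeSet d T)) := by
    rw [mulM_one]
    exact (spaceCoord_smul_parabolicOp_memLp hL hφ.toIsTest).restrict _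
  have hsupp : Function.support (mulM 1 (parabolicOp L lam φ)) ⊆ {z | 0 < z.2 0} := by
    intro z hz
    by_contra h
    refine hz ?_
    rw [mulM_one]
    simp only
    rw [parabolicOp_eq_zero fun h' => h (hφ.supp h'), smul_zero]
  have key : ∀ {g : SpaceTime d → Val d₁}, IsTest g →
      ∫ z in timeSet d T, ‖g z‖ ^ 2 ≤
        C * (∫ z in timeSet d T, ‖z.2 0 • parabolicOp L lam φ z‖ ^ 2) →
      eLpNorm g 2 (cylMeasure d T) ≤ ((√C).toNNReal : ℝ≥0∞) *
        eLpNorm (mulM 1 (parabolicOp L lam φ)) 2 (cylMeasure d T) := by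
    intro g hg h
    rw [cylMeasure_eq_restrict, eLpNorm_restrict_eq_of_support_subset hsupp]
    refine (eLpNorm_mono_measure _ Measure.restrict_le_self).trans ?_
    refine eLpNorm_two_le_of_integral_sq_le ((hg.memLp 2).restrict _) hp hC ?_
    rwa [mulM_one]
  obtain ⟨h1, h2, h3, h4, h5, h6⟩ := H L hL lam hlam T φ hφ.toIsTest hφ.supp
  have hx : ContDiff ℝ ∞ fun z : SpaceTime d => z.2 0 := contDiff_spaceCoord 0
  simp only [mulM_one, mulM_neg_one] at key ⊢
  exact ⟨key (hφ.toIsTest.inv_spaceCoord_smul hφ.supp) h1, fun i => key (hφ.toIsTest.dv _) (h2 i),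
    fun i j => key (((hφ.toIsTest.dv _).dv _).smul_left hx) (h3 i j),
    key ((hφ.toIsTest.dv _).smul_left hx) h4,
    key ((hφ.toIsTest.smul_left hx).smul_left (a := fun _ => lam) contDiff_const) h5,
    fun i => key (((hφ.toIsTest.dv _).smul_left hx).smul_left (a := fun _ => √lam) contDiff_const)
      (h6 i)⟩

/-- The right-hand side is approximated at a geometric rate, so that the sequence converges almost
everywhere without passing to subsequences. -/
lemma exists_approx (hδ : 0 < δ) (hL : IsParabolic δ K L) (hlam : 0 ≤ lam)
    {T : WithTop ℝ} {f : SpaceTime d → Val d₁} (hf : MemLp (mulM 1 f) 2 (cylMeasure d T)) :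
    ∃ φ : ℕ → SpaceTime d → Val d₁, (∀ n, IsHalfTest (φ n)) ∧
      ∀ n, eLpNorm (mulM 1 (parabolicOp L lam (φ n)) - mulM 1 f) 2 (cylMeasure d T) <
        (1 / 2 : ℝ≥0∞) ^ (n + 1) := by
  have h1 : ∀ n : ℕ, ∃ φ : SpaceTime d → Val d₁, IsHalfTest φ ∧
      eLpNorm (mulM 1 (parabolicOp L lam φ) - mulM 1 f) 2 (cylMeasure d T) <
        (1 / 2 : ℝ≥0∞) ^ (n + 1) := by
    intro n
    have h2 : hf.toLp ∈ closure (rangeOp L lam T : Set (Lp (Val d₁) 2 (cylMeasure d T))) := by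
      rw [← Submodule.topologicalClosure_coe, rangeOp_topologicalClosure hδ hL hlam T]
      trivial
    rw [EMetric.mem_closure_iff] at h2
    obtain ⟨g, ⟨φ, hφ, hg⟩, hg2⟩ := h2 ((1 / 2 : ℝ≥0∞) ^ (n + 1)) (by
      exact ENNReal.pow_pos (by norm_num) _)
    refine ⟨φ, hφ, ?_⟩
    rw [edist_comm, Lp.edist_def] at hg2
    refine lt_of_eq_of_lt (eLpNorm_congr_ae ?_) hg2
    filter_upwards [hg, hf.coeFn_toLp] with z e1 e2
    rw [Pi.sub_apply, Pi.sub_apply, e1, e2, mulM_one]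
  choose φ h h' using h1
  exact ⟨φ, h, h'⟩

/-- An operator `D` on test functions that is bounded by `M (parabolicOp L lam φ)` converges along
the approximating sequence, in norm and almost everywhere, and the bound is inherited by the limit.
-/
lemma exists_limit_of_bound {T : WithTop ℝ} {N : ℝ≥0} {D : (SpaceTime d → Val d₁) → SpaceTime d → Val d₁}
    (hsub : ∀ φ ψ, IsHalfTest φ → IsHalfTest ψ → D (fun z => φ z - ψ z) = D φ - D ψ)
    (hm : ∀ φ, IsHalfTest φ → MemLp (D φ) 2 (cylMeasure d T))
    (hb : ∀ φ, IsHalfTest φ → eLpNorm (D φ) 2 (cylMeasure d T) ≤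
      N * eLpNorm (mulM 1 (parabolicOp L lam φ)) 2 (cylMeasure d T))
    (hL : IsParabolic δ K L)
    {f : SpaceTime d → Val d₁} (hf : MemLp (mulM 1 f) 2 (cylMeasure d T))
    {φ : ℕ → SpaceTime d → Val d₁} (hφ : ∀ n, IsHalfTest (φ n))
    (hφf : ∀ n, eLpNorm (mulM 1 (parabolicOp L lam (φ n)) - mulM 1 f) 2 (cylMeasure d T) <
        (1 / 2 : ℝ≥0∞) ^ (n + 1)) :
    ∃ a, MemLp a 2 (cylMeasure d T) ∧
      Tendsto (fun n => eLpNorm (D (φ n) - a) 2 (cylMeasure d T)) atTop (𝓝 0) ∧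
      (∀ᵐ z ∂cylMeasure d T, Tendsto (fun n => D (φ n) z) atTop (𝓝 (a z))) ∧
      eLpNorm a 2 (cylMeasure d T) ≤ N * eLpNorm (mulM 1 f) 2 (cylMeasure d T) := by
  set g : ℕ → SpaceTime d → Val d₁ := fun n => mulM 1 (parabolicOp L lam (φ n)) with hg
  have hgm : ∀ n, MemLp (g n) 2 (cylMeasure d T) := fun n => by
    rw [hg]
    simp only [mulM_one]
    exact spaceCoord_smul_parabolicOp_memLp_cyl hL (hφ n).toIsTest T
  have hhalf : (1 / 2 : ℝ≥0∞) ≤ 1 := by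
    rw [one_div]; exact ENNReal.inv_le_one.2 (by norm_num)
  have hgc : ∀ M n m, M ≤ n → M ≤ m → eLpNorm (g n - g m) 2 (cylMeasure d T) <
      (1 / 2 : ℝ≥0∞) ^ M := by
    intro M n m hn hm'
    have e : g n - g m = (g n - mulM 1 f) - (g m - mulM 1 f) := by abel
    rw [e]
    refine (eLpNorm_sub_le ((hgm n).1.sub hf.1) ((hgm m).1.sub hf.1) (by norm_num)).trans_lt ?_
    have h1 : ∀ k, M ≤ k → eLpNorm (g k - mulM 1 f) 2 (cylMeasure d T) < (1 / 2) ^ (M + 1) :=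
      fun k hk => (hφf k).trans_le (pow_le_pow_right_of_le_one' hhalf (by omega))
    refine (ENNReal.add_lt_add (h1 n hn) (h1 m hm')).trans_eq ?_
    rw [pow_succ, ← mul_add, one_div, ENNReal.inv_two_add_inv_two, mul_one]
  set B : ℕ → ℝ≥0∞ := fun M => (N + 1) * (1 / 2 : ℝ≥0∞) ^ M with hB
  have hBs : ∑' i, B i ≠ ⊤ := by
    rw [hB, ENNReal.tsum_mul_left, ENNReal.tsum_geometric, one_div, ENNReal.one_sub_inv_two, inv_inv]
    exact ENNReal.mul_ne_top (by simp) (by simp)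
  have hDm := fun n => hm _ (hφ n)
  have hDc : ∀ M n m, M ≤ n → M ≤ m →
      eLpNorm (D (φ n) - D (φ m)) 2 (cylMeasure d T) < B M := by
    intro M n m hn hm'
    have h1 := hb _ ((hφ n).sub (hφ m))
    rw [hsub _ _ (hφ n) (hφ m), parabolicOp_sub (hφ n).toIsTest (hφ m).toIsTest] at h1
    calc _ ≤ N * eLpNorm (g n - g m) 2 (cylMeasure d T) := h1
      _ ≤ (N + 1) * eLpNorm (g n - g m) 2 (cylMeasure d T) := by gcongr; exact le_self_add
      _ < (N + 1) * (1 / 2 : ℝ≥0∞) ^ M :=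
        ENNReal.mul_lt_mul_right (by simp) (by simp) (hgc M n m hn hm')
  obtain ⟨a, ham, ha⟩ := exists_stronglyMeasurable_limit_of_tendsto_ae (fun n => (hDm n).1)
    (Lp.ae_tendsto_of_cauchy_eLpNorm (fun n => (hDm n).1) (by norm_num) hBs hDc)
  have hconv := Lp.cauchy_tendsto_of_tendsto (fun n => (hDm n).1) a hBs hDc ha
  have hpow : Tendsto (fun n : ℕ => (1 / 2 : ℝ≥0∞) ^ (n + 1)) atTop (𝓝 0) := by
    refine (tendsto_add_atTop_iff_nat 1).2 (ENNReal.tendsto_pow_atTop_nhds_zero_of_lt_one ?_)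
    rw [one_div]; exact ENNReal.inv_lt_one.2 (by norm_num)
  have hbound : eLpNorm a 2 (cylMeasure d T) ≤ N * eLpNorm (mulM 1 f) 2 (cylMeasure d T) := by
    have h2 : Tendsto (fun n : ℕ => eLpNorm (D (φ n) - a) 2 (cylMeasure d T) +
        N * ((1 / 2 : ℝ≥0∞) ^ (n + 1) + eLpNorm (mulM 1 f) 2 (cylMeasure d T))) atTop
        (𝓝 (0 + N * (0 + eLpNorm (mulM 1 f) 2 (cylMeasure d T)))) :=
      hconv.add (ENNReal.Tendsto.const_mul (hpow.add tendsto_const_nhds) (Or.inr (by simp)))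
    rw [zero_add, zero_add] at h2
    refine ge_of_tendsto' h2 fun n => ?_
    have e1 : a = D (φ n) - (D (φ n) - a) := by abel
    have e2 : g n = (g n - mulM 1 f) + mulM 1 f := by abel
    calc eLpNorm a 2 (cylMeasure d T)
        = eLpNorm (D (φ n) - (D (φ n) - a)) 2 (cylMeasure d T) := by rw [← e1]
      _ ≤ eLpNorm (D (φ n)) 2 (cylMeasure d T) + eLpNorm (D (φ n) - a) 2 (cylMeasure d T) :=
        eLpNorm_sub_le (hDm n).1 ((hDm n).1.sub ham.aestronglyMeasurable) (by norm_num)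
      _ ≤ N * eLpNorm (g n) 2 (cylMeasure d T) + eLpNorm (D (φ n) - a) 2 (cylMeasure d T) := by
        gcongr
        exact hb _ (hφ n)
      _ ≤ _ := by
        rw [add_comm]
        gcongr
        rw [e2]
        refine (eLpNorm_add_le ((hgm n).1.sub hf.1) hf.1 (by norm_num)).trans ?_
        gcongr
        exact (hφf n).le
  exact ⟨a, ⟨ham.aestronglyMeasurable, hbound.trans_lt (ENNReal.mul_lt_top (by simp) hf.2)⟩,
    hconv, ha, hbound⟩

end Limits

/-! ### Weak derivatives -/

section WeakDerivative

variable {d d₁ : ℕ}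

lemma integrable_smul_of_tsupport_subset {Ω : Set (SpaceTime d)} {g : SpaceTime d → Val d₁}
    (hg : LocallyIntegrableOn g Ω) {ψ : SpaceTime d → ℝ} (hψ : Continuous ψ)
    (hc : HasCompactSupport ψ) (hs : tsupport ψ ⊆ Ω) : Integrable fun z => ψ z • g z := by
  have h1 := (hg.integrableOn_compact_subset hs hc).continuousOn_smul (f := ψ) hψ.continuousOn hc
  refine (integrableOn_iff_integrable_of_support_subset ?_).1 h1
  exact (Function.support_smul_subset_left ψ g).trans (subset_tsupport ψ)

lemma setIntegral_smul_eq_of_tsupport_subset {Ω : Set (SpaceTime d)} {ψ : SpaceTime d → ℝ}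
    (hs : tsupport ψ ⊆ Ω) (g : SpaceTime d → Val d₁) :
    ∫ z in Ω, ψ z • g z = ∫ z, ψ z • g z :=
  setIntegral_eq_integral_of_forall_compl_eq_zero fun z hz => by
    rw [image_eq_zero_of_notMem_tsupport fun h => hz (hs h), zero_smul]

/-- Weak derivatives are unique up to null sets. -/
lemma HasWeakDeriv.ae_eq {Ω : Set (SpaceTime d)} (hΩ : IsOpen Ω) {V : SpaceTime d}
    {u g g' : SpaceTime d → Val d₁} (h : HasWeakDeriv Ω V u g) (h' : HasWeakDeriv Ω V u g') :
    g =ᵐ[volume.restrict Ω] g' := by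
  have key := hΩ.ae_eq_zero_of_integral_contDiff_smul_eq_zero (h.2.1.sub h'.2.1)
    fun ψ hψ hc hs => ?_
  · rw [Filter.EventuallyEq, ae_restrict_iff' hΩ.measurableSet]
    filter_upwards [key] with z hz hz'
    exact sub_eq_zero.1 (hz hz')
  · have e1 := h.2.2 ψ hψ hc hs
    have e2 := h'.2.2 ψ hψ hc hs
    rw [e1, neg_inj, setIntegral_smul_eq_of_tsupport_subset hs,
      setIntegral_smul_eq_of_tsupport_subset hs] at e2
    simp only [Pi.sub_apply, smul_sub]
    rw [integral_sub (integrable_smul_of_tsupport_subset h.2.1 hψ.continuous hc hs)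
      (integrable_smul_of_tsupport_subset h'.2.1 hψ.continuous hc hs), e2, sub_self]

lemma LocallyIntegrableOn.congr_ae {X E : Type*} [TopologicalSpace X] [MeasurableSpace X]
    [NormedAddCommGroup E] {μ : Measure X} {Ω : Set X}
    {f g : X → E}
    (hf : LocallyIntegrableOn f Ω μ) (h : f =ᵐ[μ.restrict Ω] g) : LocallyIntegrableOn g Ω μ := by
  intro x hx
  obtain ⟨s, hs, hi⟩ := hf x hx
  refine ⟨s ∩ Ω, inter_mem hs self_mem_nhdsWithin, ?_⟩
  exact (hi.mono_set Set.inter_subset_left).congr_fun_ae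
    (ae_restrict_of_ae_restrict_of_subset Set.inter_subset_right h)

lemma HasWeakDeriv.congr {Ω : Set (SpaceTime d)} {V : SpaceTime d}
    {u u' g g' : SpaceTime d → Val d₁} (h : HasWeakDeriv Ω V u g)
    (hu : u =ᵐ[volume.restrict Ω] u') (hg : g =ᵐ[volume.restrict Ω] g') :
    HasWeakDeriv Ω V u' g' := by
  refine ⟨LocallyIntegrableOn.congr_ae h.1 hu,
    LocallyIntegrableOn.congr_ae h.2.1 hg, fun ψ hψ hc hs => ?_⟩
  have e := h.2.2 ψ hψ hc hs
  have e1 : ∫ z in Ω, (fderiv ℝ ψ z V) • u' z = ∫ z in Ω, (fderiv ℝ ψ z V) • u z :=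
    integral_congr_ae (hu.mono fun z hz => by simp only [hz])
  have e2 : ∫ z in Ω, ψ z • g' z = ∫ z in Ω, ψ z • g z :=
    integral_congr_ae (hg.mono fun z hz => by simp only [hz])
  rw [e1, e2, e]

lemma HasSomeWeakDeriv.hasWeakDeriv_weakDeriv {Ω : Set (SpaceTime d)} {V : SpaceTime d}
    {u : SpaceTime d → Val d₁} (h : HasSomeWeakDeriv Ω V u) :
    HasWeakDeriv Ω V u (weakDeriv Ω V u) := by
  rw [weakDeriv, dif_pos h]
  exact Classical.choose_spec h

lemma HasWeakDeriv.weakDeriv_ae_eq {Ω : Set (SpaceTime d)} (hΩ : IsOpen Ω) {V : SpaceTime d}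
    {u g : SpaceTime d → Val d₁} (h : HasWeakDeriv Ω V u g) :
    _root_.weakDeriv Ω V u =ᵐ[volume.restrict Ω] g :=
  (HasSomeWeakDeriv.hasWeakDeriv_weakDeriv ⟨g, h⟩).ae_eq hΩ h

lemma tendsto_integral_smul {α : Type*} [MeasurableSpace α] {μ : Measure α} {ψ : α → ℝ}
    (hψ : MemLp ψ 2 μ) {a : ℕ → α → Val d₁} {A : α → Val d₁} (ha : ∀ n, MemLp (a n) 2 μ)
    (hA : MemLp A 2 μ) (h : Tendsto (fun n => eLpNorm (a n - A) 2 μ) atTop (𝓝 0)) :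
    Tendsto (fun n => ∫ x, ψ x • a n x ∂μ) atTop (𝓝 (∫ x, ψ x • A x ∂μ)) := by
  have hi : ∀ {b : α → Val d₁}, MemLp b 2 μ → MemLp (ψ • b) 1 μ := fun hb => hb.smul hψ
  refine tendsto_integral_of_L1' _ (hi hA).1
    (Eventually.of_forall fun n => memLp_one_iff_integrable.1 (hi (ha n))) ?_
  refine tendsto_of_tendsto_of_tendsto_of_le_of_le (h := fun n => eLpNorm ψ 2 μ *
    eLpNorm (a n - A) 2 μ) tendsto_const_nhds ?_ (fun _ => zero_le) fun n => ?_
  · have := ENNReal.Tendsto.const_mul h (Or.inr hψ.2.ne)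
    rwa [mul_zero] at this
  · have e : (fun x => ψ x • a n x) - (fun x => ψ x • A x) = ψ • (a n - A) := by
      funext x; simp [smul_sub]
    refine le_trans (le_of_eq ?_) (eLpNorm_smul_le_mul_eLpNorm (p := 2) (q := 2) (r := 1)
      ((ha n).1.sub hA.1) hψ.1)
    exact congrArg (fun F => eLpNorm F 1 μ) e

lemma integral_dv_smul {ψ : SpaceTime d → ℝ} {h : SpaceTime d → Val d₁} (hψ : IsTest ψ)
    (hh : IsTest h) (V : SpaceTime d) : ∫ z, dv V ψ z • h z = -∫ z, ψ z • dv V h z := by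
  have hprod : IsTest fun z => ψ z • h z := hψ.smul_right hh.smooth
  have hHaar : (volume : Measure (SpaceTime d)).IsAddHaarMeasure := by
    rw [Measure.volume_eq_prod]
    infer_instance
  have h1 := integral_smul_fderiv_eq_neg_fderiv_smul_of_integrable (μ := volume) (f := ψ) (g := h)
    (v := V) ((hψ.dv V).smul_right hh.smooth).integrable
    (hψ.smul_right (hh.dv V).smooth).integrable hprod.integrable
    (fun x _ => hψ.differentiable x) (fun x _ => hh.differentiable x)
  simp only [dv]
  rw [h1, neg_neg]

variable [NeZero d]

lemma isOpen_halfCylinder (T : WithTop ℝ) : IsOpen (halfCylinder d T) :=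
  ((isOpen_lt_coe T).preimage continuous_fst).inter
    (isOpen_lt continuous_const (contDiff_spaceCoord (0 : Fin d)).continuous)

lemma mulM_mulM {F : Type*} [AddCommGroup F] [Module ℝ F] (k : ℤ) (g : SpaceTime d → F)
    {z : SpaceTime d} (hz : 0 < z.2 0) : mulM (-k) (mulM k g) z = g z := by
  rw [mulM, mulM, smul_smul, ← zpow_add₀ hz.ne', neg_add_cancel, zpow_zero, one_smul]

lemma mulM_mulM_neg {F : Type*} [AddCommGroup F] [Module ℝ F] (k : ℤ) (g : SpaceTime d → F)
    {z : SpaceTime d} (hz : 0 < z.2 0) : mulM k (mulM (-k) g) z = g z := by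
  simpa using mulM_mulM (-k) g hz

lemma ae_cyl_pos (T : WithTop ℝ) : ∀ᵐ z ∂cylMeasure d T, 0 < z.2 0 :=
  ae_restrict_of_forall_mem (measurableSet_halfCylinder T) fun _ hz => hz.2

instance (T : WithTop ℝ) : IsLocallyFiniteMeasure (cylMeasure d T) := by
  unfold cylMeasure
  infer_instance

lemma locallyIntegrableOn_mulM {T : WithTop ℝ} {g : SpaceTime d → Val d₁}
    (hg : MemLp g 2 (cylMeasure d T)) (k : ℤ) :
    LocallyIntegrableOn (mulM k g) (halfCylinder d T) := by
  have h1 : LocallyIntegrableOn g (halfCylinder d T) :=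
    locallyIntegrableOn_of_locallyIntegrable_restrict (hg.locallyIntegrable (by norm_num))
  exact h1.continuousOn_smul (isOpen_halfCylinder T).isLocallyClosed
    (((contDiff_spaceCoord (0 : Fin d)).continuous.continuousOn).zpow₀ k
      fun z hz => Or.inl hz.2.ne')

lemma zpow_mul_memLp {ψ : SpaceTime d → ℝ} (hψ : IsTest ψ) (hs : tsupport ψ ⊆ {z | 0 < z.2 0})
    (k : ℤ) {μ : Measure (SpaceTime d)} [IsFiniteMeasureOnCompacts μ] :
    MemLp (fun z => (z.2 0) ^ k * ψ z) 2 μ := by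
  have hsub : tsupport (fun z : SpaceTime d => (z.2 0) ^ k * ψ z) ⊆ tsupport ψ :=
    closure_mono (Function.support_mul_subset_right _ _)
  refine Continuous.memLp_of_hasCompactSupport ?_ (hψ.compact.mono
    (Function.support_mul_subset_right _ _))
  refine continuous_of_tsupport fun z hz => ?_
  exact ((contDiff_spaceCoord (0 : Fin d)).continuous.continuousAt.zpow₀ k
    (Or.inl (hs (hsub hz)).ne')).mul hψ.continuous.continuousAt

/-- Weak derivatives pass to weighted limits: `A` and `C` are the limits of `M^k h` and `M^l ∂_V h`,
and the weights are absorbed by the test function, which is supported away from the boundary. -/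
lemma hasWeakDeriv_of_tendsto {T : WithTop ℝ} {h : ℕ → SpaceTime d → Val d₁}
    (hh : ∀ n, IsTest (h n)) (V : SpaceTime d) (k l : ℤ) {A C : SpaceTime d → Val d₁}
    (hk : ∀ n, MemLp (mulM k (h n)) 2 (cylMeasure d T))
    (hl : ∀ n, MemLp (mulM l (dv V (h n))) 2 (cylMeasure d T))
    (hA : MemLp A 2 (cylMeasure d T)) (hC : MemLp C 2 (cylMeasure d T))
    (hAt : Tendsto (fun n => eLpNorm (mulM k (h n) - A) 2 (cylMeasure d T)) atTop (𝓝 0))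
    (hCt : Tendsto (fun n => eLpNorm (mulM l (dv V (h n)) - C) 2 (cylMeasure d T)) atTop (𝓝 0)) :
    HasWeakDeriv (halfCylinder d T) V (mulM (-k) A) (mulM (-l) C) := by
  refine ⟨locallyIntegrableOn_mulM hA _, locallyIntegrableOn_mulM hC _, fun ψ hψ hc hs => ?_⟩
  have hψt : IsTest ψ := ⟨hψ, hc⟩
  have hsp : tsupport ψ ⊆ {z | 0 < z.2 0} := fun z hz => (hs hz).2
  have hdsp := (tsupport_dv_subset ψ V).trans hs
  have h1 := tendsto_integral_smul (zpow_mul_memLp (hψt.dv V)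
    ((tsupport_dv_subset ψ V).trans hsp) (-k)) hk hA hAt
  have h2 := tendsto_integral_smul (zpow_mul_memLp hψt hsp (-l)) hl hC hCt
  have e : ∀ n, ∫ z, ((z.2 0) ^ (-k) * dv V ψ z) • mulM k (h n) z ∂(cylMeasure d T) =
      -∫ z, ((z.2 0) ^ (-l) * ψ z) • mulM l (dv V (h n)) z ∂(cylMeasure d T) := by
    intro n
    have e1 : ∫ z, ((z.2 0) ^ (-k) * dv V ψ z) • mulM k (h n) z ∂(cylMeasure d T) =
        ∫ z in halfCylinder d T, dv V ψ z • h n z := by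
      refine integral_congr_ae ((ae_cyl_pos T).mono fun z hz => ?_)
      simp only
      rw [mul_comm, mul_smul]
      exact congrArg _ (mulM_mulM k (h n) hz)
    have e2 : ∫ z, ((z.2 0) ^ (-l) * ψ z) • mulM l (dv V (h n)) z ∂(cylMeasure d T) =
        ∫ z in halfCylinder d T, ψ z • dv V (h n) z := by
      refine integral_congr_ae ((ae_cyl_pos T).mono fun z hz => ?_)
      simp only
      rw [mul_comm, mul_smul]
      exact congrArg _ (mulM_mulM l (dv V (h n)) hz)
    rw [e1, e2, setIntegral_smul_eq_of_tsupport_subset hs,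
      setIntegral_smul_eq_of_tsupport_subset hdsp, integral_dv_smul hψt (hh n)]
  simp_rw [e] at h1
  have h3 := tendsto_nhds_unique h1 h2.neg
  calc ∫ z in halfCylinder d T, (fderiv ℝ ψ z V) • mulM (-k) A z
      = ∫ z, ((z.2 0) ^ (-k) * dv V ψ z) • A z ∂(cylMeasure d T) := by
        refine integral_congr_ae (ae_of_all _ fun z => ?_)
        simp only [mulM, dv, smul_smul, mul_comm]
    _ = -∫ z, ((z.2 0) ^ (-l) * ψ z) • C z ∂(cylMeasure d T) := h3
    _ = _ := by
        congr 1
        refine integral_congr_ae (ae_of_all _ fun z => ?_)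
        simp only [mulM, smul_smul, mul_comm]

end WeakDerivative

/-! ### Existence -/

section Existence

lemma PiLp.norm_two_le_sum {ι F : Type*} [Fintype ι] [NormedAddCommGroup F]
    (x : PiLp 2 fun _ : ι => F) : ‖x‖ ≤ ∑ i, ‖x i‖ := by
  refine le_of_sq_le_sq ?_ (Finset.sum_nonneg fun i _ => norm_nonneg _)
  rw [PiLp.norm_sq_eq_of_L2]
  exact Finset.sum_sq_le_sq_sum_of_nonneg fun i _ => norm_nonneg _

lemma eLpNorm_piLp_le_sum {α ι F : Type*} [MeasurableSpace α] {μ : Measure α} [Fintype ι]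
    [NormedAddCommGroup F] {f : α → PiLp 2 fun _ : ι => F}
    (hf : ∀ i, AEStronglyMeasurable (fun z => f z i) μ) :
    eLpNorm f 2 μ ≤ ∑ i, eLpNorm (fun z => f z i) 2 μ := by
  calc eLpNorm f 2 μ ≤ eLpNorm (∑ i, fun z => ‖f z i‖) 2 μ := by
        refine eLpNorm_mono_real fun z => ?_
        simpa using PiLp.norm_two_le_sum (f z)
    _ ≤ ∑ i, eLpNorm (fun z => ‖f z i‖) 2 μ :=
        eLpNorm_sum_le (fun i _ => (hf i).norm) (by norm_num)
    _ = _ := by simp only [eLpNorm_norm]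

/-- Existence of a solution that satisfies the estimate. The right-hand side is approximated by
images of test functions (`exists_approx`); the weighted derivatives of these converge by
`exists_limit_of_bound`. -/
theorem exists_solution (d d₁ : ℕ) [NeZero d] {δ : ℝ} (hδ : 0 < δ) (K : ℝ) : ∃ N : ℝ≥0,
    ∀ L : ℝ → Fin d → Fin d → Val d₁ →L[ℂ] Val d₁, IsParabolic δ K L → ∀ lam : ℝ, 0 ≤ lam →
    ∀ (T : WithTop ℝ) (f : SpaceTime d → Val d₁), MemLp (mulM 1 f) 2 (cylMeasure d T) →
    ∃ u, MemH2 T u ∧ (∀ᵐ z ∂cylMeasure d T,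
        -(Dt T u z) + ∑ i, ∑ j, L z.1 i j (Dx T i (Dx T j u) z) - lam • u z = f z) ∧
      ENNReal.ofReal lam * eLpNorm (mulM 1 u) 2 (cylMeasure d T) +
        ENNReal.ofReal (Real.sqrt lam) * eLpNorm (mulM 1 (grad T u)) 2 (cylMeasure d T) +
        h2Norm T u ≤ N * eLpNorm (mulM 1 f) 2 (cylMeasure d T) := by
  obtain ⟨N, hN⟩ := exists_eLpNorm_bound d d₁ hδ K
  refine ⟨N + (d * N + (N + d * N + (d * d) * N + N)), fun L hL lam hlam T f hf => ?_⟩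
  have hB := hN L hL lam hlam T
  obtain ⟨φ, hφ, hφf⟩ := exists_approx hδ hL hlam hf
  have hx : ContDiff ℝ ∞ fun z : SpaceTime d => z.2 0 := contDiff_spaceCoord 0
  have mem : ∀ {g : SpaceTime d → Val d₁}, IsTest g → MemLp g 2 (cylMeasure d T) := fun hg =>
    (hg.memLp 2).restrict _
  have m1 : ∀ {g : SpaceTime d → Val d₁}, IsTest g → MemLp (mulM 1 g) 2 (cylMeasure d T) :=
    fun hg => by rw [mulM_one]; exact mem (hg.smul_left hx)
  have m2 : ∀ {g : SpaceTime d → Val d₁}, IsHalfTest g → MemLp (mulM (-1) g) 2 (cylMeasure d T) :=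
    fun hg => by rw [mulM_neg_one]; exact mem (hg.toIsTest.inv_spaceCoord_smul hg.supp)
  have mz : ∀ g : SpaceTime d → Val d₁, mulM 0 g = g := fun g => by funext z; simp [mulM]
  have msub : ∀ (k : ℤ) (g h : SpaceTime d → Val d₁), mulM k (g - h) = mulM k g - mulM k h :=
    fun k g h => by funext z; simp [mulM, smul_sub]
  have dsub : ∀ (V : SpaceTime d) {g h : SpaceTime d → Val d₁}, IsTest g → IsTest h →
      dv V (g - h) = dv V g - dv V h := fun V g h hg hh =>
    dv_sub hg.differentiable hh.differentiable V
  have hs : ∀ g h : SpaceTime d → Val d₁, (fun z => g z - h z) = g - h := fun _ _ => rfl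
  -- the limits of the weighted derivatives
  obtain ⟨q, hqm, hqt, hqa, hqb⟩ := exists_limit_of_bound (D := fun φ => mulM (-1) φ)
    (fun g h _ _ => msub _ g h) (fun g hg => m2 hg) (fun g hg => (hB g hg).1) hL hf hφ hφf
  have hp := fun i => exists_limit_of_bound (D := fun φ => sd i φ)
    (fun g h hg hh => dsub _ hg.toIsTest hh.toIsTest) (fun g hg => mem (hg.toIsTest.dv _))
    (fun g hg => (hB g hg).2.1 i) hL hf hφ hφf
  choose p hpm hpt hpa hpb using hp
  have hr := fun i j => exists_limit_of_bound (D := fun φ => mulM 1 (sd i (sd j φ)))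
    (fun g h hg hh => by
      rw [hs, sd, sd, dsub _ hg.toIsTest hh.toIsTest, dsub _ (hg.toIsTest.dv _)
        (hh.toIsTest.dv _), msub]) (fun g hg => m1 ((hg.toIsTest.dv _).dv _))
    (fun g hg => (hB g hg).2.2.1 i j) hL hf hφ hφf
  choose r hrm hrt hra hrb using hr
  obtain ⟨s, hsm, hst, hsa, hsb⟩ := exists_limit_of_bound (D := fun φ => mulM 1 (td φ))
    (fun g h hg hh => by rw [hs, td, dsub _ hg.toIsTest hh.toIsTest, msub])
    (fun g hg => m1 (hg.toIsTest.dv _)) (fun g hg => (hB g hg).2.2.2.1) hL hf hφ hφf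
  obtain ⟨b, hbm, hbt, hba, hbb⟩ := exists_limit_of_bound (D := fun φ => lam • mulM 1 φ)
    (fun g h hg hh => by rw [hs, msub, smul_sub])
    (fun g hg => (m1 hg.toIsTest).const_smul lam) (fun g hg => (hB g hg).2.2.2.2.1) hL hf hφ hφf
  have he := fun i => exists_limit_of_bound (D := fun φ => √lam • mulM 1 (sd i φ))
    (fun g h hg hh => by rw [hs, sd, dsub _ hg.toIsTest hh.toIsTest, msub, smul_sub])
    (fun g hg => (m1 (hg.toIsTest.dv _)).const_smul _) (fun g hg => (hB g hg).2.2.2.2.2 i)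
    hL hf hφ hφf
  choose e hem het hea heb using he
  have mP : ∀ g : SpaceTime d → Val d₁, IsHalfTest g →
      MemLp (mulM 1 (parabolicOp L lam g)) 2 (cylMeasure d T) := fun g hg => by
    rw [mulM_one]; exact spaceCoord_smul_parabolicOp_memLp_cyl hL hg.toIsTest T
  obtain ⟨F, hFm, hFt, hFa, -⟩ := exists_limit_of_bound (N := 1)
    (D := fun φ => mulM 1 (parabolicOp L lam φ))
    (fun g h hg hh => parabolicOp_sub hg.toIsTest hh.toIsTest) mP (fun g hg => by simp)
    hL hf hφ hφf
  have hFf : F =ᵐ[cylMeasure d T] mulM 1 f := by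
    have hpow : Tendsto (fun n : ℕ => (1 / 2 : ℝ≥0∞) ^ (n + 1)) atTop (𝓝 0) := by
      refine (tendsto_add_atTop_iff_nat 1).2 (ENNReal.tendsto_pow_atTop_nhds_zero_of_lt_one ?_)
      rw [one_div]; exact ENNReal.inv_lt_one.2 (by norm_num)
    have h1 := hFt.add hpow
    rw [add_zero] at h1
    have h2 : eLpNorm (F - mulM 1 f) 2 (cylMeasure d T) ≤ 0 := ge_of_tendsto' h1 fun n => by
      have e1 : F - mulM 1 f = (mulM 1 (parabolicOp L lam (φ n)) - mulM 1 f) -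
        (mulM 1 (parabolicOp L lam (φ n)) - F) := by abel
      rw [e1, add_comm]
      refine (eLpNorm_sub_le ((mP _ (hφ n)).1.sub hf.1) ((mP _ (hφ n)).1.sub hFm.1)
        (by norm_num)).trans ?_
      gcongr
      exact (hφf n).le
    have h3 := (eLpNorm_eq_zero_iff (hFm.1.sub hf.1) (by norm_num)).1 (le_antisymm h2 zero_le)
    filter_upwards [h3] with z hz
    exact sub_eq_zero.1 hz
  -- the solution and its weak derivatives
  set u : SpaceTime d → Val d₁ := mulM 1 q with hu
  have hΩ := isOpen_halfCylinder (d := d) T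
  have w1 : ∀ i, HasWeakDeriv (halfCylinder d T) (spaceDir i) u (p i) := fun i => by
    have := hasWeakDeriv_of_tendsto (fun n => (hφ n).toIsTest) (spaceDir i) (-1) 0
      (fun n => m2 (hφ n)) (fun n => by rw [mz]; exact mem ((hφ n).toIsTest.dv _)) hqm (hpm i)
      hqt (by simpa only [mz] using hpt i)
    rwa [neg_neg, neg_zero, mz] at this
  have w2 : ∀ i j, HasWeakDeriv (halfCylinder d T) (spaceDir i) (p j) (mulM (-1) (r i j)) :=
    fun i j => by
    have := hasWeakDeriv_of_tendsto (fun n => (hφ n).toIsTest.dv (spaceDir j)) (spaceDir i) 0 1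
      (fun n => by rw [mz]; exact mem ((hφ n).toIsTest.dv _))
      (fun n => m1 (((hφ n).toIsTest.dv _).dv _)) (hpm j) (hrm i j)
      (by simpa only [mz] using hpt j) (hrt i j)
    rwa [neg_zero, mz] at this
  have w3 : HasWeakDeriv (halfCylinder d T) (timeDir d) u (mulM (-1) s) := by
    have := hasWeakDeriv_of_tendsto (fun n => (hφ n).toIsTest) (timeDir d) (-1) 1
      (fun n => m2 (hφ n)) (fun n => m1 ((hφ n).toIsTest.dv _)) hqm hsm hqt hst
    rwa [neg_neg] at this
  have a1 : ∀ i, Dx T i u =ᵐ[cylMeasure d T] p i := fun i => (w1 i).weakDeriv_ae_eq hΩ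
  have w2' : ∀ i j, HasWeakDeriv (halfCylinder d T) (spaceDir i) (Dx T j u) (mulM (-1) (r i j)) :=
    fun i j => (w2 i j).congr (a1 j).symm ae_eq_rfl
  have a2 : ∀ i j, Dx T i (Dx T j u) =ᵐ[cylMeasure d T] mulM (-1) (r i j) := fun i j =>
    (w2' i j).weakDeriv_ae_eq hΩ
  have a3 : Dt T u =ᵐ[cylMeasure d T] mulM (-1) s := w3.weakDeriv_ae_eq hΩ
  have b0 : mulM (-1) u =ᵐ[cylMeasure d T] q := (ae_cyl_pos T).mono fun z hz => mulM_mulM 1 q hz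
  have b2 : ∀ i j, mulM 1 (Dx T i (Dx T j u)) =ᵐ[cylMeasure d T] r i j := fun i j => by
    filter_upwards [a2 i j, ae_cyl_pos T] with z h1 h2
    rw [mulM, h1]
    exact mulM_mulM_neg 1 (r i j) h2
  have b3 : mulM 1 (Dt T u) =ᵐ[cylMeasure d T] s := by
    filter_upwards [a3, ae_cyl_pos T] with z h1 h2
    rw [mulM, h1]
    exact mulM_mulM_neg 1 s h2
  have b5 : b =ᵐ[cylMeasure d T] lam • mulM 1 u := by
    filter_upwards [hba, hqa, ae_cyl_pos T] with z h1 h2 h3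
    have h4 := h2.const_smul (lam * (z.2 0) ^ 2)
    refine tendsto_nhds_unique h1 ?_
    have e1 : (lam • mulM 1 u) z = (lam * (z.2 0) ^ 2) • q z := by
      simp only [Pi.smul_apply, hu, mulM_one, smul_smul]
      congr 1; ring
    rw [e1]
    refine h4.congr fun n => ?_
    simp only [mulM_one, mulM_neg_one, Pi.smul_apply, smul_smul]
    congr 1
    field_simp
  have b6 : ∀ i, e i =ᵐ[cylMeasure d T] √lam • mulM 1 (Dx T i u) := fun i => by
    filter_upwards [hea i, hpa i, a1 i] with z h1 h2 h3
    refine tendsto_nhds_unique h1 ?_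
    have e1 : (√lam • mulM 1 (Dx T i u)) z = √lam • z.2 0 • p i z := by
      simp only [Pi.smul_apply, mulM_one, h3]
    rw [e1]
    refine ((h2.const_smul (z.2 0)).const_smul (√lam)).congr fun n => ?_
    simp only [mulM_one, Pi.smul_apply]
  have hgm : ∀ i, MemLp (Dx T i u) 2 (cylMeasure d T) := fun i => (hpm i).ae_eq (a1 i).symm
  have hhm : ∀ i j, MemLp (mulM 1 (Dx T i (Dx T j u))) 2 (cylMeasure d T) := fun i j =>
    (hrm i j).ae_eq (b2 i j).symm
  refine ⟨u, ⟨⟨_, w3⟩, fun i => ⟨_, w1 i⟩, fun i j => ⟨_, w2' i j⟩, hqm.ae_eq b0.symm,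
    MemLp.of_eval_piLp hgm, MemLp.of_eval_piLp fun ij => hhm ij.1 ij.2, hsm.ae_eq b3.symm⟩, ?_, ?_⟩
  · -- the equation
    have hra' : ∀ᵐ z ∂cylMeasure d T, ∀ i j,
        Tendsto (fun n => mulM 1 (sd i (sd j (φ n))) z) atTop (𝓝 (r i j z)) := by
      simp only [ae_all_iff]; exact hra
    have b2' : ∀ᵐ z ∂cylMeasure d T, ∀ i j, mulM 1 (Dx T i (Dx T j u)) z = r i j z := by
      simp only [ae_all_iff]; exact b2
    filter_upwards [hsa, hra', hba, hFa, hFf, b2', b3, b5, ae_cyl_pos T]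
      with z h1 h2 h3 h4 h5 h6 h7 h8 h9
    have h10 : Tendsto (fun n => mulM 1 (parabolicOp L lam (φ n)) z) atTop
        (𝓝 (-s z + ∑ i, ∑ j, L z.1 i j (r i j z) - b z)) := by
      refine ((h1.neg.add (tendsto_finsetSum _ fun i _ => tendsto_finsetSum _ fun j _ =>
        ((L z.1 i j).continuous.tendsto _).comp (h2 i j))).sub h3).congr fun n => ?_
      simp only [mulM_one, parabolicOp, Function.comp_apply, Pi.smul_apply, smul_sub, smul_add,
        smul_neg, Finset.smul_sum, smul_comm (z.2 0) lam,
        fun i j (y : Val d₁) => (L z.1 i j).map_smul_of_tower (z.2 0) y]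
    have h11 := tendsto_nhds_unique h4 h10
    rw [h5, ← h7, h8] at h11
    simp only [← h6, mulM_one, Pi.smul_apply] at h11
    refine smul_right_injective _ h9.ne' ?_
    simp only
    rw [h11, smul_sub, smul_add, smul_neg, Finset.smul_sum, smul_comm (z.2 0) lam]
    simp only [Finset.smul_sum, fun i j (y : Val d₁) => (L z.1 i j).map_smul_of_tower (z.2 0) y]
  · -- the estimate
    set R := eLpNorm (mulM 1 f) 2 (cylMeasure d T) with hR
    have c0 : ENNReal.ofReal lam * eLpNorm (mulM 1 u) 2 (cylMeasure d T) ≤ N * R := by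
      rw [← Real.enorm_of_nonneg hlam, ← eLpNorm_const_smul, ← eLpNorm_congr_ae b5]
      exact hbb
    have c1 : ENNReal.ofReal (√lam) * eLpNorm (mulM 1 (grad T u)) 2 (cylMeasure d T) ≤
        d * (N * R) := by
      have h1 : eLpNorm (mulM 1 (grad T u)) 2 (cylMeasure d T) ≤
          ∑ i, eLpNorm (mulM 1 (Dx T i u)) 2 (cylMeasure d T) := by
        refine eLpNorm_piLp_le_sum (f := mulM 1 (grad T u)) fun i => ?_
        have : AEStronglyMeasurable (mulM 1 (Dx T i u)) (cylMeasure d T) := by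
          rw [mulM_one]
          exact hx.continuous.aestronglyMeasurable.smul (hgm i).1
        exact this
      calc _ ≤ ENNReal.ofReal (√lam) * ∑ i, eLpNorm (mulM 1 (Dx T i u)) 2 (cylMeasure d T) := by
            gcongr
        _ = ∑ i, ENNReal.ofReal (√lam) * eLpNorm (mulM 1 (Dx T i u)) 2 (cylMeasure d T) :=
            Finset.mul_sum _ _ _
        _ ≤ ∑ _i : Fin d, (N * R : ℝ≥0∞) := by
            refine Finset.sum_le_sum fun i _ => ?_
            rw [← Real.enorm_of_nonneg (Real.sqrt_nonneg lam), ← eLpNorm_const_smul,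
              ← eLpNorm_congr_ae (b6 i)]
            exact heb i
        _ = _ := by simp
    have c2 : eLpNorm (mulM (-1) u) 2 (cylMeasure d T) ≤ N * R := by
      rw [eLpNorm_congr_ae b0]; exact hqb
    have c3 : eLpNorm (grad T u) 2 (cylMeasure d T) ≤ d * (N * R) := by
      refine (eLpNorm_piLp_le_sum (f := grad T u) fun i => (hgm i).1).trans ?_
      calc _ ≤ ∑ _i : Fin d, (N * R : ℝ≥0∞) := by
            refine Finset.sum_le_sum fun i _ => ?_
            exact (eLpNorm_congr_ae (a1 i)).trans_le (hpb i)
        _ = _ := by simp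
    have c4 : eLpNorm (mulM 1 (hess T u)) 2 (cylMeasure d T) ≤ d * d * (N * R) := by
      refine (eLpNorm_piLp_le_sum (f := mulM 1 (hess T u)) fun ij => (hhm ij.1 ij.2).1).trans ?_
      calc _ ≤ ∑ _i : Fin d × Fin d, (N * R : ℝ≥0∞) := by
            refine Finset.sum_le_sum fun ij _ => ?_
            exact (eLpNorm_congr_ae (b2 ij.1 ij.2)).trans_le (hrb ij.1 ij.2)
        _ = _ := by simp
    have c5 : eLpNorm (mulM 1 (Dt T u)) 2 (cylMeasure d T) ≤ N * R := by
      rw [eLpNorm_congr_ae b3]; exact hsb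
    calc _ ≤ N * R + d * (N * R) + (N * R + d * (N * R) + d * d * (N * R) + N * R) := by
          unfold h2Norm
          gcongr
      _ = _ := by push_cast; ring

end Existence

/-! ### Uniqueness -/

section StrongToWeak

variable {d d₁ : ℕ} {δ K : ℝ} {L : ℝ → Fin d → Fin d → Val d₁ →L[ℂ] Val d₁} {lam : ℝ}

lemma Integrable.clm_apply_time (hL : IsParabolic δ K L) {G : SpaceTime d → Val d₁}
    (hG : Integrable G) (i j : Fin d) : Integrable fun z => L z.1 i j (G z) := by
  have hm : AEStronglyMeasurable (fun z : SpaceTime d => L z.1 i j) volume := by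
    have : AEStronglyMeasurable (fun z : SpaceTime d => L z.1 i j)
      ((volume : Measure ℝ).prod volume) := (hL.meas i j).comp_fst
    exact this
  refine (hG.norm.const_mul K).mono' ?_
    (ae_of_all _ fun z => (L z.1 i j).le_of_opNorm_le (hL.bound _ i j) _)
  exact (ContinuousLinearMap.apply ℂ (Val d₁) |>.flip).aestronglyMeasurable_comp₂ hm hG.1

/-- A function that has mean zero in space at almost every time still has integral zero after a
bounded operator depending only on time is applied. This deals with coefficients that are merely
measurable. -/
lemma integral_clm_time_eq_zero (hL : IsParabolic δ K L) {G : SpaceTime d → Val d₁}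
    (hG : Integrable G) (h : ∀ χ : ℝ → ℝ, IsTest χ → ∫ z, χ z.1 • G z = 0) (i j : Fin d) :
    ∫ z, L z.1 i j (G z) = 0 := by
  have hLG := Integrable.clm_apply_time hL hG i j
  rw [Measure.volume_eq_prod] at hG hLG ⊢
  have h0 : ∀ᵐ t : ℝ, ∫ x, G (t, x) = 0 := by
    refine ae_eq_zero_of_integral_contDiff_smul_eq_zero hG.integral_prod_left.locallyIntegrable
      fun χ hχ hc => ?_
    have h1 := h χ ⟨hχ, hc⟩
    obtain ⟨C, hC⟩ := hc.exists_bound_of_continuous hχ.continuous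
    have hi : Integrable (fun z : SpaceTime d => χ z.1 • G z)
        ((volume : Measure ℝ).prod volume) := by
      refine hG.bdd_smul (φ := fun z : SpaceTime d => χ z.1) C
        (hχ.continuous.comp continuous_fst).aestronglyMeasurable (ae_of_all _ fun z => hC z.1)
    rw [Measure.volume_eq_prod, integral_prod _ hi] at h1
    simpa only [integral_smul] using h1
  rw [integral_prod _ hLG]
  refine integral_eq_zero_of_ae ?_
  filter_upwards [h0, hG.prod_right_ae] with t ht hi
  rw [Pi.zero_apply, (L t i j).integral_comp_comm hi, ht, map_zero]

variable [NeZero d]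

lemma tsupport_prod_mul_subset {χ : ℝ → ℝ} {η : EuclideanSpace ℝ (Fin d) → ℝ} {T : WithTop ℝ}
    (hχ : tsupport χ ⊆ {t : ℝ | (t : WithTop ℝ) < T}) (hη : tsupport η ⊆ {x | 0 < x 0}) :
    tsupport (fun z : SpaceTime d => χ z.1 * η z.2) ⊆ halfCylinder d T := by
  intro z hz
  refine ⟨hχ (tsupport_comp_subset_preimage χ continuous_fst ?_),
    hη (tsupport_comp_subset_preimage η continuous_snd ?_)⟩
  · exact closure_mono (Function.support_mul_subset_left _ _) hz
  · exact closure_mono (Function.support_mul_subset_right _ _) hz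

lemma weakIntegrand_eq_zero {T : WithTop ℝ} {χ : ℝ → ℝ} {η : EuclideanSpace ℝ (Fin d) → ℝ}
    (hχ : tsupport χ ⊆ {t : ℝ | (t : WithTop ℝ) < T}) (hη : tsupport η ⊆ {x | 0 < x 0})
    {u : SpaceTime d → Val d₁} {z : SpaceTime d} (hz : z ∉ halfCylinder d T) :
    weakIntegrand L lam χ η u z = 0 ∧ χ z.1 * η z.2 = 0 := by
  by_cases h1 : z.1 ∈ tsupport χ
  · have h2 : z.2 ∉ tsupport η := fun h => hz ⟨hχ h1, hη h⟩
    have e0 : η z.2 = 0 := image_eq_zero_of_notMem_tsupport h2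
    have e1 : ∀ i j, pd i (pd j η) z.2 = 0 := fun i j => image_eq_zero_of_notMem_tsupport
      fun h => h2 (tsupport_dv_subset _ _ (tsupport_dv_subset _ _ h))
    simp [weakIntegrand, e0, e1]
  · have e0 : χ z.1 = 0 := image_eq_zero_of_notMem_tsupport h1
    have e1 : deriv χ z.1 = 0 := image_eq_zero_of_notMem_tsupport fun h =>
      h1 (tsupport_deriv_subset h)
    simp [weakIntegrand, e0, e1]

/-- A strong solution is a very weak one. The coefficients are not differentiable in time; they are
removed with `integral_clm_time_eq_zero`. -/
lemma weakIntegrand_of_solution (hL : IsParabolic δ K L) {T : WithTop ℝ}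
    {u f : SpaceTime d → Val d₁} (hu : MemH2 T u)
    (heq : ∀ᵐ z ∂cylMeasure d T,
      -(Dt T u z) + ∑ i, ∑ j, L z.1 i j (Dx T i (Dx T j u) z) - lam • u z = f z)
    {χ : ℝ → ℝ} {η : EuclideanSpace ℝ (Fin d) → ℝ} (hχ : IsTest χ) (hη : IsTest η)
    (hχs : tsupport χ ⊆ {t : ℝ | (t : WithTop ℝ) < T}) (hηs : tsupport η ⊆ {x | 0 < x 0}) :
    Integrable (fun z => weakIntegrand L lam χ η u z - (χ z.1 * η z.2) • f z) ∧
      ∫ z, (weakIntegrand L lam χ η u z - (χ z.1 * η z.2) • f z) = 0 := by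
  have hwt := HasSomeWeakDeriv.hasWeakDeriv_weakDeriv hu.hasDt
  have hwx := fun i => HasSomeWeakDeriv.hasWeakDeriv_weakDeriv (hu.hasDx i)
  have hwxx := fun i j => HasSomeWeakDeriv.hasWeakDeriv_weakDeriv (hu.hasDxx i j)
  have hul := hwt.1
  -- products of test functions integrate against locally integrable functions
  have int : ∀ {χ : ℝ → ℝ} {η : EuclideanSpace ℝ (Fin d) → ℝ} {g : SpaceTime d → Val d₁},
      LocallyIntegrableOn g (halfCylinder d T) → IsTest χ → IsTest η →
      tsupport χ ⊆ {t : ℝ | (t : WithTop ℝ) < T} → tsupport η ⊆ {x | 0 < x 0} →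
      Integrable fun z => (χ z.1 * η z.2) • g z := fun hg hχ hη hχs hηs =>
    integrable_smul_of_tsupport_subset hg (hχ.prod_mul hη).continuous (hχ.prod_mul hη).compact
      (tsupport_prod_mul_subset hχs hηs)
  have hdχ : tsupport (deriv χ) ⊆ {t : ℝ | (t : WithTop ℝ) < T} :=
    (closure_minimal (support_deriv_subset) (isClosed_tsupport _)).trans hχs
  have hdη : ∀ {η : EuclideanSpace ℝ (Fin d) → ℝ} (i : Fin d), tsupport η ⊆ {x | 0 < x 0} →
      tsupport (pd i η) ⊆ {x | 0 < x 0} := fun i h => (tsupport_dv_subset _ _).trans h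
  -- the space derivatives, tested with products
  have ibp : ∀ {χ : ℝ → ℝ} {η : EuclideanSpace ℝ (Fin d) → ℝ} {g g' : SpaceTime d → Val d₁}
      (i : Fin d), HasWeakDeriv (halfCylinder d T) (spaceDir i) g g' → IsTest χ → IsTest η →
      tsupport χ ⊆ {t : ℝ | (t : WithTop ℝ) < T} → tsupport η ⊆ {x | 0 < x 0} →
      ∫ z, (χ z.1 * pd i η z.2) • g z = -∫ z, (χ z.1 * η z.2) • g' z := by
    intro χ η g g' i hg hχ hη hχs hηs
    have h1 := hg.2.2 _ (hχ.prod_mul hη).smooth (hχ.prod_mul hη).compact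
      (tsupport_prod_mul_subset hχs hηs)
    have h2 : ∀ z, fderiv ℝ (fun z : SpaceTime d => χ z.1 * η z.2) z (spaceDir i) =
        χ z.1 * pd i η z.2 := congrFun (sd_prod_mul hχ hη i)
    simp only [h2] at h1
    rwa [setIntegral_smul_eq_of_tsupport_subset (tsupport_prod_mul_subset hχs hηs),
      setIntegral_smul_eq_of_tsupport_subset (tsupport_prod_mul_subset hχs (hdη i hηs))] at h1
  set G : Fin d → Fin d → SpaceTime d → Val d₁ := fun i j z =>
    (χ z.1 * pd i (pd j η) z.2) • u z - (χ z.1 * η z.2) • Dx T i (Dx T j u) z with hG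
  have hGi : ∀ i j, Integrable (G i j) := fun i j =>
    (int hul hχ ((hη.dv _).dv _) hχs (hdη i (hdη j hηs))).sub
      (int (hwxx i j).2.1 hχ hη hχs hηs)
  have hG0 : ∀ i j, ∫ z, L z.1 i j (G i j z) = 0 := fun i j => by
    refine integral_clm_time_eq_zero hL (hGi i j) (fun ψ hψ => ?_) i j
    have hψχ : IsTest fun t => ψ t * χ t := hχ.smul_left hψ.smooth
    have hψs : tsupport (fun t => ψ t * χ t) ⊆ {t : ℝ | (t : WithTop ℝ) < T} :=
      (closure_mono (Function.support_mul_subset_right _ _)).trans hχs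
    have e1 : ∫ z, ((fun t => ψ t * χ t) z.1 * pd j (pd i η) z.2) • u z =
        -∫ z, ((fun t => ψ t * χ t) z.1 * pd i η z.2) • Dx T j u z :=
      ibp j (hwx j) hψχ (hη.dv _) hψs (hdη i hηs)
    have e2 : ∫ z, ((fun t => ψ t * χ t) z.1 * pd i η z.2) • Dx T j u z =
        -∫ z, ((fun t => ψ t * χ t) z.1 * η z.2) • Dx T i (Dx T j u) z :=
      ibp i (hwxx i j) hψχ hη hψs hηs
    have k1 : Integrable fun z => ((fun t => ψ t * χ t) z.1 * pd j (pd i η) z.2) • u z :=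
      int hul hψχ ((hη.dv _).dv _) hψs (hdη j (hdη i hηs))
    have k2 : Integrable fun z =>
        ((fun t => ψ t * χ t) z.1 * η z.2) • Dx T i (Dx T j u) z :=
      int (hwxx i j).2.1 hψχ hη hψs hηs
    have e3 : pd j (pd i η) = pd i (pd j η) := dv_comm hη.smooth _ _
    have e4 : (fun z => ψ z.1 • G i j z) = fun z =>
        ((fun t => ψ t * χ t) z.1 * pd j (pd i η) z.2) • u z -
          ((fun t => ψ t * χ t) z.1 * η z.2) • Dx T i (Dx T j u) z := by
      funext z
      rw [e3, hG]
      simp only [smul_sub, smul_smul, mul_assoc]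
    rw [e4, integral_sub k1 k2, e1, e2, neg_neg, sub_self]
  -- the time derivative
  have it1 := int hul hχ.deriv hη hdχ hηs
  have it2 : Integrable fun z => (χ z.1 * η z.2) • Dt T u z := int hwt.2.1 hχ hη hχs hηs
  have ht : ∫ z, ((deriv χ z.1 * η z.2) • u z + (χ z.1 * η z.2) • Dt T u z) = 0 := by
    have h1 := hwt.2.2 _ (hχ.prod_mul hη).smooth (hχ.prod_mul hη).compact
      (tsupport_prod_mul_subset hχs hηs)
    have h2 : ∀ z, fderiv ℝ (fun z : SpaceTime d => χ z.1 * η z.2) z (timeDir d) =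
        deriv χ z.1 * η z.2 := congrFun (td_prod_mul hχ hη)
    simp only [h2] at h1
    rw [setIntegral_smul_eq_of_tsupport_subset (tsupport_prod_mul_subset hχs hηs),
      setIntegral_smul_eq_of_tsupport_subset (tsupport_prod_mul_subset hdχ hηs)] at h1
    rw [integral_add it1 it2, h1]
    exact neg_add_cancel _
  have iJ1 : Integrable fun z => (deriv χ z.1 * η z.2) • u z + (χ z.1 * η z.2) • Dt T u z :=
    it1.add it2
  have iJ2 : Integrable fun z => ∑ i, ∑ j, L z.1 i j (G i j z) :=
    integrable_finsetSum _ fun i _ => integrable_finsetSum _ fun j _ =>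
      Integrable.clm_apply_time hL (hGi i j) i j
  have hJ : (fun z => weakIntegrand L lam χ η u z - (χ z.1 * η z.2) • f z) =ᵐ[volume]
      fun z => ((deriv χ z.1 * η z.2) • u z + (χ z.1 * η z.2) • Dt T u z) +
        ∑ i, ∑ j, L z.1 i j (G i j z) := by
    filter_upwards [(ae_restrict_iff' (measurableSet_halfCylinder T)).1 heq] with z hz
    have hr : ∀ (i j : Fin d) (c : ℝ) (y : Val d₁), L z.1 i j (c • y) = c • L z.1 i j y :=
      fun i j c y => (L z.1 i j).map_smul_of_tower c y
    by_cases hzΩ : z ∈ halfCylinder d T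
    · rw [← hz hzΩ]
      simp only [hG, weakIntegrand, map_sub, hr, smul_sub, smul_add, smul_neg, Finset.smul_sum,
        Finset.sum_sub_distrib, smul_smul]
      rw [mul_comm lam]
      abel
    · obtain ⟨h1, h2⟩ := weakIntegrand_eq_zero (L := L) (lam := lam) (u := u) hχs hηs hzΩ
      have h3 : (deriv χ z.1 * η z.2) = 0 := image_eq_zero_of_notMem_tsupport
        (f := fun z : SpaceTime d => deriv χ z.1 * η z.2) fun h =>
          hzΩ (tsupport_prod_mul_subset hdχ hηs h)
      have h4 : ∀ i j, χ z.1 * pd i (pd j η) z.2 = 0 := fun i j =>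
        image_eq_zero_of_notMem_tsupport
        (f := fun z : SpaceTime d => χ z.1 * pd i (pd j η) z.2) fun h =>
          hzΩ (tsupport_prod_mul_subset hχs (hdη i (hdη j hηs)) h)
      simp [h1, h2, h3, h4, hG]
  refine ⟨(iJ1.add iJ2).congr hJ.symm, ?_⟩
  rw [integral_congr_ae hJ, integral_add iJ1 iJ2, ht,
    integral_finsetSum _ fun i _ => integrable_finsetSum _ fun j _ =>
      Integrable.clm_apply_time hL (hGi i j) i j, zero_add]
  refine Finset.sum_eq_zero fun i _ => ?_
  rw [integral_finsetSum _ fun j _ => Integrable.clm_apply_time hL (hGi i j) i j]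
  exact Finset.sum_eq_zero fun j _ => hG0 i j

/-- Uniqueness of solutions: the difference of two, set to zero outside of the half space, satisfies
the assumptions of `ae_eq_zero_of_weakIntegrand`. -/
theorem solution_unique (hδ : 0 < δ) (hL : IsParabolic δ K L) (hlam : 0 ≤ lam) {T : WithTop ℝ}
    {u u' f : SpaceTime d → Val d₁} (hu : MemH2 T u) (hu' : MemH2 T u')
    (heq : ∀ᵐ z ∂cylMeasure d T,
      -(Dt T u z) + ∑ i, ∑ j, L z.1 i j (Dx T i (Dx T j u) z) - lam • u z = f z)
    (heq' : ∀ᵐ z ∂cylMeasure d T,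
      -(Dt T u' z) + ∑ i, ∑ j, L z.1 i j (Dx T i (Dx T j u') z) - lam • u' z = f z) :
    u =ᵐ[cylMeasure d T] u' := by
  have hH := measurableSet_halfCylinder (d := d) T
  have hqL : MemLp (mulM (-1) u - mulM (-1) u') 2 (cylMeasure d T) := hu.memLp_u.sub hu'.memLp_u
  set q : SpaceTime d → Val d₁ := (halfCylinder d T).indicator (hqL.1.mk _) with hq
  set v : SpaceTime d → Val d₁ := fun z => z.2 0 • q z with hv
  have hqm : StronglyMeasurable q := hqL.1.stronglyMeasurable_mk.indicator hH
  have hq2 : MemLp q 2 :=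
    (memLp_indicator_iff_restrict hH).2 (hqL.ae_eq hqL.1.ae_eq_mk)
  have hq0 : ∀ z : SpaceTime d, ¬ 0 < z.2 0 → q z = 0 := fun z hz =>
    Set.indicator_of_notMem (fun h => hz h.2) _
  have hqv : ∀ z : SpaceTime d, (z.2 0)⁻¹ • v z = q z := fun z => by
    by_cases hz : 0 < z.2 0
    · rw [hv, inv_smul_smul₀ hz.ne']
    · simp [hv, hq0 z hz]
  have hvu : ∀ᵐ z : SpaceTime d, z ∈ halfCylinder d T → v z = u z - u' z := by
    filter_upwards [(ae_restrict_iff' hH).1 hqL.1.ae_eq_mk] with z hz hzΩ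
    simp only [hv, hq]
    rw [Set.indicator_of_mem hzΩ, ← hz hzΩ]
    simp only [Pi.sub_apply, mulM_neg_one, ← smul_sub]
    rw [smul_inv_smul₀ hzΩ.2.ne']
  have key := ae_eq_zero_of_weakIntegrand hδ hL hlam (T := T) (v := v)
    ((contDiff_spaceCoord (0 : Fin d)).continuous.stronglyMeasurable.smul hqm)
    (hq2.ae_eq (ae_of_all _ fun z => (hqv z).symm)) (fun z hz => by simp [hv, hq0 z hz])
    (fun χ η hχ hη hχs hηs => ?_)
  · rw [Filter.EventuallyEq, cylMeasure, ae_restrict_iff' hH]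
    filter_upwards [key, hvu] with z h1 h2 hz
    rw [h1 hz.1] at h2
    exact (sub_eq_zero.1 (h2 hz).symm)
  · obtain ⟨i1, e1⟩ := weakIntegrand_of_solution hL hu heq hχ hη hχs hηs
    obtain ⟨i2, e2⟩ := weakIntegrand_of_solution hL hu' heq' hχ hη hχs hηs
    have h3 := integral_sub i1 i2
    rw [e1, e2, sub_zero] at h3
    rw [← h3]
    refine integral_congr_ae ?_
    filter_upwards [hvu] with z hz
    by_cases hzΩ : z ∈ halfCylinder d T
    · simp only [weakIntegrand, hz hzΩ, map_sub, smul_sub, Finset.sum_sub_distrib]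
      abel
    · obtain ⟨a1, a2⟩ := weakIntegrand_eq_zero (L := L) (lam := lam) (u := u) hχs hηs hzΩ
      have a3 := (weakIntegrand_eq_zero (L := L) (lam := lam) (u := u') hχs hηs hzΩ).1
      have a4 := (weakIntegrand_eq_zero (L := L) (lam := lam) (u := v) hχs hηs hzΩ).1
      rw [a1, a2, a3, a4]
      simp

end StrongToWeak

/-! ### Matrix coefficients -/

section Coefficients

variable {d d₁ : ℕ}

lemma toEuclideanCLM_eq_sum (B : Matrix (Fin d₁) (Fin d₁) ℂ) :
    Matrix.toEuclideanCLM (n := Fin d₁) (𝕜 := ℂ) B =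
      ∑ k, ∑ r, B k r • Matrix.toEuclideanCLM (n := Fin d₁) (𝕜 := ℂ) (Matrix.single k r 1) := by
  conv_lhs => rw [Matrix.matrix_eq_sum_single B]
  simp only [map_sum]
  refine Finset.sum_congr rfl fun k _ => Finset.sum_congr rfl fun r _ => ?_
  rw [← map_smul, Matrix.smul_single, smul_eq_mul, mul_one]

/-- A bound for the operator norm of matrices with entries bounded by `δ⁻¹`; it is the sum of the
bounds for the single entries. -/
def coeffBound (d₁ : ℕ) (δ : ℝ) : ℝ :=
  ∑ k : Fin d₁, ∑ r : Fin d₁,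
    δ⁻¹ * ‖Matrix.toEuclideanCLM (n := Fin d₁) (𝕜 := ℂ) (Matrix.single k r 1)‖

lemma AdmissibleCoeff.isParabolic {δ : ℝ} {A : Fin d → Fin d → ℝ → Matrix (Fin d₁) (Fin d₁) ℂ}
    (hA : AdmissibleCoeff δ A) : IsParabolic δ (coeffBound d₁ δ)
      fun t i j => Matrix.toEuclideanCLM (n := Fin d₁) (𝕜 := ℂ) (A i j t) where
  meas i j := by
    simp only [toEuclideanCLM_eq_sum (A i j _)]
    refine Finset.aestronglyMeasurable_fun_sum _ fun k _ =>
      Finset.aestronglyMeasurable_fun_sum _ fun r _ => ?_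
    exact (hA.measurable i j k r).aestronglyMeasurable.smul_const _
  bound t i j := by
    rw [toEuclideanCLM_eq_sum]
    refine norm_sum_le_of_le _ fun k _ => norm_sum_le_of_le _ fun r _ => ?_
    rw [norm_smul]
    gcongr
    exact hA.bounded i j k r t
  ell := legendreHadamard_of_admissible hA

end Coefficients

end

theorem theorem3p3 (d d₁ : ℕ) [NeZero d] (δ : ℝ) (hδ : 0 < δ) :
    ∃ N : ℝ≥0,
      ∀ A : Fin d → Fin d → ℝ → Matrix (Fin d₁) (Fin d₁) ℂ, AdmissibleCoeff δ A →
      ∀ (T : WithTop ℝ) (lam : ℝ), 0 ≤ lam →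
        (∀ u f : SpaceTime d → Val d₁,
          MemH2 T u → MemLp (mulM 1 f) 2 (cylMeasure d T) → SolvesSystem A T lam u f →
            ENNReal.ofReal lam * eLpNorm (mulM 1 u) 2 (cylMeasure d T) +
              ENNReal.ofReal (Real.sqrt lam) * eLpNorm (mulM 1 (grad T u)) 2 (cylMeasure d T) +
              h2Norm T u ≤ N * eLpNorm (mulM 1 f) 2 (cylMeasure d T)) ∧
        (∀ f : SpaceTime d → Val d₁, MemLp (mulM 1 f) 2 (cylMeasure d T) →
          ∃ u : SpaceTime d → Val d₁, (MemH2 T u ∧ SolvesSystem A T lam u f) ∧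
            ∀ v : SpaceTime d → Val d₁, MemH2 T v → SolvesSystem A T lam v f →
              v =ᵐ[cylMeasure d T] u) := by
  obtain ⟨N, hN⟩ := exists_solution d d₁ hδ (coeffBound d₁ δ)
  refine ⟨N, fun A hA T lam hlam => ?_⟩
  have hL := hA.isParabolic
  refine ⟨fun u f hu hf heq => ?_, fun f hf => ?_⟩
  · obtain ⟨w, hw, hweq, hest⟩ := hN _ hL lam hlam T f hf
    have huw : u =ᵐ[cylMeasure d T] w := solution_unique hδ hL hlam hu hw heq hweq
    have hΩ := isOpen_halfCylinder (d := d) T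
    have hDt : Dt T u =ᵐ[cylMeasure d T] Dt T w :=
      ((HasSomeWeakDeriv.hasWeakDeriv_weakDeriv hu.hasDt).congr huw ae_eq_rfl).ae_eq hΩ
        (HasSomeWeakDeriv.hasWeakDeriv_weakDeriv hw.hasDt)
    have hDx : ∀ i, Dx T i u =ᵐ[cylMeasure d T] Dx T i w := fun i =>
      ((HasSomeWeakDeriv.hasWeakDeriv_weakDeriv (hu.hasDx i)).congr huw ae_eq_rfl).ae_eq hΩ
        (HasSomeWeakDeriv.hasWeakDeriv_weakDeriv (hw.hasDx i))
    have hDxx : ∀ i j, Dx T i (Dx T j u) =ᵐ[cylMeasure d T] Dx T i (Dx T j w) := fun i j =>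
      ((HasSomeWeakDeriv.hasWeakDeriv_weakDeriv (hu.hasDxx i j)).congr (hDx j) ae_eq_rfl).ae_eq hΩ
        (HasSomeWeakDeriv.hasWeakDeriv_weakDeriv (hw.hasDxx i j))
    have hgrad : grad T u =ᵐ[cylMeasure d T] grad T w := by
      filter_upwards [ae_all_iff.2 hDx] with z hz
      simp only [grad, hz]
    have hhess : hess T u =ᵐ[cylMeasure d T] hess T w := by
      filter_upwards [ae_all_iff.2 fun i => ae_all_iff.2 (hDxx i)] with z hz
      simp only [hess, hz]
    have hM : ∀ {F : Type} [NormedAddCommGroup F] [NormedSpace ℝ F] {g h : SpaceTime d → F}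
        (k : ℤ), g =ᵐ[cylMeasure d T] h → eLpNorm (mulM k g) 2 (cylMeasure d T) =
          eLpNorm (mulM k h) 2 (cylMeasure d T) := fun k hgh =>
      eLpNorm_congr_ae (hgh.mono fun z hz => by simp only [mulM, hz])
    rw [h2Norm, hM 1 huw, hM 1 hgrad, hM (-1) huw, eLpNorm_congr_ae hgrad, hM 1 hhess, hM 1 hDt]
    exact hest
  · obtain ⟨w, hw, hweq, -⟩ := hN _ hL lam hlam T f hf
    exact ⟨w, ⟨hw, hweq⟩, fun v hv hveq => solution_unique hδ hL hlam hv hw hveq hweq⟩
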